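/- Let $\Phi$ be the root system $B_n$ or $D_n$ in $\mathbb{R}^n$ with positive roots $\varepsilon_i\pm\varepsilon_j$ ($1\le i<j\le n$) and, for $B_n$ only, $\varepsilon_i$ ($1\le i\le n$). Put $\mathrm{col}(\varepsilon_i\pm\varepsilon_j)=\mathrm{col}(\varepsilon_i)=i$, $\mathrm{row}(\varepsilon_i\pm\varepsilon_j)=\mp j$, $\mathrm{row}(\varepsilon_i)=0$. Let $D\subset\Phi^+$ be an orthogonal rook placement, i.e. a set of pairwise orthogonal positive roots, no two of which lie in the same row or in the same column, and let $\sigma=\prod_{\beta\in D}r_\beta$ be the element of the Weyl group $W(\Phi)$ with support $D$, where $r_\beta$ is the orthogonal reflection in the hyperplane $\beta^\perp$. Let $\mathbb{F}_q$ be a finite field of odd characteristic $p\ge n$, and let $m=2n+1$ for $B_n$ and $m=2n$ for $D_n$. Number rows and columns of $m\times m$ matrices by $1,\dots,n,0,-n,\dots,-1$ (without $0$ for $D_n$). Let $U$ be the group of lower triangular matrices with ones on the diagonal that preserve the symmetric bilinear form whose matrix has ones on the antidiagonal and zeros elsewhere (a maximal unipotent subgroup of the orthogonal group), and let $\mathfrak{u}$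 be its Lie algebra, the strictly lower triangular matrices that are skew-symmetric with respect to the antidiagonal. It has the basis $e_{\varepsilon_i}=e_{0,i}-e_{-i,0}$, $e_{\varepsilon_i-\varepsilon_j}=e_{j,i}-e_{-i,-j}$, $e_{\varepsilon_i+\varepsilon_j}=e_{-j,i}-e_{-i,j}$, where $e_{a,b}$ are the matrix units; let $e_\alpha^*\in\mathfrak{u}^*$, $e_\alpha^*(x)=\frac12\mathrm{tr}(e_\alpha^tx)$, be the dual basis. For $\xi=(\xi_\beta)_{\beta\in D}$ with all $\xi_\beta\in\mathbb{F}_q^\times$, let $\Omega_{D,\xi}\subset\mathfrak{u}^*$ be the orbit of $f_{D,\xi}=\sum_{\beta\in D}\xi_\beta e_\beta^*$ under the coadjoint action $(g.f)(x)=f(g^{-1}xg)$ of $U$. Its dimension $\dim\Omega_{D,\xi}$ is the dimension of the orbit of $f_{D,\xi}$ over the algebraic closure $\overline{\mathbb{F}}_q$ as an algebraic variety. Let $l(\sigma)$ and $s(\sigma)$ be the least numbers of factors in an expression of $\sigma$ as a product of simple reflections and of arbitrary reflections $r_\alpha$, $\alpha\in\Phi$, respectively. Here the simple roots are $\varepsilon_i-\varepsilon_{i+1}$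 ($1\le i<n$), together with $\varepsilon_n$ for $B_n$ and with $\varepsilon_{n-1}+\varepsilon_n$ for $D_n$, $n\geq 2$. Let $d(\sigma)=\#\{\beta\in D\mid \mathrm{col}(\beta)>i,\ \mathrm{row}(\beta)<0\}$ if $\Phi=B_n$ and $\varepsilon_i\in D$ for some (necessarily unique) $i$, and $d(\sigma)=0$ otherwise. Then $$\dim\Omega_{D,\xi}=l(\sigma)-s(\sigma)-2d(\sigma),\qquad |\Omega_{D,\xi}|=q^{\,l(\sigma)-s(\sigma)-2d(\sigma)} .$$ In particular, $\dim\Omega_{D,\xi}$ does not depend on $\xi$. -/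

import Mathlib

/-- The two families of orthogonal root systems, `B_n` and `D_n`. -/
inductive OrthType
  | B
  | D

namespace OrthType

/-- The size `m` of the matrices: `2n+1` for `B_n` and `2n` for `D_n`. -/
def size : OrthType → ℕ → ℕ
  | B, n => 2 * n + 1
  | D, n => 2 * n

theorem le_size (X : OrthType) (n : ℕ) : n ≤ X.size n := by
  cases X <;> simp only [size] <;> omega

end OrthType

/-- The positive roots of `B_n` or `D_n`: `ε_i - ε_j` and `ε_i + ε_j` for `i < j`, and, in type `B`
only, `ε_i`. The indices run over `Fin n`, so `i : Fin n` stands for the index `i + 1`. -/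
inductive PosRoot (X : OrthType) (n : ℕ) : Type
  | sub (i j : Fin n) (h : i < j) : PosRoot X n
  | add (i j : Fin n) (h : i < j) : PosRoot X n
  | short (i : Fin n) (h : X = OrthType.B) : PosRoot X n

namespace PosRoot

variable {X : OrthType} {n : ℕ}

/-- The root as a vector of `ℝⁿ`. -/
noncomputable def vec : PosRoot X n → EuclideanSpace ℝ (Fin n)
  | sub i j _ => EuclideanSpace.single i 1 - EuclideanSpace.single j 1
  | add i j _ => EuclideanSpace.single i 1 + EuclideanSpace.single j 1
  | short i _ => EuclideanSpace.single i 1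

/-- The column of a positive root: `col(ε_i ± ε_j) = col(ε_i) = i`. -/
def col : PosRoot X n → Fin n
  | sub i _ _ => i
  | add i _ _ => i
  | short i _ => i

/-- The row of a positive root, with values in `{-n, …, n}`: `row(ε_i ± ε_j) = ∓j`,
`row(ε_i) = 0`. -/
def row : PosRoot X n → ℤ
  | sub _ j _ => (j : ℤ) + 1
  | add _ j _ => -((j : ℤ) + 1)
  | short _ _ => 0

/-- The simple roots: `ε_i - ε_{i+1}`, together with `ε_n` for `B_n` and `ε_{n-1} + ε_n`
for `D_n`. -/
def IsSimple : PosRoot X n → Prop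
  | sub i j _ => (j : ℕ) = i + 1
  | add i j _ => X = OrthType.D ∧ (j : ℕ) = i + 1 ∧ (j : ℕ) + 1 = n
  | short i _ => (i : ℕ) + 1 = n

/-- The orthogonal reflection of `ℝⁿ` in the hyperplane orthogonal to the root. -/
noncomputable def reflection (β : PosRoot X n) :
    EuclideanSpace ℝ (Fin n) ≃ₗᵢ[ℝ] EuclideanSpace ℝ (Fin n) :=
  (Submodule.span ℝ {β.vec})ᗮ.reflection

end PosRoot

/-- An orthogonal rook placement: pairwise orthogonal positive roots, at most one in each row and
at most one in each column. -/
def IsOrthogonalRookPlacement {X : OrthType} {n : ℕ} (D : Finset (PosRoot X n)) : Prop :=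
  ∀ β ∈ D, ∀ γ ∈ D, β ≠ γ →
    inner ℝ β.vec γ.vec = 0 ∧ β.row ≠ γ.row ∧ β.col ≠ γ.col

/-- The element `σ = r_{β₁} ⋯ r_{β_t}` of the Weyl group with support `D = {β₁, …, β_t}`. The
reflections in pairwise orthogonal roots commute, so the order of the factors is irrelevant. -/
noncomputable def supportInvolution {X : OrthType} {n : ℕ} (D : Finset (PosRoot X n)) :
    EuclideanSpace ℝ (Fin n) ≃ₗᵢ[ℝ] EuclideanSpace ℝ (Fin n) :=
  (D.toList.map PosRoot.reflection).prod

/-- The smallest number of factors in an expression of `g` as a product of elements of `S`. -/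
noncomputable def wordLength {G : Type*} [Group G] (S : Set G) (g : G) : ℕ :=
  sInf {k | ∃ w : List G, w.length = k ∧ (∀ s ∈ w, s ∈ S) ∧ w.prod = g}

/-- The Coxeter length `l`: the length with respect to the simple reflections. -/
noncomputable def coxeterLength (X : OrthType) (n : ℕ)
    (σ : EuclideanSpace ℝ (Fin n) ≃ₗᵢ[ℝ] EuclideanSpace ℝ (Fin n)) : ℕ :=
  wordLength (PosRoot.reflection '' {α : PosRoot X n | α.IsSimple}) σ

/-- The reflection length `s`: the length with respect to all reflections `r_α`, `α ∈ Φ`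
(note `r_{-α} = r_α`). -/
noncomputable def reflectionLength (X : OrthType) (n : ℕ)
    (σ : EuclideanSpace ℝ (Fin n) ≃ₗᵢ[ℝ] EuclideanSpace ℝ (Fin n)) : ℕ :=
  wordLength (Set.range (PosRoot.reflection : PosRoot X n → _)) σ

/-- The number `d`: if `ε_i ∈ D` (which forces type `B`), the number of `β ∈ D` with `col β > i`
and `row β < 0`; it is `0` if `D` contains no `ε_i`. An orthogonal rook placement contains at most
one root `ε_i`, because these roots all lie in the row `0`. -/
noncomputable def dNumber {X : OrthType} {n : ℕ} (D : Finset (PosRoot X n)) : ℕ :=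
  Set.ncard {β | β ∈ D ∧ β.row < 0 ∧ ∃ i h, PosRoot.short i h ∈ D ∧ i < β.col}

section Matrices

variable (X : OrthType) (n : ℕ) (K : Type*) [Field K]

/-- The matrix of the symmetric form: ones on the antidiagonal, zeros elsewhere.

Rows and columns of `m × m` matrices are numbered by `1, …, n, 0, -n, …, -1` (without `0` in type
`D`), in this order; thus `Fin.rev` is the change of sign of the index. -/
def antidiagonalForm : Matrix (Fin (X.size n)) (Fin (X.size n)) K :=
  Matrix.of fun i j => if j = i.rev then 1 else 0

/-- The Lie algebra `𝔲`: strictly lower triangular matrices in the orthogonal Lie algebra, i.e.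
skew-symmetric with respect to the antidiagonal. -/
def nilpotentAlgebra : Submodule K (Matrix (Fin (X.size n)) (Fin (X.size n)) K) where
  carrier := {x | (∀ i j, i ≤ j → x i j = 0) ∧
    x.transpose * antidiagonalForm X n K = -(antidiagonalForm X n K * x)}
  add_mem' := by
    rintro x y ⟨hx, hx'⟩ ⟨hy, hy'⟩
    refine ⟨fun i j h => by simp [hx i j h, hy i j h], ?_⟩
    rw [Matrix.transpose_add, add_mul, mul_add, hx', hy', neg_add]
  zero_mem' := by simp
  smul_mem' := by
    rintro c x ⟨hx, hx'⟩
    refine ⟨fun i j h => by simp [hx i j h], ?_⟩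
    rw [Matrix.transpose_smul, smul_mul_assoc, hx', mul_smul_comm, smul_neg]

theorem antidiagonalForm_mul_apply (x : Matrix (Fin (X.size n)) (Fin (X.size n)) K)
    (i j : Fin (X.size n)) : (antidiagonalForm X n K * x) i j = x i.rev j := by
  simp [antidiagonalForm, Matrix.mul_apply]

theorem mul_antidiagonalForm_apply (x : Matrix (Fin (X.size n)) (Fin (X.size n)) K)
    (i j : Fin (X.size n)) : (x * antidiagonalForm X n K) i j = x i j.rev := by
  have h : ∀ k : Fin (X.size n), j = k.rev ↔ k = j.rev := fun k =>
    ⟨fun e => by rw [e, Fin.rev_rev], fun e => by rw [e, Fin.rev_rev]⟩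
  simp [antidiagonalForm, Matrix.mul_apply, h]

theorem mem_nilpotentAlgebra_iff (x : Matrix (Fin (X.size n)) (Fin (X.size n)) K) :
    x ∈ nilpotentAlgebra X n K ↔
      (∀ i j, i ≤ j → x i j = 0) ∧ ∀ i j, x j.rev i.rev = -x i j := by
  refine and_congr_right fun _ => ?_
  rw [← Matrix.ext_iff]
  simp only [Matrix.neg_apply, mul_antidiagonalForm_apply, antidiagonalForm_mul_apply,
    Matrix.transpose_apply]
  constructor
  · intro h i j
    have := h i.rev j
    rwa [Fin.rev_rev] at this
  · intro h i j
    have := h i.rev j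
    rwa [Fin.rev_rev] at this

/-- The maximal unipotent subgroup `U` of the orthogonal group: lower triangular matrices with ones
on the diagonal which preserve the symmetric form. -/
def unipotentGroup : Subgroup (Matrix.GeneralLinearGroup (Fin (X.size n)) K) where
  carrier := {g | (∀ i j, i < j → g.val i j = 0) ∧ (∀ i, g.val i i = 1) ∧
    g.val.transpose * antidiagonalForm X n K * g.val = antidiagonalForm X n K}
  mul_mem' := by
    rintro g h ⟨hg, hg1, hgJ⟩ ⟨hh, hh1, hhJ⟩
    refine ⟨fun i j hij => ?_, fun i => ?_, ?_⟩
    · rw [Units.val_mul, Matrix.mul_apply]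
      refine Finset.sum_eq_zero fun k _ => ?_
      rcases lt_or_ge i k with hk | hk
      · rw [hg i k hk, zero_mul]
      · rw [hh k j (hk.trans_lt hij), mul_zero]
    · rw [Units.val_mul, Matrix.mul_apply, Finset.sum_eq_single i, hg1, hh1, one_mul]
      · intro k _ hk
        rcases lt_or_gt_of_ne hk with hk | hk
        · rw [hh k i hk, mul_zero]
        · rw [hg i k hk, zero_mul]
      · simp
    · rw [Units.val_mul, Matrix.transpose_mul]
      calc _ = h.val.transpose * (g.val.transpose * antidiagonalForm X n K * g.val) * h.val := by
            simp only [mul_assoc]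
        _ = _ := by rw [hgJ, hhJ]
  one_mem' := by
    refine ⟨fun i j h => ?_, fun i => ?_, ?_⟩
    · simp [h.ne]
    · simp
    · simp
  inv_mem' := by
    rintro g ⟨hg, hg1, hgJ⟩
    have key : antidiagonalForm X n K * (g⁻¹).val = g.val.transpose * antidiagonalForm X n K := by
      calc antidiagonalForm X n K * (g⁻¹).val
          = g.val.transpose * antidiagonalForm X n K * (g.val * (g⁻¹).val) := by
            rw [← mul_assoc, hgJ]
        _ = _ := by rw [Units.mul_inv, mul_one]
    have entry : ∀ i j, (g⁻¹).val i j = g.val j.rev i.rev := by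
      intro i j
      have h := congrFun (congrFun key i.rev) j
      rwa [antidiagonalForm_mul_apply, mul_antidiagonalForm_apply, Fin.rev_rev,
        Matrix.transpose_apply] at h
    refine ⟨fun i j h => ?_, fun i => ?_, ?_⟩
    · rw [entry]
      exact hg _ _ (Fin.rev_lt_rev.mpr h)
    · rw [entry, hg1]
    · rw [mul_assoc, key, ← mul_assoc, ← Matrix.transpose_mul, Units.mul_inv,
        Matrix.transpose_one, one_mul]

variable {X n K} in
/-- `𝔲` is stable under conjugation by `U`. -/
theorem conj_mem_nilpotentAlgebra {g : Matrix.GeneralLinearGroup (Fin (X.size n)) K}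
    (hg : g ∈ unipotentGroup X n K) {x : Matrix (Fin (X.size n)) (Fin (X.size n)) K}
    (hx : x ∈ nilpotentAlgebra X n K) :
    g.val * x * (g⁻¹).val ∈ nilpotentAlgebra X n K := by
  have hgi := (unipotentGroup X n K).inv_mem hg
  obtain ⟨hl, -, hJ⟩ := hg
  obtain ⟨hil, -, hiJ⟩ := hgi
  obtain ⟨hx0, hxJ⟩ := hx
  have key : antidiagonalForm X n K * (g⁻¹).val = g.val.transpose * antidiagonalForm X n K := by
    calc antidiagonalForm X n K * (g⁻¹).val
        = g.val.transpose * antidiagonalForm X n K * (g.val * (g⁻¹).val) := by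
          rw [← mul_assoc, hJ]
      _ = _ := by rw [Units.mul_inv, mul_one]
  have key' : antidiagonalForm X n K * g.val
      = (g⁻¹).val.transpose * antidiagonalForm X n K := by
    calc antidiagonalForm X n K * g.val
        = (g⁻¹).val.transpose * antidiagonalForm X n K * ((g⁻¹).val * g.val) := by
          rw [← mul_assoc, hiJ]
      _ = _ := by rw [Units.inv_mul, mul_one]
  refine ⟨fun i j hij => ?_, ?_⟩
  · rw [Matrix.mul_apply]
    refine Finset.sum_eq_zero fun k _ => ?_
    rcases lt_or_ge k j with hk | hk
    · rw [hil k j hk, mul_zero]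
    · rw [Matrix.mul_apply, Finset.sum_eq_zero, zero_mul]
      intro a _
      rcases lt_or_ge i a with ha | ha
      · rw [hl i a ha, zero_mul]
      · rw [hx0 a k (ha.trans (hij.trans hk)), mul_zero]
  · calc (g.val * x * (g⁻¹).val).transpose * antidiagonalForm X n K
        = (g⁻¹).val.transpose * (x.transpose * (g.val.transpose * antidiagonalForm X n K)) := by
          simp only [Matrix.transpose_mul, mul_assoc]
      _ = (g⁻¹).val.transpose * ((x.transpose * antidiagonalForm X n K) * (g⁻¹).val) := by
          rw [← key, mul_assoc]
      _ = -((g⁻¹).val.transpose * antidiagonalForm X n K * (x * (g⁻¹).val)) := by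
          rw [hxJ]; simp only [neg_mul, mul_neg, mul_assoc]
      _ = _ := by rw [← key']; simp only [mul_assoc]

/-- The adjoint action of `U` on `𝔲`: `g` acts by `x ↦ g x g⁻¹`. -/
noncomputable def adjointRep : Representation K (unipotentGroup X n K) (nilpotentAlgebra X n K) where
  toFun g :=
    { toFun := fun x => ⟨g.1.val * x.1 * (g.1⁻¹).val, conj_mem_nilpotentAlgebra g.2 x.2⟩
      map_add' := fun x y => by ext1; simp only [Submodule.coe_add, mul_add, add_mul]
      map_smul' := fun c x => by
        ext1; simp only [Submodule.coe_smul, mul_smul_comm, smul_mul_assoc, RingHom.id_apply] }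
  map_one' := by
    ext1 x
    apply Subtype.ext
    simp
  map_mul' g h := by
    ext1 x
    apply Subtype.ext
    simp [mul_assoc]

/-- The coadjoint action of `U` on `𝔲*`: `(g.f)(x) = f(g⁻¹ x g)`. -/
noncomputable def coadjointRep :
    Representation K (unipotentGroup X n K) (Module.Dual K (nilpotentAlgebra X n K)) :=
  (adjointRep X n K).dual

/-- The orbit of a linear form on `𝔲` under the coadjoint action of `U`. -/
def coadjointOrbit (f : Module.Dual K (nilpotentAlgebra X n K)) :
    Set (Module.Dual K (nilpotentAlgebra X n K)) :=
  Set.range fun g : unipotentGroup X n K => coadjointRep X n K g f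

end Matrices

namespace PosRoot

variable {X : OrthType} {n : ℕ}

/-- The position in `1, …, n, 0, -n, …, -1` of the positive index `i`. -/
def posIndex (X : OrthType) {n : ℕ} (i : Fin n) : Fin (X.size n) :=
  Fin.castLE (X.le_size n) i

/-- The position in `1, …, n, 0, -n, …, -1` of the row of a positive root. -/
def rowIndex : PosRoot X n → Fin (X.size n)
  | sub _ j _ => posIndex X j
  | add _ j _ => (posIndex X j).rev
  | short _ h => ⟨n, by subst h; simp only [OrthType.size]; omega⟩

/-- The root vectors `e_α = e_{a,b} - e_{-b,-a}` with `a = row α` and `b = col α`, i.e.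
`e_{ε_i} = e_{0,i} - e_{-i,0}`, `e_{ε_i-ε_j} = e_{j,i} - e_{-i,-j}` and
`e_{ε_i+ε_j} = e_{-j,i} - e_{-i,j}`. -/
def rootMatrix (K : Type*) [Field K] (α : PosRoot X n) :
    Matrix (Fin (X.size n)) (Fin (X.size n)) K :=
  Matrix.single α.rowIndex (posIndex X α.col) 1
    - Matrix.single (posIndex X α.col).rev α.rowIndex.rev 1

theorem posIndex_col_lt_rowIndex (α : PosRoot X n) : posIndex X α.col < α.rowIndex := by
  rcases α with ⟨i, j, h⟩ | ⟨i, j, h⟩ | ⟨i, h⟩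
  · exact h
  · have hi := i.2
    have hj := j.2
    rw [Fin.lt_def]
    simp only [col, rowIndex, posIndex, Fin.val_rev, Fin.val_castLE]
    have h' : (i : ℕ) < j := h
    cases X <;> simp only [OrthType.size] <;> omega
  · exact i.2

theorem rootMatrix_mem (K : Type*) [Field K] (α : PosRoot X n) :
    α.rootMatrix K ∈ nilpotentAlgebra X n K := by
  rw [mem_nilpotentAlgebra_iff]
  have hlt := α.posIndex_col_lt_rowIndex
  have hlt' := Fin.rev_lt_rev.mpr hlt
  have e1 : ∀ a b : Fin (X.size n), a = b.rev ↔ a.rev = b := fun a b =>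
    ⟨fun e => by rw [e, Fin.rev_rev], fun e => by rw [← e, Fin.rev_rev]⟩
  constructor
  · intro i j hij
    rw [rootMatrix, Matrix.sub_apply, Matrix.single_apply_of_ne, Matrix.single_apply_of_ne,
      sub_zero]
    · rintro ⟨rfl, rfl⟩
      exact absurd hij (not_le.mpr hlt')
    · rintro ⟨rfl, rfl⟩
      exact absurd hij (not_le.mpr hlt)
  · intro i j
    simp only [rootMatrix, Matrix.sub_apply, Matrix.single_apply, e1, Fin.rev_rev]
    rw [neg_sub]
    congr 1 <;> simp only [and_comm]

/-- The root vector `e_α` as an element of `𝔲`. -/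
def rootVector (K : Type*) [Field K] (α : PosRoot X n) : nilpotentAlgebra X n K :=
  ⟨α.rootMatrix K, α.rootMatrix_mem K⟩

/-- The linear form `e_α^*` on `𝔲`, given by `x ↦ ½ tr(e_αᵗ x)`. -/
noncomputable def dualVector (K : Type*) [Field K] (α : PosRoot X n) :
    Module.Dual K (nilpotentAlgebra X n K) :=
  (2 : K)⁻¹ • (Matrix.traceLinearMap (Fin (X.size n)) K K ∘ₗ
    LinearMap.mulLeft K (α.rootMatrix K).transpose ∘ₗ (nilpotentAlgebra X n K).subtype)

end PosRoot

/-- The canonical form `f_{D,ξ} = ∑_{β ∈ D} ξ_β e_β^*`. -/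
noncomputable def canonicalForm {X : OrthType} {n : ℕ} {K : Type*} [Field K]
    (D : Finset (PosRoot X n)) (ξ : D → K) : Module.Dual K (nilpotentAlgebra X n K) :=
  ∑ β : D, ξ β • β.1.dualVector K

/-- The coadjoint orbit `Ω_{D,ξ}` associated with `D`. -/
def associatedOrbit {X : OrthType} {n : ℕ} {K : Type*} [Field K]
    (D : Finset (PosRoot X n)) (ξ : D → K) : Set (Module.Dual K (nilpotentAlgebra X n K)) :=
  coadjointOrbit X n K (canonicalForm D ξ)

/-- The dimension of a subset `V` of an affine space over an algebraically closed field `K`, that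
is, of its Zariski closure: the largest number of algebraically independent elements of the
coordinate ring `K[V]`, the ring of polynomials modulo those vanishing on `V`. -/
noncomputable def varietyDim {ι K : Type*} [Field K] (V : Set (ι → K)) : Cardinal :=
  Algebra.trdeg K (MvPolynomial ι K ⧸ MvPolynomial.vanishingIdeal K V)

/-- The dimension of the orbit `Ω_{D,ξ}` over a field `F`: the dimension of the orbit of the same
linear form over the algebraic closure of `F`, which is a subset of the affine space `𝔲*` with the
coordinates `h ↦ h(e_α)`, `α ∈ Φ⁺`. -/
noncomputable def orbitDim {X : OrthType} {n : ℕ} {F : Type*} [Field F]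
    (D : Finset (PosRoot X n)) (ξ : D → F) : Cardinal :=
  varietyDim ((fun (h : Module.Dual (AlgebraicClosure F) (nilpotentAlgebra X n (AlgebraicClosure F)))
      (α : PosRoot X n) => h (α.rootVector (AlgebraicClosure F))) ''
    associatedOrbit D fun β => algebraMap F (AlgebraicClosure F) (ξ β))

/-!
The rows and columns `1, …, n, 0, -n, …, -1` are the *positions*, and `Fin.rev` is the change of
sign. A positive root is a pair of positions `(x, y)` with `x < y` and `y ≠ -x`, up to the
symmetry `(x, y) ↦ (-y, -x)`; it is normalized by `x = col < y = row < -x`. Orthogonality and the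
rook condition together imply that the roots of `D` have disjoint supports among the positions
(`IsOrthogonalRookPlacement.eq_of_meets`).

All quantities are expressed by the set `decompositions D` of certain decompositions of the roots
`β ∈ D` into two positive roots, at `(col β, z)` and at `(z, row β)`: those for which `z` does not
belong to the support of a root of `D` with a smaller column. Each of the three claims below gives
the number `2 |decompositions D|`.

* In the Weyl group, `s(σ) = |D|`, since `σ` changes the signs of `|D|` orthogonal vectors, and
  `l(σ)` is the number of positive roots inverted by `σ`. An inverted root outside of `D` involves
  a position of a `β ∈ D` and a position `z` that is *high* for `β`, and these inverted roots come
  in pairs. The high positions differ from those occurring in `decompositions D` only at `z = 0`,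
  and this difference is `d(σ)`. Hence `l(σ) = |D| + 2 |decompositions D| + 2 d(σ)`
  (`inversions_supportPerm`).

* In the Lie algebra, the radical of the form `(u, v) ↦ f([u, v])`, where `f = f_{D,ξ}`, has
  codimension `2 |decompositions D|` (`finrank_radical`). Every pair of positive roots with sum in
  `D` contains one of the distinguished roots at `(z, row β)`, so `u` lies in the radical once its
  coordinates at these roots and its products with their root vectors vanish; and the matrix of
  the form at the distinguished root vectors is block triangular with invertible blocks.

* In the group, the condition for `g ∈ U` to fix `f` is linear in the matrix `g`, and it is the
  condition that defines the radical (`coadjointRep_canonicalForm_eq_iff`). As the condition is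
  preserved by products and inverses, the Cayley transform `x ↦ (1 + x)(1 - x)⁻¹` maps the radical
  onto the stabilizer, just as it maps `𝔲` onto `U`. This replaces the exponential map and
  requires only that `2` is invertible. Over a finite field the number of points of the orbit
  follows (`ncard_associatedOrbit`).

For the dimension over an infinite field, every element of `U` is written as a product of Cayley
transforms of elements of a complement of the radical, one for each step of the filtration by the
distance from the diagonal, and of an element of the stabilizer (`exists_parametrization`). So the
orbit is the image of an affine space of dimension `2 |decompositions D|` under a polynomial map.
Conversely, the curves `s ↦ cayley (s w) . f` have enough tangent vectors at `f` for the
coordinates at the members of the distinguished decompositions to be algebraically independent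
(`card_le_varietyDim`).
-/

/-! ### Positive roots as pairs of positions -/

section

namespace PosRoot

variable {X : OrthType} {n : ℕ}

theorem size_cases (X : OrthType) (n : ℕ) :
    (X = OrthType.B ∧ X.size n = 2 * n + 1) ∨ (X = OrthType.D ∧ X.size n = 2 * n) := by
  cases X
  · exact Or.inl ⟨rfl, rfl⟩
  · exact Or.inr ⟨rfl, rfl⟩

/-- The position in `1, …, n, 0, -n, …, -1` of the column of a positive root. -/
def colIndex (α : PosRoot X n) : Fin (X.size n) :=
  posIndex X α.col

theorem colIndex_val (α : PosRoot X n) : (α.colIndex : ℕ) = α.col := rfl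

theorem rowIndex_sub_val (i j : Fin n) (h : i < j) :
    ((sub i j h : PosRoot X n).rowIndex : ℕ) = j := rfl

theorem rowIndex_add_val (i j : Fin n) (h : i < j) :
    ((add i j h : PosRoot X n).rowIndex : ℕ) = X.size n - (j + 1) := rfl

theorem rowIndex_short_val (i : Fin n) (h : X = OrthType.B) :
    ((short i h : PosRoot X n).rowIndex : ℕ) = n := rfl

theorem colIndex_lt_rowIndex (α : PosRoot X n) : α.colIndex < α.rowIndex :=
  α.posIndex_col_lt_rowIndex

theorem rowIndex_lt_rev_colIndex (α : PosRoot X n) : α.rowIndex < α.colIndex.rev := by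
  have hs := size_cases X n
  rw [Fin.lt_def, Fin.val_rev, colIndex_val]
  rcases α with ⟨i, j, h⟩ | ⟨i, j, h⟩ | ⟨i, h⟩
  · have hi := i.2
    have hj := j.2
    have h' : (i : ℕ) < j := h
    simp only [col, rowIndex_sub_val]
    omega
  · have hi := i.2
    have hj := j.2
    have h' : (i : ℕ) < j := h
    simp only [col, rowIndex_add_val]
    omega
  · have hi := i.2
    simp only [col, rowIndex_short_val]
    subst h
    simp only [OrthType.size]
    omega

/-- A positive root is determined by the positions of its column and of its row. -/
theorem ext_index {α β : PosRoot X n} (h : α.colIndex = β.colIndex)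
    (h' : α.rowIndex = β.rowIndex) : α = β := by
  have hs := size_cases X n
  rw [Fin.ext_iff, colIndex_val, colIndex_val] at h
  rw [Fin.ext_iff] at h'
  rcases α with ⟨i, j, hij⟩ | ⟨i, j, hij⟩ | ⟨i, hi⟩ <;>
  rcases β with ⟨k, l, hkl⟩ | ⟨k, l, hkl⟩ | ⟨k, hk⟩ <;>
  simp only [col, rowIndex_sub_val, rowIndex_add_val, rowIndex_short_val] at h h'
  case sub.sub => congr 1 <;> ext <;> omega
  case add.add => congr 1 <;> ext <;> omega
  case short.short => congr 1; ext; omega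
  all_goals
    exfalso
    first
    | (have h1 := j.2; have h2 := l.2; omega)
    | (have h1 := j.2; subst hk; simp only [OrthType.size] at *; omega)
    | (have h1 := l.2; subst hi; simp only [OrthType.size] at *; omega)

/-- Positive roots correspond to pairs of positions `c < r < -c`. -/
theorem exists_of_lt {c r : Fin (X.size n)} (h : c < r) (h' : r < c.rev) :
    ∃ α : PosRoot X n, α.colIndex = c ∧ α.rowIndex = r := by
  have hr := r.2
  rw [Fin.lt_def] at h h'
  rw [Fin.val_rev] at h'
  have hcn : (c : ℕ) < n := by
    cases X <;> simp only [OrthType.size] at * <;> omega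
  rcases lt_or_ge (r : ℕ) n with hrn | hrn
  · exact ⟨sub ⟨c, hcn⟩ ⟨r, hrn⟩ h, rfl, rfl⟩
  · rcases lt_or_ge (X.size n - (r + 1) : ℕ) n with hrn' | hrn'
    · refine ⟨add ⟨c, hcn⟩ ⟨X.size n - (r + 1), hrn'⟩ (by rw [Fin.lt_def]; simp only; omega),
        rfl, ?_⟩
      ext
      simp only [rowIndex, posIndex, Fin.val_rev, Fin.val_castLE]
      omega
    · have hX : X = OrthType.B := by
        cases X
        · rfl
        · simp only [OrthType.size] at *; omega
      refine ⟨short ⟨c, hcn⟩ hX, rfl, ?_⟩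
      subst hX
      ext
      simp only [rowIndex, OrthType.size] at *
      omega

instance : Finite (PosRoot X n) :=
  Finite.of_injective (fun α : PosRoot X n => (α.colIndex, α.rowIndex)) fun α β h => by
    simp only [Prod.mk.injEq] at h
    exact ext_index h.1 h.2

noncomputable instance : Fintype (PosRoot X n) := Fintype.ofFinite _

noncomputable instance : DecidableEq (PosRoot X n) := Classical.decEq _

/-- The position `x` belongs to the support of `α`: it is one of `±col α`, `±row α`. The support of
`ε_i` thus contains the position `0`. -/
def Meets (α : PosRoot X n) (x : Fin (X.size n)) : Prop :=
  x = α.colIndex ∨ x = α.rowIndex ∨ x = α.colIndex.rev ∨ x = α.rowIndex.rev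

theorem meets_colIndex (α : PosRoot X n) : α.Meets α.colIndex := Or.inl rfl

theorem meets_rowIndex (α : PosRoot X n) : α.Meets α.rowIndex := Or.inr (Or.inl rfl)

theorem Meets.rev {α : PosRoot X n} {x : Fin (X.size n)} (h : α.Meets x) : α.Meets x.rev := by
  rcases h with rfl | rfl | rfl | rfl <;> simp [Meets]

theorem meets_rev_iff {α : PosRoot X n} {x : Fin (X.size n)} : α.Meets x.rev ↔ α.Meets x :=
  ⟨fun h => by simpa using h.rev, Meets.rev⟩

end PosRoot

open PosRoot in
/-- Distinct roots of an orthogonal rook placement have disjoint supports. -/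
theorem IsOrthogonalRookPlacement.eq_of_meets {X : OrthType} {n : ℕ} {D : Finset (PosRoot X n)}
    (hD : IsOrthogonalRookPlacement D) {β γ : PosRoot X n} (hβ : β ∈ D) (hγ : γ ∈ D)
    {x : Fin (X.size n)} (h : β.Meets x) (h' : γ.Meets x) : β = γ := by
  by_contra hne
  obtain ⟨h1, h2, h3⟩ := hD β hβ γ hγ hne
  have hx := x.2
  have hs := size_cases X n
  simp only [Meets, Fin.ext_iff, Fin.val_rev, colIndex_val] at h h'
  rcases β with ⟨i, j, hij⟩ | ⟨i, j, hij⟩ | ⟨i, hi⟩ <;>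
  rcases γ with ⟨k, l, hkl⟩ | ⟨k, l, hkl⟩ | ⟨k, hk⟩ <;>
  simp only [col, row, vec, inner_sub_left, inner_sub_right, inner_add_left, inner_add_right,
    EuclideanSpace.inner_single_left, PiLp.single_apply, map_one, one_mul,
    rowIndex_sub_val, rowIndex_add_val, rowIndex_short_val, Fin.ext_iff, ne_eq]
    at h h' h1 h2 h3
  case short.short => exact h2 trivial
  all_goals
    have h5 := k.2
    have h6 := i.2
    try have h7 := j.2
    try have h8 := l.2
    try rw [Fin.lt_def] at hij
    try rw [Fin.lt_def] at hkl
    try have h9 : X.size n = 2 * n + 1 := by rw [hi]; rfl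
    try have h9 : X.size n = 2 * n + 1 := by rw [hk]; rfl
    split_ifs at h1 <;> first | omega | (norm_num at h1)

end

/-! ### Reflections as permutations of the positions -/

section

namespace PosRoot

variable {X : OrthType} {n : ℕ}

theorem posIndex_injective : Function.Injective (posIndex X (n := n)) := fun i j h => by
  simpa [posIndex, Fin.ext_iff] using h

theorem posIndex_ne_rev (i j : Fin n) : posIndex X i ≠ (posIndex X j).rev := by
  have hs := size_cases X n
  have hi := i.2
  have hj := j.2
  rw [Ne, Fin.ext_iff, Fin.val_rev]
  simp only [posIndex, Fin.val_castLE]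
  omega

/-- Every position is `i`, `-i` or `0`. -/
theorem position_cases (x : Fin (X.size n)) :
    (∃ i, x = posIndex X i) ∨ (∃ i, x = (posIndex X i).rev) ∨ x = x.rev := by
  have hs := size_cases X n
  have hx := x.2
  rcases lt_trichotomy (x : ℕ) (x.rev : ℕ) with h | h | h
  · rw [Fin.val_rev] at h
    exact Or.inl ⟨⟨x, by omega⟩, rfl⟩
  · exact Or.inr (Or.inr (Fin.ext h))
  · refine Or.inr (Or.inl ⟨⟨x.rev, by rw [Fin.val_rev] at *; omega⟩, ?_⟩)
    rw [Fin.ext_iff, Fin.val_rev]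
    simp only [posIndex, Fin.val_castLE, Fin.val_rev]
    omega

/-- The vector of `ℝⁿ` at a position: `ε_i` at the position `i`, `-ε_i` at `-i`, and `0` at `0`. -/
noncomputable def vecAt (x : Fin (X.size n)) : EuclideanSpace ℝ (Fin n) :=
  WithLp.toLp 2 fun i =>
    (if x = posIndex X i then 1 else 0) - (if x = (posIndex X i).rev then 1 else 0)

theorem vecAt_apply (x : Fin (X.size n)) (i : Fin n) :
    vecAt x i = (if x = posIndex X i then 1 else 0) - (if x = (posIndex X i).rev then 1 else 0) :=
  rfl

theorem vecAt_rev (x : Fin (X.size n)) : vecAt x.rev = -vecAt x := by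
  ext i
  rw [PiLp.neg_apply, vecAt_apply, vecAt_apply, neg_sub]
  simp only [Fin.rev_eq_iff, Fin.rev_rev]

theorem vecAt_posIndex (i : Fin n) : vecAt (posIndex X i) = EuclideanSpace.single i 1 := by
  ext j
  rw [vecAt_apply, if_neg (posIndex_ne_rev i j), sub_zero, PiLp.single_apply]
  simp only [posIndex_injective.eq_iff, eq_comm]

theorem vecAt_of_eq_rev {x : Fin (X.size n)} (h : x = x.rev) : vecAt x = 0 := by
  have := vecAt_rev x
  rw [← h] at this
  ext i
  have h' := congrArg (fun v => v i) this
  simp only [PiLp.neg_apply] at h'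
  simp only [PiLp.zero_apply]
  linarith

theorem vec_eq (α : PosRoot X n) : α.vec = vecAt α.colIndex - vecAt α.rowIndex := by
  rcases α with ⟨i, j, h⟩ | ⟨i, j, h⟩ | ⟨i, h⟩
  · rw [vec, ← vecAt_posIndex (X := X), ← vecAt_posIndex (X := X)]; rfl
  · rw [vec, ← vecAt_posIndex (X := X), ← vecAt_posIndex (X := X), rowIndex, vecAt_rev,
      sub_neg_eq_add]; rfl
  · rw [vec, ← vecAt_posIndex (X := X), vecAt_of_eq_rev (x := rowIndex _), sub_zero]
    · rfl
    · subst h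
      rw [Fin.ext_iff, Fin.val_rev, rowIndex_short_val]
      simp only [OrthType.size]
      omega

theorem inner_vecAt (x y : Fin (X.size n)) :
    inner ℝ (vecAt x) (vecAt y) = (if x = y then 1 else 0) - (if x = y.rev then 1 else 0 : ℝ) := by
  rcases position_cases y with ⟨j, rfl⟩ | ⟨j, rfl⟩ | h
  · rw [vecAt_posIndex, EuclideanSpace.inner_single_right, vecAt_apply]
    simp
  · rw [vecAt_rev, inner_neg_right, vecAt_posIndex, EuclideanSpace.inner_single_right, vecAt_apply,
      Fin.rev_rev]
    simp
  · rw [vecAt_of_eq_rev h, inner_zero_right, ← h, sub_self]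

theorem norm_vecAt {x : Fin (X.size n)} (h : x ≠ x.rev) : ‖vecAt x‖ = 1 := by
  have := real_inner_self_eq_norm_sq (vecAt x)
  rw [inner_vecAt, if_pos rfl, if_neg h, sub_zero] at this
  nlinarith [norm_nonneg (vecAt x)]

theorem vecAt_injective : Function.Injective (vecAt : Fin (X.size n) → _) := fun x y h => by
  by_contra hne
  have h1 := inner_vecAt x x
  rw [if_pos rfl] at h1
  have h2 := inner_vecAt x y
  rw [← h, h1, if_neg hne] at h2
  have h5 : x = x.rev := by
    by_contra hx
    rw [if_neg hx] at h2
    split_ifs at h2 <;> norm_num at h2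
  have h6 : y = y.rev := by
    by_contra hy
    have := norm_vecAt hy
    rw [← h, vecAt_of_eq_rev h5, norm_zero] at this
    exact zero_ne_one this
  apply hne
  rw [Fin.ext_iff, Fin.val_rev] at *
  have := x.2
  have := y.2
  omega

/-- The position of the vector `r_α(ε_i)`, where `i = col α`: the row `∓j` of `ε_i ± ε_j`, and `-i`
for `ε_i`. -/
def target (α : PosRoot X n) : Fin (X.size n) :=
  if α.rowIndex = α.rowIndex.rev then α.colIndex.rev else α.rowIndex

theorem colIndex_lt_target (α : PosRoot X n) : α.colIndex < α.target := by
  have h1 := α.colIndex_lt_rowIndex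
  have h2 := α.rowIndex_lt_rev_colIndex
  rw [target]
  split_ifs
  · exact h1.trans h2
  · exact h1

theorem target_ne_rev (α : PosRoot X n) : α.target ≠ α.target.rev := by
  have h1 := α.colIndex_lt_rowIndex
  have h2 := α.rowIndex_lt_rev_colIndex
  rw [target]
  split_ifs with h
  · rw [Fin.rev_rev]
    exact (h1.trans h2).ne'
  · exact h

theorem colIndex_ne_rev (α : PosRoot X n) : α.colIndex ≠ α.colIndex.rev :=
  (α.colIndex_lt_rowIndex.trans α.rowIndex_lt_rev_colIndex).ne

/-- The permutation of the positions induced by the reflection `r_α`. -/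
def perm (α : PosRoot X n) : Equiv.Perm (Fin (X.size n)) :=
  Equiv.swap α.colIndex α.target *
    (if α.target = α.colIndex.rev then 1 else Equiv.swap α.colIndex.rev α.target.rev)

theorem perm_cases (α : PosRoot X n) (x : Fin (X.size n)) :
    (x = α.colIndex ∧ α.perm x = α.target) ∨ (x = α.target ∧ α.perm x = α.colIndex) ∨
    (x = α.colIndex.rev ∧ α.perm x = α.target.rev) ∨
    (x = α.target.rev ∧ α.perm x = α.colIndex.rev) ∨
    (x ≠ α.colIndex ∧ x ≠ α.target ∧ x ≠ α.colIndex.rev ∧ x ≠ α.target.rev ∧ α.perm x = x) := by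
  have h1 := α.colIndex_lt_target.ne
  have h2 := α.target_ne_rev
  have h3 := α.colIndex_ne_rev
  rw [perm]
  split_ifs with h
  · simp only [h, Fin.rev_rev, mul_one]
    simp only [Equiv.swap_apply_def]
    split_ifs <;> simp_all
  · have h4 : α.colIndex ≠ α.target.rev := fun e => h (by rw [e, Fin.rev_rev])
    simp only [Equiv.Perm.mul_apply, Equiv.swap_apply_def]
    split_ifs <;> simp_all

theorem perm_colIndex (α : PosRoot X n) : α.perm α.colIndex = α.target := by
  have h1 := α.colIndex_lt_target.ne
  have h3 := α.colIndex_ne_rev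
  have := α.perm_cases α.colIndex
  grind

theorem perm_of_ne (α : PosRoot X n) {x : Fin (X.size n)} (h1 : x ≠ α.colIndex)
    (h2 : x ≠ α.target) (h3 : x ≠ α.colIndex.rev) (h4 : x ≠ α.target.rev) : α.perm x = x := by
  have := α.perm_cases x
  grind

theorem meets_target (α : PosRoot X n) : α.Meets α.target := by
  rw [target]
  split_ifs
  · exact α.meets_colIndex.rev
  · exact α.meets_rowIndex

theorem perm_of_not_meets (α : PosRoot X n) {x : Fin (X.size n)} (h : ¬ α.Meets x) :
    α.perm x = x := by
  refine α.perm_of_ne ?_ ?_ ?_ ?_ <;> rintro rfl <;> apply h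
  · exact α.meets_colIndex
  · exact α.meets_target
  · exact α.meets_colIndex.rev
  · exact α.meets_target.rev

theorem Meets.perm {α : PosRoot X n} {x : Fin (X.size n)} (h : α.Meets x) :
    α.Meets (α.perm x) := by
  rcases α.perm_cases x with ⟨-, e⟩ | ⟨-, e⟩ | ⟨-, e⟩ | ⟨-, e⟩ | ⟨-, -, -, -, e⟩ <;> rw [e]
  · exact α.meets_target
  · exact α.meets_colIndex
  · exact α.meets_target.rev
  · exact α.meets_colIndex.rev
  · exact h

theorem span_vec (α : PosRoot X n) :
    Submodule.span ℝ {α.vec} = Submodule.span ℝ {vecAt α.colIndex - vecAt α.target} := by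
  rw [vec_eq, target]
  split_ifs with h
  · rw [vecAt_of_eq_rev h, vecAt_rev, sub_zero, sub_neg_eq_add, ← two_smul ℝ,
      Submodule.span_singleton_smul_eq (by simp)]
  · rfl

theorem reflection_eq (α : PosRoot X n) : α.reflection =
    (Submodule.span ℝ {vecAt α.colIndex - vecAt α.target})ᗮ.reflection := by
  simp only [reflection, span_vec]

theorem reflection_vecAt (α : PosRoot X n) (x : Fin (X.size n)) :
    α.reflection (vecAt x) = vecAt (α.perm x) := by
  have hn : ‖vecAt α.colIndex‖ = ‖vecAt α.target‖ := by
    rw [norm_vecAt α.colIndex_ne_rev, norm_vecAt α.target_ne_rev]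
  have h1 : α.reflection (vecAt α.colIndex) = vecAt α.target := by
    rw [reflection_eq]
    exact Submodule.reflection_sub hn
  have h2 : α.reflection (vecAt α.target) = vecAt α.colIndex := by
    rw [← h1]
    exact Submodule.reflection_reflection _ _
  rcases α.perm_cases x with ⟨e, e'⟩ | ⟨e, e'⟩ | ⟨e, e'⟩ | ⟨e, e'⟩ | ⟨n1, n2, n3, n4, e'⟩ <;>
  rw [e']
  · rw [e, h1]
  · rw [e, h2]
  · rw [e, vecAt_rev, vecAt_rev, map_neg, h1]
  · rw [e, vecAt_rev, vecAt_rev, map_neg, h2]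
  · rw [reflection_eq]
    apply Submodule.reflection_mem_subspace_eq_self
    rw [Submodule.mem_orthogonal_singleton_iff_inner_left, inner_sub_right, inner_vecAt,
      inner_vecAt, if_neg n1, if_neg n2, if_neg n3, if_neg n4]
    simp

theorem reflection_vec (α : PosRoot X n) : α.reflection α.vec = -α.vec :=
  Submodule.reflection_orthogonalComplement_singleton_eq_neg _

theorem vec_ne_zero (α : PosRoot X n) : α.vec ≠ 0 := by
  rw [vec_eq, sub_ne_zero]
  exact fun h => α.colIndex_lt_rowIndex.ne (vecAt_injective h)

/-- The isometry `g` permutes the vectors `±ε_i` in the way in which `w` permutes the positions. -/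
def Represents (g : EuclideanSpace ℝ (Fin n) ≃ₗᵢ[ℝ] EuclideanSpace ℝ (Fin n))
    (w : Equiv.Perm (Fin (X.size n))) : Prop :=
  ∀ x, g (vecAt x) = vecAt (w x)

theorem represents_reflection (α : PosRoot X n) : Represents α.reflection α.perm :=
  α.reflection_vecAt

theorem Represents.one : Represents (X := X) (n := n) 1 1 := fun _ => rfl

theorem Represents.mul {g g' : EuclideanSpace ℝ (Fin n) ≃ₗᵢ[ℝ] EuclideanSpace ℝ (Fin n)}
    {w w' : Equiv.Perm (Fin (X.size n))} (h : Represents g w) (h' : Represents g' w') :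
    Represents (g * g') (w * w') := fun x => by
  change g (g' _) = _
  rw [h', h, Equiv.Perm.mul_apply]

theorem Represents.list_prod (l : List (PosRoot X n)) :
    Represents (l.map reflection).prod (l.map perm).prod := by
  induction l with
  | nil => exact Represents.one
  | cons a l ih => simpa using (represents_reflection a).mul ih

theorem Represents.rev {g : EuclideanSpace ℝ (Fin n) ≃ₗᵢ[ℝ] EuclideanSpace ℝ (Fin n)}
    {w : Equiv.Perm (Fin (X.size n))} (h : Represents g w) (x : Fin (X.size n)) :
    w x.rev = (w x).rev := by
  apply vecAt_injective
  rw [vecAt_rev, ← h, ← h, vecAt_rev, map_neg]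

theorem Represents.eq {g g' : EuclideanSpace ℝ (Fin n) ≃ₗᵢ[ℝ] EuclideanSpace ℝ (Fin n)}
    {w : Equiv.Perm (Fin (X.size n))} (h : Represents g w) (h' : Represents g' w) : g = g' := by
  have : (g.toLinearEquiv : EuclideanSpace ℝ (Fin n) →ₗ[ℝ] EuclideanSpace ℝ (Fin n))
      = g'.toLinearEquiv := by
    refine (EuclideanSpace.basisFun (Fin n) ℝ).toBasis.ext fun i => ?_
    have h1 := (h (posIndex X i)).trans (h' (posIndex X i)).symm
    rw [vecAt_posIndex] at h1
    simpa using h1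
  ext1 x
  exact LinearMap.congr_fun this x

end PosRoot

end

/-! ### The reflection length -/

section

section WordLength

theorem List.exists_map_eq_of_forall_mem_image {G A : Type*} {f : A → G} {S : Set A} (w : List G)
    (h : ∀ s ∈ w, s ∈ f '' S) : ∃ l : List A, (∀ a ∈ l, a ∈ S) ∧ l.map f = w := by
  induction w with
  | nil => exact ⟨[], by simp, rfl⟩
  | cons s w ih =>
    obtain ⟨l, hl, rfl⟩ := ih fun t ht => h t (List.mem_cons_of_mem _ ht)
    obtain ⟨a, ha, rfl⟩ := h _ List.mem_cons_self
    exact ⟨a :: l, by simpa using ⟨ha, hl⟩, rfl⟩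

theorem wordLength_eq {G A : Type*} [Group G] {f : A → G} {S : Set A} {g : G} (k : ℕ)
    (l : List A) (hl : ∀ a ∈ l, a ∈ S)
    (hk : l.length = k) (hg : (l.map f).prod = g)
    (hmin : ∀ l : List A, (∀ a ∈ l, a ∈ S) → (l.map f).prod = g → k ≤ l.length) :
    wordLength (f '' S) g = k := by
  refine le_antisymm (Nat.sInf_le ⟨l.map f, by simpa using hk, ?_, hg⟩) (le_csInf ?_ ?_)
  · intro s hs
    obtain ⟨a, ha, rfl⟩ := List.mem_map.mp hs
    exact ⟨a, hl a ha, rfl⟩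
  · refine ⟨k, l.map f, by simpa using hk, ?_, hg⟩
    intro s hs
    obtain ⟨a, ha, rfl⟩ := List.mem_map.mp hs
    exact ⟨a, hl a ha, rfl⟩
  · rintro j ⟨w, rfl, hw, hwg⟩
    obtain ⟨l', hl', rfl⟩ := w.exists_map_eq_of_forall_mem_image hw
    simpa using hmin l' hl' hwg

end WordLength

namespace PosRoot

variable {X : OrthType} {n : ℕ}

theorem sub_prod_reflection_mem_span (l : List (PosRoot X n)) (v : EuclideanSpace ℝ (Fin n)) :
    v - (l.map reflection).prod v ∈
      Submodule.span ℝ (Set.range fun i : Fin l.length => (l.get i).vec) := by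
  have hset : ∀ l : List (PosRoot X n),
      (Set.range fun i : Fin l.length => (l.get i).vec) = vec '' {α | α ∈ l} := by
    intro l
    ext u
    simp only [Set.mem_range, Set.mem_image, Set.mem_ofPred_eq, List.mem_iff_get]
    constructor
    · rintro ⟨i, rfl⟩; exact ⟨_, ⟨i, rfl⟩, rfl⟩
    · rintro ⟨_, ⟨i, rfl⟩, rfl⟩; exact ⟨i, rfl⟩
  rw [hset]
  induction l with
  | nil => simp
  | cons a l ih =>
    have h1 : Submodule.span ℝ (vec '' {α | α ∈ l}) ≤
        Submodule.span ℝ (vec '' {α | α ∈ a :: l}) :=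
      Submodule.span_mono (Set.image_mono fun α h => List.mem_cons_of_mem _ h)
    set u := (l.map reflection).prod v with hu
    have h2 : ((a :: l).map reflection).prod v = a.reflection u := rfl
    have h3 : u - a.reflection u ∈ Submodule.span ℝ {a.vec} := by
      have := Submodule.sub_starProjection_mem_orthogonal (K := (Submodule.span ℝ {a.vec})ᗮ) u
      rw [Submodule.orthogonal_orthogonal] at this
      have h4 := Submodule.smul_mem _ (2 : ℝ) this
      rw [reflection, Submodule.reflection_apply]
      convert h4 using 1
      module
    have h5 : Submodule.span ℝ {a.vec} ≤ Submodule.span ℝ (vec '' {α | α ∈ a :: l}) :=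
      Submodule.span_mono (by
        rintro _ rfl
        exact ⟨a, List.mem_cons_self, rfl⟩)
    rw [h2, ← sub_add_sub_cancel v u]
    exact Submodule.add_mem _ (h1 ih) (h5 h3)

end PosRoot

open PosRoot

variable {X : OrthType} {n : ℕ} {D : Finset (PosRoot X n)}

/-- The permutation of the positions induced by the involution with support `D`. -/
noncomputable def supportPerm (D : Finset (PosRoot X n)) : Equiv.Perm (Fin (X.size n)) :=
  (D.toList.map perm).prod

theorem represents_supportInvolution (D : Finset (PosRoot X n)) :
    Represents (supportInvolution D) (supportPerm D) :=
  Represents.list_prod _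

theorem list_prod_perm_of_not_meets {l : List (PosRoot X n)} {x : Fin (X.size n)}
    (h : ∀ β ∈ l, ¬ β.Meets x) : (l.map perm).prod x = x := by
  induction l with
  | nil => rfl
  | cons a l ih =>
    rw [List.map_cons, List.prod_cons, Equiv.Perm.mul_apply,
      ih fun β hβ => h β (List.mem_cons_of_mem _ hβ), perm_of_not_meets _ (h a List.mem_cons_self)]

theorem supportPerm_of_not_meets {x : Fin (X.size n)} (h : ∀ β ∈ D, ¬ β.Meets x) :
    supportPerm D x = x :=
  list_prod_perm_of_not_meets fun β hβ => h β (Finset.mem_toList.mp hβ)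

theorem supportPerm_of_meets (hD : IsOrthogonalRookPlacement D) {β : PosRoot X n} (hβ : β ∈ D)
    {x : Fin (X.size n)} (h : β.Meets x) : supportPerm D x = β.perm x := by
  obtain ⟨l₁, l₂, hl⟩ := List.append_of_mem (Finset.mem_toList.mpr hβ)
  have hnd := D.nodup_toList
  rw [hl, List.nodup_middle, List.nodup_cons, List.mem_append, not_or] at hnd
  have hmem : ∀ γ, γ ∈ l₁ ∨ γ ∈ l₂ → γ ∈ D ∧ γ ≠ β := by
    intro γ hγ
    refine ⟨Finset.mem_toList.mp (by rw [hl]; simp; tauto), ?_⟩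
    rintro rfl
    exact hγ.elim hnd.1.1 hnd.1.2
  rw [supportPerm, hl, List.map_append, List.map_cons, List.prod_append, List.prod_cons,
    Equiv.Perm.mul_apply, Equiv.Perm.mul_apply,
    list_prod_perm_of_not_meets (l := l₂), list_prod_perm_of_not_meets (l := l₁)]
  · intro γ hγ h'
    exact (hmem γ (Or.inl hγ)).2 (hD.eq_of_meets (hmem γ (Or.inl hγ)).1 hβ h' h.perm)
  · intro γ hγ h'
    exact (hmem γ (Or.inr hγ)).2 (hD.eq_of_meets (hmem γ (Or.inr hγ)).1 hβ h' h)

theorem supportInvolution_vec (hD : IsOrthogonalRookPlacement D) {β : PosRoot X n} (hβ : β ∈ D) :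
    supportInvolution D β.vec = -β.vec := by
  rw [← reflection_vec, vec_eq, map_sub, map_sub, represents_supportInvolution,
    represents_supportInvolution, supportPerm_of_meets hD hβ β.meets_colIndex,
    supportPerm_of_meets hD hβ β.meets_rowIndex, reflection_vecAt, reflection_vecAt]

/-- `s(σ) = |D|`: a product of `k` reflections moves vectors only by elements of a subspace of
dimension at most `k`, and `σ` moves the `|D|` orthogonal vectors `β ∈ D` to their negatives. -/
theorem reflectionLength_supportInvolution (hD : IsOrthogonalRookPlacement D) :
    reflectionLength X n (supportInvolution D) = D.card := by
  rw [reflectionLength, ← Set.image_univ]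
  refine wordLength_eq _ D.toList (by simp) (Finset.length_toList D) rfl fun l _ hl => ?_
  have hli : LinearIndependent ℝ fun β : D => (β : PosRoot X n).vec := by
    refine linearIndependent_of_ne_zero_of_inner_eq_zero (fun β => β.1.vec_ne_zero) ?_
    intro β γ hne
    exact (hD β β.2 γ γ.2 fun h => hne (Subtype.ext h)).1
  have hle : Submodule.span ℝ (Set.range fun β : D => (β : PosRoot X n).vec) ≤
      Submodule.span ℝ (Set.range fun i : Fin l.length => (l.get i).vec) := by
    rw [Submodule.span_le]
    rintro _ ⟨β, rfl⟩
    have h1 := sub_prod_reflection_mem_span l β.1.vec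
    rw [hl, supportInvolution_vec hD β.2, sub_neg_eq_add, ← two_smul ℝ] at h1
    exact (Submodule.smul_mem_iff _ two_ne_zero).mp h1
  have h2 := Submodule.finrank_mono hle
  rw [finrank_span_eq_card hli, Fintype.card_coe] at h2
  exact h2.trans ((finrank_range_le_card _).trans (by simp))

end

/-! ### Inversions and simple reflections -/

section

namespace PosRoot

variable {X : OrthType} {n : ℕ}

/-- The number of inversions of a permutation of the positions: the number of positive roots that
the corresponding isometry of `ℝⁿ` sends to negative roots. -/
noncomputable def inversions (w : Equiv.Perm (Fin (X.size n))) : ℕ :=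
  (Finset.univ.filter fun α : PosRoot X n => w α.rowIndex < w α.colIndex).card

/-- The positive root `α` is, up to the symmetry `(x, y) ↦ (-y, -x)`, given by the pair of positions
`(x, y)`: as a vector it is the difference of the vectors at `x` and at `y`. -/
def IsAt (α : PosRoot X n) (x y : Fin (X.size n)) : Prop :=
  (α.colIndex = x ∧ α.rowIndex = y) ∨ (α.colIndex = y.rev ∧ α.rowIndex = x.rev)

theorem isAt_self (α : PosRoot X n) : α.IsAt α.colIndex α.rowIndex := Or.inl ⟨rfl, rfl⟩

theorem IsAt.rev {α : PosRoot X n} {x y : Fin (X.size n)} (h : α.IsAt x y) :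
    α.IsAt y.rev x.rev := by
  rcases h with h | h
  · exact Or.inr (by simpa using h)
  · exact Or.inl h

theorem IsAt.unique {α β : PosRoot X n} {x y : Fin (X.size n)} (h : α.IsAt x y)
    (h' : β.IsAt x y) : α = β := by
  have a1 := α.rowIndex_lt_rev_colIndex
  have b1 := β.rowIndex_lt_rev_colIndex
  rcases h with ⟨h1, h2⟩ | ⟨h1, h2⟩ <;> rcases h' with ⟨h3, h4⟩ | ⟨h3, h4⟩
  · exact ext_index (h1.trans h3.symm) (h2.trans h4.symm)
  · rw [h1, h2] at a1
    rw [h3, h4, Fin.rev_rev, Fin.rev_lt_iff] at b1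
    rw [Fin.lt_def, Fin.val_rev] at *
    omega
  · rw [h1, h2, Fin.rev_rev] at a1
    rw [h3, h4] at b1
    rw [Fin.lt_def, Fin.val_rev] at *
    omega
  · exact ext_index (h1.trans h3.symm) (h2.trans h4.symm)

theorem exists_isAt {x y : Fin (X.size n)} (h : x < y) (h' : y ≠ x.rev) :
    ∃ α : PosRoot X n, α.IsAt x y := by
  rcases lt_or_gt_of_ne h' with h1 | h1
  · obtain ⟨α, h2⟩ := exists_of_lt h h1
    exact ⟨α, Or.inl h2⟩
  · obtain ⟨α, h2⟩ := exists_of_lt (c := y.rev) (r := x.rev) (Fin.rev_lt_rev.mpr h)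
      (by rwa [Fin.rev_rev])
    exact ⟨α, Or.inr h2⟩

theorem IsAt.lt {α : PosRoot X n} {x y : Fin (X.size n)} (h : α.IsAt x y) : x < y := by
  have h1 := α.colIndex_lt_rowIndex
  rcases h with ⟨e, e'⟩ | ⟨e, e'⟩ <;> rw [e, e'] at h1
  · exact h1
  · exact Fin.rev_lt_rev.mp h1

theorem IsAt.ne_rev {α : PosRoot X n} {x y : Fin (X.size n)} (h : α.IsAt x y) : y ≠ x.rev := by
  have h1 := α.rowIndex_lt_rev_colIndex
  rcases h with ⟨e, e'⟩ | ⟨e, e'⟩ <;> rw [e, e'] at h1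
  · exact h1.ne
  · rw [Fin.rev_rev] at h1
    exact h1.ne'

theorem IsAt.inverted_iff {α : PosRoot X n} {x y : Fin (X.size n)} (h : α.IsAt x y)
    {w : Equiv.Perm (Fin (X.size n))} (hw : ∀ x, w x.rev = (w x).rev) :
    w α.rowIndex < w α.colIndex ↔ w y < w x := by
  rcases h with ⟨e, e'⟩ | ⟨e, e'⟩ <;> rw [e, e']
  rw [hw, hw, Fin.rev_lt_rev]

theorem perm_rev (α : PosRoot X n) (x : Fin (X.size n)) : α.perm x.rev = (α.perm x).rev :=
  α.represents_reflection.rev x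

theorem perm_perm (α : PosRoot X n) (x : Fin (X.size n)) : α.perm (α.perm x) = x := by
  apply vecAt_injective
  rw [← reflection_vecAt, ← reflection_vecAt]
  exact Submodule.reflection_reflection _ _

theorem perm_mul_self (α : PosRoot X n) : α.perm * α.perm = 1 :=
  Equiv.ext α.perm_perm

theorem perm_target (α : PosRoot X n) : α.perm α.target = α.colIndex := by
  rw [← perm_colIndex, perm_perm]

/-- A simple reflection permutes the positive roots other than the corresponding simple root. -/
theorem IsSimple.perm_lt_perm {α : PosRoot X n} (h : α.IsSimple) {x y : Fin (X.size n)}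
    (hxy : x < y) (hy : y ≠ x.rev) (hα : ¬ α.IsAt x y) : α.perm x < α.perm y := by
  have hs := size_cases X n
  have hx1 := α.perm_cases x
  have hy1 := α.perm_cases y
  have hx2 := x.2
  have hy2 := y.2
  have c1 := colIndex_val α
  have hsx := (α.perm x).2
  have hsy := (α.perm y).2
  rw [IsAt] at hα
  rw [Fin.lt_def] at *
  generalize α.perm x = sx at *
  generalize α.perm y = sy at *
  have ht : (α.target : ℕ) = if X.size n - (α.rowIndex + 1) = α.rowIndex then
      X.size n - (α.colIndex + 1) else α.rowIndex := by
    have := α.rowIndex.2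
    rw [target]
    simp only [Fin.ext_iff, Fin.val_rev, apply_ite Fin.val]
    congr 1
    simp only [eq_comm]
  simp only [Fin.ext_iff, Fin.val_rev, ne_eq] at hx1 hy1 hα hy
  generalize α.target = t at *
  rcases α with ⟨i, j, hij⟩ | ⟨i, j, hij⟩ | ⟨i, hi⟩
  · have hj := j.2
    simp only [rowIndex_sub_val, c1, col, IsSimple] at *
    split_ifs at ht <;> grind
  · have hj := j.2
    simp only [rowIndex_add_val, c1, col, IsSimple] at *
    obtain ⟨h1, h2, h3⟩ := h
    subst h1
    simp only [reduceCtorEq, false_and, true_and, false_or] at hs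
    split_ifs at ht <;> grind
  · have hj := i.2
    simp only [rowIndex_short_val, c1, col, IsSimple] at *
    subst hi
    simp only [reduceCtorEq, false_and, true_and, or_false] at hs
    split_ifs at ht <;> grind

theorem perm_rowIndex_lt (α : PosRoot X n) : α.perm α.rowIndex < α.perm α.colIndex := by
  rw [perm_colIndex]
  have h1 := α.colIndex_lt_rowIndex
  have h2 := α.rowIndex_lt_rev_colIndex
  have h3 := α.colIndex_lt_target
  by_cases h : α.rowIndex = α.rowIndex.rev
  · have ht : α.target = α.colIndex.rev := if_pos h
    rw [perm_of_ne]
    · rw [ht]; exact h2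
    · exact h1.ne'
    · rw [ht]; exact h2.ne
    · exact h2.ne
    · rw [ht, Fin.rev_rev]; exact h1.ne'
  · have ht : α.target = α.rowIndex := if_neg h
    rw [← ht, perm_target]
    exact h3

/-- The simple reflection `r_α` maps the roots other than `α` inverted by `w r_α` to roots inverted
by `w`. With `w r_α` in place of `w` this also gives the opposite inequality. -/
theorem inversions_mul_perm_aux {α : PosRoot X n} (h : α.IsSimple)
    {w : Equiv.Perm (Fin (X.size n))} (hw : ∀ x, w x.rev = (w x).rev) :
    (Finset.univ.filter fun γ : PosRoot X n =>
      γ ≠ α ∧ (w * α.perm) γ.rowIndex < (w * α.perm) γ.colIndex).card ≤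
    (Finset.univ.filter fun γ : PosRoot X n => γ ≠ α ∧ w γ.rowIndex < w γ.colIndex).card := by
  have key : ∀ γ : PosRoot X n, γ ≠ α →
      ∃ δ : PosRoot X n, δ.IsAt (α.perm γ.colIndex) (α.perm γ.rowIndex) := by
    intro γ hγ
    refine exists_isAt (h.perm_lt_perm γ.colIndex_lt_rowIndex γ.rowIndex_lt_rev_colIndex.ne
      fun h' => hγ (γ.isAt_self.unique h')) ?_
    rw [← perm_rev]
    exact fun e => γ.rowIndex_lt_rev_colIndex.ne (α.perm.injective e)
  choose! f hf using key
  refine Finset.card_le_card_of_injOn f ?_ ?_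
  · intro γ hγ
    simp only [Finset.coe_filter, Finset.mem_univ, true_and, Set.mem_ofPred_eq] at hγ ⊢
    refine ⟨?_, ((hf γ hγ.1).inverted_iff hw).mpr hγ.2⟩
    intro e
    have h1 := hf γ hγ.1
    rw [e] at h1
    have h2 := (h1.inverted_iff (w := α.perm) α.perm_rev).mp α.perm_rowIndex_lt
    rw [perm_perm, perm_perm] at h2
    exact lt_asymm h2 γ.colIndex_lt_rowIndex
  · intro γ hγ δ hδ e
    simp only [Finset.coe_filter, Finset.mem_univ, true_and, Set.mem_ofPred_eq] at hγ hδ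
    have h1 := hf γ hγ.1
    have h2 := hf δ hδ.1
    rw [e] at h1
    rcases h1 with ⟨h3, h4⟩ | ⟨h3, h4⟩ <;> rcases h2 with ⟨h5, h6⟩ | ⟨h5, h6⟩
    · exact ext_index (α.perm.injective (h3.symm.trans h5)) (α.perm.injective (h4.symm.trans h6))
    · rw [h3, ← perm_rev] at h5
      rw [h4, ← perm_rev] at h6
      exact (δ.isAt_self.rev.unique (Or.inl ⟨α.perm.injective h5, α.perm.injective h6⟩)).symm
    · rw [h5, ← perm_rev] at h3
      rw [h6, ← perm_rev] at h4
      exact γ.isAt_self.rev.unique (Or.inl ⟨α.perm.injective h3, α.perm.injective h4⟩)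
    · rw [h3, Fin.rev_inj] at h5
      rw [h4, Fin.rev_inj] at h6
      exact ext_index (α.perm.injective h6) (α.perm.injective h5)

theorem inversions_eq (w : Equiv.Perm (Fin (X.size n))) (α : PosRoot X n) :
    inversions w =
      (Finset.univ.filter fun γ : PosRoot X n => γ ≠ α ∧ w γ.rowIndex < w γ.colIndex).card +
        if w α.rowIndex < w α.colIndex then 1 else 0 := by
  rw [inversions]
  split_ifs with h
  · rw [← Finset.card_insert_of_notMem (a := α) (by simp)]
    congr 1
    ext γ
    simp only [Finset.mem_filter, Finset.mem_univ, true_and, Finset.mem_insert]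
    by_cases e : γ = α
    · subst e; simp [h]
    · simp [e]
  · rw [add_zero]
    congr 1
    ext γ
    simp only [Finset.mem_filter, Finset.mem_univ, true_and]
    by_cases e : γ = α
    · subst e; simp [h]
    · simp [e]

theorem mul_perm_rev {w : Equiv.Perm (Fin (X.size n))} (hw : ∀ x, w x.rev = (w x).rev)
    (α : PosRoot X n) (x : Fin (X.size n)) : (w * α.perm) x.rev = ((w * α.perm) x).rev := by
  rw [Equiv.Perm.mul_apply, perm_rev, hw, Equiv.Perm.mul_apply]

theorem inversions_mul_perm_le {α : PosRoot X n} (h : α.IsSimple)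
    {w : Equiv.Perm (Fin (X.size n))} (hw : ∀ x, w x.rev = (w x).rev) :
    inversions (w * α.perm) ≤ inversions w + 1 := by
  have h1 := inversions_mul_perm_aux h hw
  rw [inversions_eq (w * α.perm) α, inversions_eq w α]
  split_ifs <;> omega

theorem inversions_mul_perm_of_lt {α : PosRoot X n} (h : α.IsSimple)
    {w : Equiv.Perm (Fin (X.size n))} (hw : ∀ x, w x.rev = (w x).rev)
    (hα : w α.rowIndex < w α.colIndex) : inversions (w * α.perm) + 1 = inversions w := by
  have h1 := inversions_mul_perm_aux h hw
  have h2 := inversions_mul_perm_aux h (mul_perm_rev hw α)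
  rw [mul_assoc, perm_mul_self, mul_one] at h2
  have h3 : ¬ (w * α.perm) α.rowIndex < (w * α.perm) α.colIndex := by
    rw [Equiv.Perm.mul_apply, Equiv.Perm.mul_apply, perm_colIndex]
    by_cases h : α.rowIndex = α.rowIndex.rev
    · have ht : α.target = α.colIndex.rev := if_pos h
      have h1 := α.colIndex_lt_rowIndex
      have h2 := α.rowIndex_lt_rev_colIndex
      rw [perm_of_ne, ht]
      -- the position `0` is fixed by `w`, so inversion of `α` means that `w` maps `i` beyond `0`
      · have h5 := hw α.rowIndex
        rw [← h] at h5
        rw [hw]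
        rw [Fin.lt_def] at *
        rw [Fin.ext_iff] at h5
        rw [Fin.val_rev] at *
        omega
      · exact h1.ne'
      · rw [ht]; exact h2.ne
      · exact h2.ne
      · rw [ht, Fin.rev_rev]; exact h1.ne'
    · have ht : α.target = α.rowIndex := if_neg h
      rw [← ht, perm_target, ht]
      exact hα.asymm
  rw [inversions_eq (w * α.perm) α, inversions_eq w α, if_pos hα, if_neg h3]
  omega

end PosRoot

end

/-! ### The Coxeter length is the number of inversions -/

section

namespace PosRoot

variable {X : OrthType} {n : ℕ}

/-- In type `D` every reflection exchanges two pairs of positions. -/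
theorem sign_perm (hX : X = OrthType.D) (α : PosRoot X n) : Equiv.Perm.sign α.perm = 1 := by
  have hr : α.rowIndex ≠ α.rowIndex.rev := by
    have := α.rowIndex.2
    subst hX
    rw [Ne, Fin.ext_iff, Fin.val_rev]
    simp only [OrthType.size] at *
    omega
  have ht : α.target = α.rowIndex := if_neg hr
  have h1 := α.colIndex_lt_rowIndex
  have h2 := α.rowIndex_lt_rev_colIndex
  rw [perm, if_neg (by rw [ht]; exact h2.ne), Equiv.Perm.sign_mul,
    Equiv.Perm.sign_swap (by rw [ht]; exact h1.ne),
    Equiv.Perm.sign_swap (by rw [ht, Ne, Fin.rev_inj]; exact h1.ne)]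
  rfl

theorem sign_list_prod_perm (hX : X = OrthType.D) (l : List (PosRoot X n)) :
    Equiv.Perm.sign (l.map perm).prod = 1 := by
  induction l with
  | nil => simp
  | cons a l ih =>
    rw [List.map_cons, List.prod_cons, Equiv.Perm.sign_mul, ih, sign_perm hX, one_mul]

theorem perm_eq_one_of_lt {m : ℕ} {w : Equiv.Perm (Fin m)}
    (h : ∀ x y : Fin m, (y : ℕ) = x + 1 → w x < w y) : w = 1 := by
  have hm : StrictMono w := by
    rcases m with _ | m
    · exact fun x => x.elim0
    · exact Fin.strictMono_iff_lt_succ.mpr fun i => h _ _ (by simp)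
  ext x
  have h1 := StrictMono.range_inj hm (strictMono_id (α := Fin m))
  rw [w.surjective.range_eq, Set.range_id] at h1
  rw [h1.mp rfl]
  rfl

/-- An element of the Weyl group that inverts no simple root is trivial. In type `D` the parity
condition excludes the sign change of `ε_n`, which inverts no simple root either. -/
theorem eq_one_of_isSimple {w : Equiv.Perm (Fin (X.size n))} (hw : ∀ x, w x.rev = (w x).rev)
    (hs : X = OrthType.D → Equiv.Perm.sign w = 1)
    (h : ∀ α : PosRoot X n, α.IsSimple → w α.colIndex < w α.rowIndex) : w = 1 := by
  -- by the symmetry under `x ↦ -x`, only the steps starting in the first half need to be checked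
  have half : ∀ w : Equiv.Perm (Fin (X.size n)), (∀ x, w x.rev = (w x).rev) →
      (∀ x y : Fin (X.size n), (y : ℕ) = x + 1 → (x : ℕ) < n → w x < w y) → w = 1 := by
    intro w hw h
    refine perm_eq_one_of_lt fun x y hxy => ?_
    rcases lt_or_ge (x : ℕ) n with hx | hx
    · exact h x y hxy hx
    · have := h y.rev x.rev (by have := y.2; rw [Fin.val_rev, Fin.val_rev]; omega) (by
        have := y.2
        have := size_cases X n
        rw [Fin.val_rev]; omega)
      rwa [hw, hw, Fin.rev_lt_rev] at this
  have hlt : ∀ x y : Fin (X.size n), (y : ℕ) = x + 1 → (y : ℕ) < n → w x < w y := by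
    intro x y hxy hy
    have := h (sub ⟨x, by omega⟩ ⟨y, hy⟩ (by rw [Fin.lt_def]; simp only; omega)) hxy
    exact this
  by_cases hX : X = OrthType.B
  · refine half w hw fun x y hxy hx => ?_
    rcases lt_or_ge (y : ℕ) n with hy | hy
    · exact hlt x y hxy hy
    · have := h (short ⟨x, hx⟩ hX) (by change (x : ℕ) + 1 = n; omega)
      have hyr : y = (short ⟨x, hx⟩ hX : PosRoot X n).rowIndex := by
        rw [Fin.ext_iff, rowIndex_short_val]
        omega
      rw [hyr]
      exact this
  · have hX : X = OrthType.D := by cases X <;> simp at hX ⊢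
    have hsize : X.size n = 2 * n := by rw [hX]; rfl
    by_cases hmid : ∀ x y : Fin (X.size n), (y : ℕ) = x + 1 → (y : ℕ) = n → w x < w y
    · refine half w hw fun x y hxy hx => ?_
      rcases lt_or_ge (y : ℕ) n with hy | hy
      · exact hlt x y hxy hy
      · exact hmid x y hxy (by omega)
    -- otherwise `w` composed with the sign change of `ε_n` is trivial, which contradicts the parity
    · exfalso
      push Not at hmid
      obtain ⟨a, b, hab, hb, hle⟩ := hmid
      have hne : a ≠ b := by rw [Ne, Fin.ext_iff]; omega
      have hba : b = a.rev := by rw [Fin.ext_iff, Fin.val_rev]; omega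
      have hlt' : w b < w a := lt_of_le_of_ne hle fun e => hne (w.injective e).symm
      have hone : w * Equiv.swap a b = 1 := by
        refine half _ ?_ ?_
        · intro x
          rw [Equiv.Perm.mul_apply, Equiv.Perm.mul_apply, ← hw]
          congr 1
          rw [hba]
          by_cases h1 : x = a
          · rw [h1, Equiv.swap_apply_right, Equiv.swap_apply_left, Fin.rev_rev]
          · by_cases h2 : x = a.rev
            · rw [h2, Fin.rev_rev, Equiv.swap_apply_right, Equiv.swap_apply_left]
            · rw [Equiv.swap_apply_of_ne_of_ne h1 h2, Equiv.swap_apply_of_ne_of_ne]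
              · rwa [Ne, Fin.rev_eq_iff]
              · rwa [Ne, Fin.rev_inj]
        · intro x y hxy hx
          rw [Equiv.Perm.mul_apply, Equiv.Perm.mul_apply]
          rcases lt_trichotomy (y : ℕ) (n - 1) with hy | hy | hy
          · rw [Equiv.swap_apply_of_ne_of_ne, Equiv.swap_apply_of_ne_of_ne]
            · exact hlt x y hxy (by omega)
            all_goals rw [Ne, Fin.ext_iff]; omega
          · have hya : y = a := by rw [Fin.ext_iff]; omega
            rw [hya, Equiv.swap_apply_left, Equiv.swap_apply_of_ne_of_ne]
            · have := h (add ⟨x, hx⟩ ⟨a, by omega⟩ (by rw [Fin.lt_def]; simp only; omega))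
                ⟨hX, by change (a : ℕ) = x + 1; omega, by change (a : ℕ) + 1 = n; omega⟩
              rw [hba]
              exact this
            all_goals rw [Ne, Fin.ext_iff]; omega
          · have hxa : x = a := by rw [Fin.ext_iff]; omega
            have hyb : y = b := by rw [Fin.ext_iff]; omega
            rw [hxa, hyb, Equiv.swap_apply_left, Equiv.swap_apply_right]
            exact hlt'
      have hsign := congrArg Equiv.Perm.sign hone
      rw [Equiv.Perm.sign_mul, hs hX, Equiv.Perm.sign_swap hne, Equiv.Perm.sign_one] at hsign
      exact absurd hsign (by decide)

theorem inversions_one : inversions (1 : Equiv.Perm (Fin (X.size n))) = 0 := by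
  rw [inversions, Finset.card_eq_zero, Finset.filter_eq_empty_iff]
  intro α _
  exact α.colIndex_lt_rowIndex.asymm

theorem inversions_list_prod_le (l : List (PosRoot X n)) (hl : ∀ α ∈ l, α.IsSimple) :
    inversions (l.map perm).prod ≤ l.length := by
  induction l using List.reverseRecOn with
  | nil => simp [inversions_one]
  | append_singleton l a ih =>
    have h1 := ih fun α hα => hl α (by simp [hα])
    have h2 := inversions_mul_perm_le (hl a (by simp)) (Represents.list_prod l).rev
    simp only [List.map_append, List.map_cons, List.map_nil, List.prod_append, List.prod_cons,
      List.prod_nil, mul_one, List.length_append, List.length_cons, List.length_nil]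
    omega

/-- As long as there are inversions, some simple root is inverted, and multiplication by its
reflection removes exactly one inversion. -/
theorem exists_list_of_inversions (k : ℕ) :
    ∀ {g : EuclideanSpace ℝ (Fin n) ≃ₗᵢ[ℝ] EuclideanSpace ℝ (Fin n)}
      {w : Equiv.Perm (Fin (X.size n))}, Represents g w →
      (X = OrthType.D → Equiv.Perm.sign w = 1) → inversions w = k →
      ∃ l : List (PosRoot X n), (∀ α ∈ l, α.IsSimple) ∧ l.length = k ∧
        (l.map reflection).prod = g := by
  induction k with
  | zero =>
    intro g w hg hs hk
    have hw : w = 1 := by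
      refine eq_one_of_isSimple hg.rev hs fun α _ => ?_
      rw [inversions, Finset.card_eq_zero, Finset.filter_eq_empty_iff] at hk
      exact lt_of_le_of_ne (not_lt.mp (hk (Finset.mem_univ α)))
        fun e => α.colIndex_lt_rowIndex.ne (w.injective e)
    subst hw
    exact ⟨[], by simp, rfl, Represents.one.eq hg⟩
  | succ k ih =>
    intro g w hg hs hk
    have hex : ∃ α : PosRoot X n, α.IsSimple ∧ w α.rowIndex < w α.colIndex := by
      by_contra hno
      push Not at hno
      have hw : w = 1 := eq_one_of_isSimple hg.rev hs fun α hα =>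
        lt_of_le_of_ne (hno α hα) fun e => α.colIndex_lt_rowIndex.ne (w.injective e)
      rw [hw, inversions_one] at hk
      omega
    obtain ⟨α, hα, hlt⟩ := hex
    have h1 := inversions_mul_perm_of_lt hα hg.rev hlt
    obtain ⟨l, hl, hlen, hprod⟩ := ih (hg.mul (represents_reflection α))
      (fun hX => by rw [Equiv.Perm.sign_mul, hs hX, sign_perm hX, one_mul]) (by omega)
    refine ⟨l ++ [α], ?_, by simp [hlen], ?_⟩
    · intro γ hγ
      rcases List.mem_append.mp hγ with h | h
      · exact hl γ h
      · rw [List.mem_singleton.mp h]; exact hα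
    · have h2 : α.reflection * α.reflection = 1 := by
        have h3 := (represents_reflection α).mul (represents_reflection α)
        rw [perm_mul_self] at h3
        exact h3.eq Represents.one
      rw [List.map_append, List.prod_append, hprod, List.map_singleton, List.prod_singleton,
        mul_assoc, h2, mul_one]

theorem Represents.perm_eq {g : EuclideanSpace ℝ (Fin n) ≃ₗᵢ[ℝ] EuclideanSpace ℝ (Fin n)}
    {w w' : Equiv.Perm (Fin (X.size n))} (h : Represents g w) (h' : Represents g w') : w = w' :=
  Equiv.ext fun x => vecAt_injective ((h x).symm.trans (h' x))

/-- The Coxeter length of an element of the Weyl group is its number of inversions. -/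
theorem coxeterLength_eq_inversions (l : List (PosRoot X n)) :
    coxeterLength X n (l.map reflection).prod = inversions (l.map perm).prod := by
  obtain ⟨l', hl', hlen, hprod⟩ := exists_list_of_inversions _ (Represents.list_prod l)
    (fun hX => sign_list_prod_perm hX l) rfl
  refine wordLength_eq _ l' hl' hlen hprod fun l'' h'' hprod'' => ?_
  have h1 := Represents.list_prod l''
  rw [hprod''] at h1
  have h2 : (l''.map perm).prod = (l.map perm).prod := h1.perm_eq (Represents.list_prod l)
  rw [← h2]
  exact inversions_list_prod_le l'' h''

end PosRoot

theorem coxeterLength_supportInvolution {X : OrthType} {n : ℕ} (D : Finset (PosRoot X n)) :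
    coxeterLength X n (supportInvolution D) = PosRoot.inversions (supportPerm D) :=
  PosRoot.coxeterLength_eq_inversions _

end

/-! ### Inverted roots and decompositions of the roots of `D` -/

section

open PosRoot

namespace PosRoot

variable {X : OrthType} {n : ℕ}

theorem eq_of_eq_rev {m : ℕ} {x y : Fin m} (hx : x = x.rev) (hy : y = y.rev) : x = y := by
  rw [Fin.ext_iff, Fin.val_rev] at *
  have := x.2
  have := y.2
  omega

theorem Meets.le {α : PosRoot X n} {x : Fin (X.size n)} (h : α.Meets x) : α.colIndex ≤ x := by
  have h1 := α.colIndex_lt_rowIndex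
  have h2 := α.rowIndex_lt_rev_colIndex
  have h3 := Fin.rev_lt_rev.mpr h2
  rw [Fin.rev_rev] at h3
  rcases h with rfl | rfl | rfl | rfl
  · exact le_rfl
  · exact h1.le
  · exact (h1.trans h2).le
  · exact h3.le

theorem Meets.le_rev {α : PosRoot X n} {x : Fin (X.size n)} (h : α.Meets x) :
    x ≤ α.colIndex.rev := by
  rw [← Fin.rev_le_rev, Fin.rev_rev]
  exact h.rev.le

theorem IsAt.meets {α : PosRoot X n} {x y : Fin (X.size n)} (h : α.IsAt x y) :
    α.Meets x ∧ α.Meets y := by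
  rcases h with ⟨h1, h2⟩ | ⟨h1, h2⟩
  · rw [← h1, ← h2]
    exact ⟨α.meets_colIndex, α.meets_rowIndex⟩
  · rw [← meets_rev_iff, ← h2, ← α.meets_rev_iff (x := y), ← h1]
    exact ⟨α.meets_rowIndex, α.meets_colIndex⟩

theorem row_neg_iff (α : PosRoot X n) : α.row < 0 ↔ α.rowIndex.rev < α.rowIndex := by
  have hs := size_cases X n
  rw [Fin.lt_def, Fin.val_rev]
  rcases α with ⟨i, j, h⟩ | ⟨i, j, h⟩ | ⟨i, h⟩
  · have := j.2
    simp only [row, rowIndex_sub_val]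
    omega
  · have := j.2
    simp only [row, rowIndex_add_val]
    omega
  · subst h
    simp only [row, rowIndex_short_val, OrthType.size]
    omega

theorem rowIndex_eq_rev_iff (α : PosRoot X n) :
    α.rowIndex = α.rowIndex.rev ↔ ∃ i h, α = short i h := by
  have hs := size_cases X n
  rw [Fin.ext_iff, Fin.val_rev]
  rcases α with ⟨i, j, h⟩ | ⟨i, j, h⟩ | ⟨i, h⟩
  · have := j.2
    simp only [rowIndex_sub_val, reduceCtorEq, exists_false, iff_false]
    omega
  · have := j.2
    simp only [rowIndex_add_val, reduceCtorEq, exists_false, iff_false]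
    omega
  · refine ⟨fun _ => ⟨i, h, rfl⟩, fun _ => ?_⟩
    subst h
    simp only [rowIndex_short_val, OrthType.size]
    omega

theorem Meets.rowIndex_eq_rev {α : PosRoot X n} {x : Fin (X.size n)} (h : α.Meets x)
    (hx : x = x.rev) : α.rowIndex = α.rowIndex.rev := by
  have h1 := α.colIndex_ne_rev
  rcases h with rfl | rfl | rfl | rfl
  · exact absurd hx h1
  · exact hx
  · rw [Fin.rev_rev] at hx
    exact absurd hx.symm h1
  · rw [Fin.rev_rev] at hx
    exact hx.symm

end PosRoot

variable {X : OrthType} {n : ℕ} {D : Finset (PosRoot X n)}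

open Classical in
/-- The pairs `(β, z)` with `β ∈ D` and `col β < z < row β` (as positions), where `z ≠ -row β` and
`z` does not lie in the support of a root of `D` with a smaller column than `β`. With `v_x` the
vector at the position `x`, such a pair is a decomposition `β = (v_c - v_z) + (v_z - v_r)` into two
positive roots, for `c = col β` and `r = row β`. -/
noncomputable def decompositions (D : Finset (PosRoot X n)) :
    Finset (PosRoot X n × Fin (X.size n)) :=
  Finset.univ.filter fun s => s.1 ∈ D ∧ s.1.colIndex < s.2 ∧ s.2 < s.1.rowIndex ∧
    s.2 ≠ s.1.rowIndex.rev ∧ ∀ β ∈ D, β.Meets s.2 → s.1.colIndex ≤ β.colIndex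

theorem mem_decompositions {s : PosRoot X n × Fin (X.size n)} :
    s ∈ decompositions D ↔ s.1 ∈ D ∧ s.1.colIndex < s.2 ∧ s.2 < s.1.rowIndex ∧
    s.2 ≠ s.1.rowIndex.rev ∧ ∀ β ∈ D, β.Meets s.2 → s.1.colIndex ≤ β.colIndex := by
  simp [decompositions]

/-- The position `z` is high for `β`: it lies strictly between `col β` and `-col β`, it does not
belong to the support of `β`, and it does not belong to the support of a root of `D` with a smaller
column, except that for `z = 0` this last condition is waived. The involution with support `D`
permutes the positions that are high for `β`. -/
def IsHigh (D : Finset (PosRoot X n)) (β : PosRoot X n) (z : Fin (X.size n)) : Prop :=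
  β.colIndex < z ∧ z < β.colIndex.rev ∧ ¬ β.Meets z ∧
    ∀ γ ∈ D, γ.Meets z → z = z.rev ∨ β.colIndex < γ.colIndex

theorem IsHigh.rev {β : PosRoot X n} {z : Fin (X.size n)} (h : IsHigh D β z) :
    IsHigh D β z.rev := by
  obtain ⟨h1, h2, h3, h4⟩ := h
  refine ⟨?_, Fin.rev_lt_rev.mpr h1, fun h => h3 (meets_rev_iff.mp h), fun γ hγ h => ?_⟩
  · rwa [← Fin.rev_lt_rev, Fin.rev_rev]
  · rw [Fin.rev_rev, eq_comm]
    exact h4 γ hγ (meets_rev_iff.mp h)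

theorem supportPerm_rev (x : Fin (X.size n)) : supportPerm D x.rev = (supportPerm D x).rev :=
  (represents_supportInvolution D).rev x

theorem supportPerm_of_eq_rev {x : Fin (X.size n)} (h : x = x.rev) : supportPerm D x = x := by
  have h1 := supportPerm_rev (D := D) x
  rw [← h] at h1
  exact eq_of_eq_rev h1 h

theorem supportPerm_supportPerm (hD : IsOrthogonalRookPlacement D) (x : Fin (X.size n)) :
    supportPerm D (supportPerm D x) = x := by
  by_cases h : ∃ β ∈ D, β.Meets x
  · obtain ⟨β, hβ, h⟩ := h
    rw [supportPerm_of_meets hD hβ h, supportPerm_of_meets hD hβ h.perm, perm_perm]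
  · push Not at h
    rw [supportPerm_of_not_meets h, supportPerm_of_not_meets h]

theorem IsHigh.supportPerm (hD : IsOrthogonalRookPlacement D) {β : PosRoot X n} (hβ : β ∈ D)
    {z : Fin (X.size n)} (h : IsHigh D β z) : IsHigh D β (supportPerm D z) := by
  by_cases hz : z = z.rev
  · rwa [supportPerm_of_eq_rev hz]
  by_cases hm : ∃ γ ∈ D, γ.Meets z
  · obtain ⟨γ, hγ, hm⟩ := hm
    obtain ⟨h1, h2, h3, h4⟩ := h
    rw [supportPerm_of_meets hD hγ hm]
    have h5 := (h4 γ hγ hm).resolve_left hz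
    refine ⟨h5.trans_le hm.perm.le, hm.perm.le_rev.trans_lt (Fin.rev_lt_rev.mpr h5), ?_, ?_⟩
    · intro h
      rw [hD.eq_of_meets hβ hγ h hm.perm] at h3
      exact h3 hm
    · intro δ hδ h
      rw [hD.eq_of_meets hδ hγ h hm.perm]
      exact Or.inr h5
  · push Not at hm
    rwa [supportPerm_of_not_meets hm]

theorem supportPerm_colIndex (hD : IsOrthogonalRookPlacement D) {β : PosRoot X n} (hβ : β ∈ D) :
    supportPerm D β.colIndex = β.target := by
  rw [supportPerm_of_meets hD hβ β.meets_colIndex, perm_colIndex]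

theorem supportPerm_rowIndex (hD : IsOrthogonalRookPlacement D) {β : PosRoot X n} (hβ : β ∈ D)
    (h : β.rowIndex ≠ β.rowIndex.rev) : supportPerm D β.rowIndex = β.colIndex := by
  have ht : β.target = β.rowIndex := if_neg h
  rw [supportPerm_of_meets hD hβ β.meets_rowIndex, ← ht, perm_target]

/-- An inverted root outside of `D` which involves a nonzero position in the support of `β ∈ D` and
a position that is high for `β` is of one of two kinds. -/
theorem exists_of_meets_of_isHigh (hD : IsOrthogonalRookPlacement D) {β γ : PosRoot X n}
    (hβ : β ∈ D) {x y : Fin (X.size n)} (hγ : γ.IsAt x y) (hinv : supportPerm D y < supportPerm D x)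
    (hx : β.Meets x) (hx0 : x ≠ x.rev) (hy : IsHigh D β y) :
    (∃ z, IsHigh D β z ∧ supportPerm D z < β.target ∧ γ.IsAt β.colIndex z) ∨
    (∃ z, IsHigh D β z ∧ β.rowIndex ≠ β.rowIndex.rev ∧ z < β.rowIndex ∧ γ.IsAt z β.rowIndex) := by
  have hlt := hγ.lt
  rcases hx with rfl | rfl | rfl | rfl
  · rw [supportPerm_colIndex hD hβ] at hinv
    exact Or.inl ⟨y, hy, hinv, hγ⟩
  · rw [supportPerm_rowIndex hD hβ hx0] at hinv
    exact absurd hinv (hy.supportPerm hD hβ).1.asymm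
  · exact absurd hlt hy.2.1.asymm
  · refine Or.inr ⟨y.rev, hy.rev, fun e => hx0 (by rw [← e, ← e]), ?_, ?_⟩
    · rwa [← Fin.rev_lt_rev, Fin.rev_rev]
    · simpa using hγ.rev

theorem isHigh_of_col_lt (hD : IsOrthogonalRookPlacement D) {β γ : PosRoot X n} (hβ : β ∈ D)
    (hγ : γ ∈ D) (hlt : β.colIndex < γ.colIndex) {z : Fin (X.size n)} (hz : γ.Meets z) :
    IsHigh D β z := by
  refine ⟨hlt.trans_le hz.le, hz.le_rev.trans_lt (Fin.rev_lt_rev.mpr hlt), fun h => ?_,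
    fun δ hδ h => ?_⟩
  · exact hlt.ne (congrArg _ (hD.eq_of_meets hβ hγ h hz))
  · rw [hD.eq_of_meets hδ hγ h hz]
    exact Or.inr hlt

/-- No root other than `β` with both positions in the support of `β` is inverted by `r_β`. -/
theorem mem_of_isAt_of_meets {β γ : PosRoot X n} {x y : Fin (X.size n)} (h : γ.IsAt x y)
    (hx : β.Meets x) (hy : β.Meets y) (hinv : β.perm y < β.perm x) : γ = β := by
  have h1 := β.colIndex_lt_rowIndex
  have h2 := β.rowIndex_lt_rev_colIndex
  have h3 := h.lt
  have h4 := h.ne_rev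
  have hc := β.perm_colIndex
  have ht : β.target = if β.rowIndex = β.rowIndex.rev then β.colIndex.rev else β.rowIndex := rfl
  have hcr := β.perm_rev β.colIndex
  have hrr := β.perm_rev β.rowIndex
  have hr : β.rowIndex ≠ β.rowIndex.rev → β.perm β.rowIndex = β.colIndex := fun e => by
    rw [if_neg e] at ht
    rw [← ht, perm_target]
  have key : (x = β.colIndex ∧ y = β.rowIndex) ∨ (x = β.rowIndex.rev ∧ y = β.colIndex.rev) := by
    have h5 := Fin.rev_lt_rev.mpr h1
    have h6 := Fin.rev_lt_rev.mpr h2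
    rw [Fin.rev_rev] at h6
    by_cases e : β.rowIndex = β.rowIndex.rev
    · rcases hx with rfl | rfl | rfl | rfl <;> rcases hy with rfl | rfl | rfl | rfl <;>
      (try simp only [Fin.rev_rev] at *) <;> grind
    · have e' := hr e
      rw [if_neg e] at ht
      rw [ht] at hc
      rw [hc] at hcr
      rw [e'] at hrr
      rcases hx with rfl | rfl | rfl | rfl <;> rcases hy with rfl | rfl | rfl | rfl <;>
      simp only [Fin.rev_rev, hc, hcr, e', hrr] at * <;> grind
  rcases key with ⟨rfl, rfl⟩ | ⟨rfl, rfl⟩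
  · exact h.unique β.isAt_self
  · exact h.unique β.isAt_self.rev

/-- Every inverted root outside of `D` involves a position in the support of a root `β ∈ D` and a
position that is high for `β`: take for `β` the root of `D` with the smaller column among those
meeting the two positions, ignoring the position `0`. -/
theorem exists_of_inverted (hD : IsOrthogonalRookPlacement D) {γ : PosRoot X n} (hγ : γ ∉ D)
    (hinv : supportPerm D γ.rowIndex < supportPerm D γ.colIndex) :
    ∃ β ∈ D, (∃ z, IsHigh D β z ∧ supportPerm D z < β.target ∧ γ.IsAt β.colIndex z) ∨
    (∃ z, IsHigh D β z ∧ β.rowIndex ≠ β.rowIndex.rev ∧ z < β.rowIndex ∧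
      γ.IsAt z β.rowIndex) := by
  have h1 := γ.colIndex_lt_rowIndex
  have h2 := γ.rowIndex_lt_rev_colIndex
  have h0 := γ.isAt_self
  have hx0 := γ.colIndex_ne_rev
  generalize γ.colIndex = x at *
  generalize γ.rowIndex = y at *
  have hinv' : supportPerm D x.rev < supportPerm D y.rev := by
    rwa [supportPerm_rev, supportPerm_rev, Fin.rev_lt_rev]
  by_cases hx : ∃ β ∈ D, β.Meets x <;> by_cases hy : ∃ β ∈ D, β.Meets y
  · obtain ⟨β, hβ, hx⟩ := hx
    obtain ⟨β', hβ', hy⟩ := hy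
    rcases lt_trichotomy β.colIndex β'.colIndex with hlt | heq | hlt
    · exact ⟨β, hβ, exists_of_meets_of_isHigh hD hβ h0 hinv hx hx0
        (isHigh_of_col_lt hD hβ hβ' hlt hy)⟩
    · have e : β = β' := hD.eq_of_meets hβ hβ' β.meets_colIndex (heq ▸ β'.meets_colIndex)
      subst e
      rw [supportPerm_of_meets hD hβ hx, supportPerm_of_meets hD hβ hy] at hinv
      exact absurd (mem_of_isAt_of_meets h0 hx hy hinv ▸ hβ) hγ
    · by_cases hy0 : y = y.rev
      · refine ⟨β, hβ, exists_of_meets_of_isHigh hD hβ h0 hinv hx hx0 ⟨?_, ?_, ?_, ?_⟩⟩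
        · have := β.colIndex_lt_rowIndex.trans β.rowIndex_lt_rev_colIndex
          rw [Fin.lt_def, Fin.ext_iff, Fin.val_rev] at *
          omega
        · have := β.colIndex_lt_rowIndex.trans β.rowIndex_lt_rev_colIndex
          rw [Fin.lt_def, Fin.ext_iff, Fin.val_rev] at *
          omega
        · intro h
          exact hlt.ne (congrArg _ (hD.eq_of_meets hβ' hβ hy h))
        · exact fun _ _ _ => Or.inl hy0
      · exact ⟨β', hβ', exists_of_meets_of_isHigh hD hβ' h0.rev hinv' hy.rev
          (by rwa [Fin.rev_rev, ne_comm]) (isHigh_of_col_lt hD hβ' hβ hlt hx).rev⟩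
  · obtain ⟨β, hβ, hx⟩ := hx
    push Not at hy
    have hτ := supportPerm_of_not_meets hy
    rw [hτ, supportPerm_of_meets hD hβ hx] at hinv
    refine ⟨β, hβ, exists_of_meets_of_isHigh hD hβ h0 (by
      rwa [hτ, supportPerm_of_meets hD hβ hx]) hx hx0 ⟨?_, ?_, hy β hβ, ?_⟩⟩
    · exact hx.le.trans_lt h1
    · exact hinv.trans_le hx.perm.le_rev
    · exact fun γ hγ h => absurd h (hy γ hγ)
  · obtain ⟨β, hβ, hy⟩ := hy
    push Not at hx
    have hτ := supportPerm_of_not_meets hx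
    rw [hτ, supportPerm_of_meets hD hβ hy] at hinv
    have hhigh : IsHigh D β x := ⟨hy.perm.le.trans_lt hinv, h1.trans_le hy.le_rev, hx β hβ,
      fun γ hγ h => absurd h (hx γ hγ)⟩
    by_cases hy0 : y = y.rev
    · rw [← supportPerm_of_meets hD hβ hy, supportPerm_of_eq_rev hy0] at hinv
      exact absurd hinv h1.asymm
    · exact ⟨β, hβ, exists_of_meets_of_isHigh hD hβ h0.rev hinv' hy.rev
        (by rwa [Fin.rev_rev, ne_comm]) hhigh.rev⟩
  · push Not at hx hy
    rw [supportPerm_of_not_meets hx, supportPerm_of_not_meets hy] at hinv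
    exact absurd hinv h1.asymm

end

/-! ### The number of inversions of the involution -/

section

open PosRoot

variable {X : OrthType} {n : ℕ} {D : Finset (PosRoot X n)}

theorem PosRoot.IsAt.eq_or {γ : PosRoot X n} {x y x' y' : Fin (X.size n)} (h : γ.IsAt x y)
    (h' : γ.IsAt x' y') : (x = x' ∧ y = y') ∨ (x = y'.rev ∧ y = x'.rev) := by
  rcases h with ⟨a1, a2⟩ | ⟨a1, a2⟩ <;> rcases h' with ⟨b1, b2⟩ | ⟨b1, b2⟩ <;>
    rw [a1] at b1 <;> rw [a2] at b2
  · exact Or.inl ⟨b1, b2⟩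
  · exact Or.inr ⟨b1, b2⟩
  · exact Or.inr ⟨by rw [← b2, Fin.rev_rev], by rw [← b1, Fin.rev_rev]⟩
  · exact Or.inl ⟨Fin.rev_injective b2, Fin.rev_injective b1⟩

section Count

open Classical

/-- The pairs `(β, z)` with `z` high for `β` and `z < row β`. -/
noncomputable def highPairs (D : Finset (PosRoot X n)) : Finset (PosRoot X n × Fin (X.size n)) :=
  Finset.univ.filter fun s => s.1 ∈ D ∧ IsHigh D s.1 s.2 ∧ s.2 < s.1.rowIndex

/-- The pairs `(β, z)` for which the positive root at `(col β, z)` is inverted. -/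
noncomputable def colPairs (D : Finset (PosRoot X n)) : Finset (PosRoot X n × Fin (X.size n)) :=
  Finset.univ.filter fun s => s.1 ∈ D ∧ IsHigh D s.1 s.2 ∧ supportPerm D s.2 < s.1.target

/-- The pairs `(β, z)` for which the positive root at `(z, row β)` is inverted, where `β` is not
short. -/
noncomputable def rowPairs (D : Finset (PosRoot X n)) : Finset (PosRoot X n × Fin (X.size n)) :=
  Finset.univ.filter fun s => s.1 ∈ D ∧ IsHigh D s.1 s.2 ∧ s.1.rowIndex ≠ s.1.rowIndex.rev ∧
    s.2 < s.1.rowIndex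

/-- The pairs `(β, 0)` for which `0` lies in the support of a short root of `D` with a smaller
column account for `d(σ)`. -/
theorem card_highPairs (D : Finset (PosRoot X n)) (hD : IsOrthogonalRookPlacement D) :
    (highPairs D).card = (decompositions D).card + dNumber D := by
  have hsub : decompositions D ⊆ highPairs D := by
    rintro ⟨β, z⟩ h
    rw [mem_decompositions] at h
    obtain ⟨hβ, h1, h2, h3, h4⟩ := h
    simp only at hβ h1 h2 h3 h4
    have hm : ¬ β.Meets z := by
      rintro (h | h | h | h)
      · exact h1.ne' h
      · exact h2.ne h
      · exact (h2.trans β.rowIndex_lt_rev_colIndex).ne h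
      · exact h3 h
    simp only [highPairs, Finset.mem_filter, Finset.mem_univ, true_and]
    refine ⟨hβ, ⟨h1, h2.trans β.rowIndex_lt_rev_colIndex, hm, fun γ hγ h => Or.inr ?_⟩, h2⟩
    refine lt_of_le_of_ne (h4 γ hγ h) fun e => hm ?_
    rwa [hD.eq_of_meets hβ hγ β.meets_colIndex (e ▸ γ.meets_colIndex)]
  rw [← Finset.card_sdiff_add_card_eq_card hsub, add_comm]
  congr 1
  have himage : Set.image Prod.fst
      (↑(highPairs D \ decompositions D) : Set (PosRoot X n × Fin (X.size n))) =
      {β | β ∈ D ∧ β.row < 0 ∧ ∃ i h, PosRoot.short i h ∈ D ∧ i < β.col} := by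
    ext β
    simp only [Set.mem_image, Finset.mem_coe, Finset.mem_sdiff, Set.mem_ofPred_eq, highPairs,
      Finset.mem_filter, Finset.mem_univ, true_and, mem_decompositions, Prod.exists,
      exists_and_right, exists_eq_right]
    constructor
    · rintro ⟨z, ⟨hβ, h, hz⟩, hn⟩
      have hex : ∃ γ ∈ D, γ.Meets z ∧ γ.colIndex < β.colIndex := by
        by_contra hno
        push Not at hno
        exact hn ⟨hβ, h.1, hz, fun e => h.2.2.1 (e ▸ β.meets_rowIndex.rev), hno⟩
      obtain ⟨γ, hγ, hm, hlt⟩ := hex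
      have hz0 := (h.2.2.2 γ hγ hm).resolve_right hlt.asymm
      obtain ⟨i, hi, rfl⟩ := (rowIndex_eq_rev_iff γ).mp (hm.rowIndex_eq_rev hz0)
      refine ⟨hβ, (row_neg_iff β).mpr ?_, i, ⟨hi, hγ⟩, hlt⟩
      rw [Fin.lt_def, Fin.ext_iff, Fin.val_rev] at *
      omega
    · rintro ⟨hβ, hrow, i, ⟨hi, hs⟩, hlt⟩
      have hs0 := (rowIndex_eq_rev_iff (short (n := n) i hi)).mpr ⟨i, hi, rfl⟩
      have hlt' : (short (n := n) i hi).colIndex < β.colIndex := hlt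
      have hne : β ≠ short i hi := fun e => hlt'.ne' (by rw [e])
      have hr := (row_neg_iff β).mp hrow
      have hc := β.colIndex_lt_rowIndex.trans β.rowIndex_lt_rev_colIndex
      have hm := (short (n := n) i hi).meets_rowIndex
      refine ⟨(short (n := n) i hi).rowIndex, ⟨hβ, ⟨?_, ?_, ?_, ?_⟩, ?_⟩, ?_⟩
      · rw [Fin.lt_def, Fin.ext_iff, Fin.val_rev] at *
        omega
      · rw [Fin.lt_def, Fin.ext_iff, Fin.val_rev] at *
        omega
      · exact fun h => hne (hD.eq_of_meets hβ hs h hm)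
      · exact fun _ _ _ => Or.inl hs0
      · rw [Fin.lt_def, Fin.ext_iff, Fin.val_rev] at *
        omega
      · exact fun h => (h.2.2.2.2 _ hs hm).not_gt hlt'
  rw [dNumber, ← himage, Set.InjOn.ncard_image, Set.ncard_coe_finset]
  rintro ⟨β, z⟩ h ⟨β', z'⟩ h' (rfl : β = β')
  simp only [Finset.mem_coe, Finset.mem_sdiff, highPairs, Finset.mem_filter, Finset.mem_univ,
    true_and, mem_decompositions] at h h'
  have key : ∀ z, (β ∈ D ∧ IsHigh D β z ∧ z < β.rowIndex) →
      (¬ (β ∈ D ∧ β.colIndex < z ∧ z < β.rowIndex ∧ z ≠ β.rowIndex.rev ∧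
        ∀ γ ∈ D, γ.Meets z → β.colIndex ≤ γ.colIndex)) → z = z.rev := by
    rintro z ⟨hβ, h, hz⟩ hn
    by_contra hz0
    exact hn ⟨hβ, h.1, hz, fun e => h.2.2.1 (e ▸ β.meets_rowIndex.rev),
      fun γ hγ hm => ((h.2.2.2 γ hγ hm).resolve_left hz0).le⟩
  rw [eq_of_eq_rev (key z h.1 h.2) (key z' h'.1 h'.2)]

/-- The inverted roots outside of `D`, listed by `colPairs D` and `rowPairs D`, are twice as many as
the pairs `(β, z)` with `z` high for `β` and `z < row β`. -/
theorem card_colPairs (hD : IsOrthogonalRookPlacement D) :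
    (colPairs D).card + (rowPairs D).card = 2 * (highPairs D).card := by
  -- long roots: apply the involution to `z`; short roots: change the sign of `z`
  have h1 : ((colPairs D).filter fun s => s.1.rowIndex ≠ s.1.rowIndex.rev).card =
      (rowPairs D).card := by
    refine Finset.card_nbij' (fun s => (s.1, supportPerm D s.2)) (fun s => (s.1, supportPerm D s.2))
      ?_ ?_ ?_ ?_
    · rintro ⟨β, z⟩ h
      simp only [colPairs, rowPairs, Finset.coe_filter, Finset.mem_filter, Finset.mem_univ,
        true_and, Set.mem_ofPred_eq] at h ⊢
      obtain ⟨⟨hβ, h1, h2⟩, h3⟩ := h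
      rw [target, if_neg h3] at h2
      exact ⟨hβ, h1.supportPerm hD hβ, h3, h2⟩
    · rintro ⟨β, z⟩ h
      simp only [colPairs, rowPairs, Finset.coe_filter, Finset.mem_filter, Finset.mem_univ,
        true_and, Set.mem_ofPred_eq] at h ⊢
      obtain ⟨hβ, h1, h3, h2⟩ := h
      rw [target, if_neg h3, supportPerm_supportPerm hD]
      exact ⟨⟨hβ, h1.supportPerm hD hβ, h2⟩, h3⟩
    · rintro ⟨β, z⟩ _
      simp only [supportPerm_supportPerm hD]
    · rintro ⟨β, z⟩ _
      simp only [supportPerm_supportPerm hD]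
  have h2 : (highPairs D).filter (fun s => s.1.rowIndex ≠ s.1.rowIndex.rev) = rowPairs D := by
    ext s
    simp only [highPairs, rowPairs, Finset.mem_filter, Finset.mem_univ, true_and]
    tauto
  set A := (colPairs D).filter fun s => ¬ s.1.rowIndex ≠ s.1.rowIndex.rev with hA
  have h3 : A.filter (fun s => s.2 < s.1.rowIndex) =
      (highPairs D).filter (fun s => ¬ s.1.rowIndex ≠ s.1.rowIndex.rev) := by
    ext ⟨β, z⟩
    simp only [hA, highPairs, colPairs, Finset.mem_filter, Finset.mem_univ, true_and, not_not]
    constructor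
    · rintro ⟨⟨⟨a, b, -⟩, c⟩, d⟩
      exact ⟨⟨a, b, d⟩, c⟩
    · rintro ⟨⟨a, b, d⟩, c⟩
      refine ⟨⟨⟨a, b, ?_⟩, c⟩, d⟩
      rw [target, if_pos c]
      exact (b.supportPerm hD a).2.1
  have h4 : (A.filter (fun s => ¬ s.2 < s.1.rowIndex)).card =
      (A.filter (fun s => s.2 < s.1.rowIndex)).card := by
    have hrev : ∀ s ∈ A, (s.1, s.2.rev) ∈ A := by
      rintro ⟨β, z⟩ h
      simp only [hA, colPairs, Finset.mem_filter, Finset.mem_univ, true_and, not_not] at h ⊢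
      obtain ⟨⟨a, b, -⟩, c⟩ := h
      refine ⟨⟨a, b.rev, ?_⟩, c⟩
      rw [target, if_pos c]
      exact (b.rev.supportPerm hD a).2.1
    have hne : ∀ s ∈ A, s.2 ≠ s.1.rowIndex ∧ s.1.rowIndex = s.1.rowIndex.rev := by
      rintro ⟨β, z⟩ h
      simp only [hA, colPairs, Finset.mem_filter, Finset.mem_univ, true_and, not_not] at h
      exact ⟨fun e : z = _ => h.1.2.1.2.2.1 (e ▸ β.meets_rowIndex), h.2⟩
    refine Finset.card_nbij' (fun s => (s.1, s.2.rev)) (fun s => (s.1, s.2.rev)) ?_ ?_ ?_ ?_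
    · rintro ⟨β, z⟩ h
      simp only [Finset.coe_filter, Set.mem_ofPred_eq] at h ⊢
      refine ⟨hrev _ h.1, ?_⟩
      obtain ⟨h5, h6⟩ := hne _ h.1
      rw [h6]
      exact Fin.rev_lt_rev.mpr (lt_of_le_of_ne (not_lt.mp h.2) h5.symm)
    · rintro ⟨β, z⟩ h
      simp only [Finset.coe_filter, Set.mem_ofPred_eq] at h ⊢
      refine ⟨hrev _ h.1, ?_⟩
      obtain ⟨h5, h6⟩ := hne _ h.1
      rw [h6, Fin.rev_lt_rev]
      exact h.2.asymm
    · rintro ⟨β, z⟩ _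
      simp
    · rintro ⟨β, z⟩ _
      simp
  have e1 := Finset.card_filter_add_card_filter_not (s := colPairs D)
    (fun s => s.1.rowIndex ≠ s.1.rowIndex.rev)
  have e2 := Finset.card_filter_add_card_filter_not (s := highPairs D)
    (fun s => s.1.rowIndex ≠ s.1.rowIndex.rev)
  have e3 := Finset.card_filter_add_card_filter_not (s := A) (fun s => s.2 < s.1.rowIndex)
  rw [h4, h3] at e3
  rw [h2] at e2
  rw [h1, ← hA] at e1
  omega

/-- The inverted roots are the elements of `D`, those at `(col β, z)` for `(β, z) ∈ colPairs D` and
those at `(z, row β)` for `(β, z) ∈ rowPairs D`. -/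
theorem inversions_supportPerm (hD : IsOrthogonalRookPlacement D) :
    inversions (supportPerm D) =
      D.card + (2 * (decompositions D).card + 2 * dNumber D) := by
  rw [← mul_add, ← card_highPairs D hD, ← card_colPairs hD]
  have hA : ∀ s ∈ colPairs D, ∃ γ : PosRoot X n, γ.IsAt s.1.colIndex s.2 := by
    rintro ⟨β, z⟩ h
    simp only [colPairs, Finset.mem_filter, Finset.mem_univ, true_and] at h
    exact exists_isAt h.2.1.1 h.2.1.2.1.ne
  have hB : ∀ s ∈ rowPairs D, ∃ γ : PosRoot X n, γ.IsAt s.2 s.1.rowIndex := by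
    rintro ⟨β, z⟩ h
    simp only [rowPairs, Finset.mem_filter, Finset.mem_univ, true_and] at h
    refine exists_isAt h.2.2.2 fun e => h.2.1.2.2.1 ?_
    rw [← meets_rev_iff, ← e]
    exact β.meets_rowIndex
  rcases isEmpty_or_nonempty (PosRoot X n) with hemp | hne
  · simp [inversions, colPairs, rowPairs, Finset.eq_empty_of_isEmpty]
  choose! f hf using hA
  choose! g hg using hB
  have hfinj : Set.InjOn f (colPairs D) := by
    rintro ⟨β, z⟩ h ⟨β', z'⟩ h' e
    have h1 := hf _ h
    have h2 := hf _ h'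
    simp only [colPairs, Finset.coe_filter, Finset.mem_univ, true_and, Set.mem_ofPred_eq] at h h'
    rw [e] at h1
    rcases h1.eq_or h2 with ⟨a1, a2⟩ | ⟨a1, a2⟩ <;> simp only at a1 a2
    · rw [hD.eq_of_meets h.1 h'.1 β.meets_colIndex (a1 ▸ β'.meets_colIndex), a2]
    · have c1 := h.2.1.2.1
      rw [a1, a2, Fin.rev_rev] at c1
      exact absurd h'.2.1.2.1 c1.asymm
  have hginj : Set.InjOn g (rowPairs D) := by
    rintro ⟨β, z⟩ h ⟨β', z'⟩ h' e
    have h1 := hg _ h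
    have h2 := hg _ h'
    simp only [rowPairs, Finset.coe_filter, Finset.mem_univ, true_and, Set.mem_ofPred_eq] at h h'
    rw [e] at h1
    rcases h1.eq_or h2 with ⟨a1, a2⟩ | ⟨a1, a2⟩ <;> simp only at a1 a2
    · rw [hD.eq_of_meets h.1 h'.1 β.meets_rowIndex (a2 ▸ β'.meets_rowIndex), a1]
    · have a3 : z' = β.rowIndex.rev := by rw [a2, Fin.rev_rev]
      rcases h.2.1.2.2.2 β' h'.1 (a1 ▸ β'.meets_rowIndex.rev) with c1 | c1
      · rw [a1, Fin.rev_rev] at c1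
        exact absurd c1.symm h'.2.2.1
      rcases h'.2.1.2.2.2 β h.1 (a3 ▸ β.meets_rowIndex.rev) with c2 | c2
      · rw [a3, Fin.rev_rev] at c2
        exact absurd c2.symm h.2.2.1
      · exact absurd c2 c1.asymm
  have hAB : Disjoint ((colPairs D).image f) ((rowPairs D).image g) := by
    rw [Finset.disjoint_left]
    intro γ h h'
    simp only [Finset.mem_image] at h h'
    obtain ⟨⟨β, z⟩, h, rfl⟩ := h
    obtain ⟨⟨β', z'⟩, h', e⟩ := h'
    have h1 := hf _ h
    have h2 := hg _ h'
    simp only [rowPairs, colPairs, Finset.mem_filter, Finset.mem_univ, true_and] at h h'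
    rw [e] at h2
    rcases h1.eq_or h2 with ⟨a1, a2⟩ | ⟨a1, a2⟩ <;> simp only at a1 a2
    · rcases h.2.1.2.2.2 β' h'.1 (a2 ▸ β'.meets_rowIndex) with c1 | c1
      · rw [a2] at c1
        exact h'.2.2.1 c1
      rcases h'.2.1.2.2.2 β h.1 (a1 ▸ β.meets_colIndex) with c2 | c2
      · rw [← a1] at c2
        exact β.colIndex_ne_rev c2
      · exact c1.asymm c2
    · have := hD.eq_of_meets h.1 h'.1 β.meets_colIndex (a1 ▸ β'.meets_rowIndex.rev)
      subst this
      have := β.rowIndex_lt_rev_colIndex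
      rw [a1, Fin.rev_rev] at this
      exact lt_irrefl _ this
  have hDA : Disjoint D ((colPairs D).image f ∪ (rowPairs D).image g) := by
    rw [Finset.disjoint_left]
    intro γ hγ h
    rw [Finset.mem_union, Finset.mem_image, Finset.mem_image] at h
    rcases h with ⟨⟨β, z⟩, h, rfl⟩ | ⟨⟨β, z⟩, h, rfl⟩
    · have h1 := (hf _ h).meets
      simp only [colPairs, Finset.mem_filter, Finset.mem_univ, true_and] at h h1
      refine h.2.1.2.2.1 ?_
      rw [hD.eq_of_meets h.1 hγ β.meets_colIndex h1.1]
      exact h1.2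
    · have h1 := (hg _ h).meets
      simp only [rowPairs, Finset.mem_filter, Finset.mem_univ, true_and] at h h1
      refine h.2.1.2.2.1 ?_
      rw [hD.eq_of_meets h.1 hγ β.meets_rowIndex h1.2]
      exact h1.1
  rw [← Finset.card_image_of_injOn hfinj, ← Finset.card_image_of_injOn hginj,
    ← Finset.card_union_of_disjoint hAB, ← Finset.card_union_of_disjoint hDA, inversions]
  congr 1
  have hrev := supportPerm_rev (D := D)
  ext γ
  simp only [Finset.mem_filter, Finset.mem_univ, true_and, Finset.mem_union, Finset.mem_image,
    Prod.exists]
  constructor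
  · intro hinv
    by_cases hγ : γ ∈ D
    · exact Or.inl hγ
    · obtain ⟨β, hβ, ⟨z, h1, h2, h3⟩ | ⟨z, h1, h2, h3, h4⟩⟩ := exists_of_inverted hD hγ hinv
      · have hmem : (β, z) ∈ colPairs D := by
          simp only [colPairs, Finset.mem_filter, Finset.mem_univ, true_and]
          exact ⟨hβ, h1, h2⟩
        exact Or.inr (Or.inl ⟨β, z, hmem, (hf _ hmem).unique h3⟩)
      · have hmem : (β, z) ∈ rowPairs D := by
          simp only [rowPairs, Finset.mem_filter, Finset.mem_univ, true_and]
          exact ⟨hβ, h1, h2, h3⟩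
        exact Or.inr (Or.inr ⟨β, z, hmem, (hg _ hmem).unique h4⟩)
  · rintro (hγ | ⟨β, z, h, rfl⟩ | ⟨β, z, h, rfl⟩)
    · rw [supportPerm_of_meets hD hγ γ.meets_rowIndex, supportPerm_of_meets hD hγ γ.meets_colIndex]
      exact γ.perm_rowIndex_lt
    · refine ((hf _ h).inverted_iff hrev).mpr ?_
      simp only [colPairs, Finset.mem_filter, Finset.mem_univ, true_and] at h ⊢
      rw [supportPerm_colIndex hD h.1]
      exact h.2.2
    · refine ((hg _ h).inverted_iff hrev).mpr ?_
      simp only [rowPairs, Finset.mem_filter, Finset.mem_univ, true_and] at h ⊢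
      rw [supportPerm_rowIndex hD h.1 h.2.2.1]
      exact (h.2.1.supportPerm hD h.1).1

end Count

end

/-! ### The Cayley transform -/

section

namespace Matrix

variable {m : ℕ} {A : Type*}

/-- The transpose with respect to the antidiagonal. -/
def antitranspose (x : Matrix (Fin m) (Fin m) A) : Matrix (Fin m) (Fin m) A :=
  of fun i j => x j.rev i.rev

theorem antitranspose_apply (x : Matrix (Fin m) (Fin m) A) (i j : Fin m) :
    x.antitranspose i j = x j.rev i.rev := rfl

theorem antitranspose_antitranspose (x : Matrix (Fin m) (Fin m) A) :
    x.antitranspose.antitranspose = x := by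
  ext i j
  simp [antitranspose_apply]

variable [CommRing A]

theorem antitranspose_add (x y : Matrix (Fin m) (Fin m) A) :
    (x + y).antitranspose = x.antitranspose + y.antitranspose := rfl

theorem antitranspose_sub (x y : Matrix (Fin m) (Fin m) A) :
    (x - y).antitranspose = x.antitranspose - y.antitranspose := rfl

theorem antitranspose_smul (a : A) (x : Matrix (Fin m) (Fin m) A) :
    (a • x).antitranspose = a • x.antitranspose := rfl

theorem antitranspose_one : (1 : Matrix (Fin m) (Fin m) A).antitranspose = 1 := by
  ext i j
  rw [antitranspose_apply, one_apply, one_apply]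
  simp only [Fin.rev_inj, eq_comm]

theorem antitranspose_mul (x y : Matrix (Fin m) (Fin m) A) :
    (x * y).antitranspose = y.antitranspose * x.antitranspose := by
  ext i j
  rw [antitranspose_apply, mul_apply, mul_apply, ← Equiv.sum_comp Fin.revPerm]
  refine Finset.sum_congr rfl fun k _ => ?_
  rw [antitranspose_apply, antitranspose_apply, Fin.revPerm_apply, mul_comm]

theorem antitranspose_pow (x : Matrix (Fin m) (Fin m) A) (k : ℕ) :
    (x ^ k).antitranspose = x.antitranspose ^ k := by
  induction k with
  | zero => simp [antitranspose_one]
  | succ k ih => rw [pow_succ, antitranspose_mul, ih, pow_succ']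

theorem antitranspose_sum {ι : Type*} (s : Finset ι) (f : ι → Matrix (Fin m) (Fin m) A) :
    (∑ i ∈ s, f i).antitranspose = ∑ i ∈ s, (f i).antitranspose := by
  ext i j
  simp only [antitranspose_apply, Matrix.sum_apply]

theorem antitranspose_map {B : Type*} [CommRing B] (f : A →+* B) (x : Matrix (Fin m) (Fin m) A) :
    x.antitranspose.map f = (x.map f).antitranspose := rfl

theorem antitranspose_single (i j : Fin m) (a : A) :
    (single i j a).antitranspose = single j.rev i.rev a := by
  ext k l
  simp only [antitranspose_apply, single_apply]
  have h1 : i = l.rev ↔ i.rev = l := Fin.rev_eq_iff.symm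
  have h2 : j = k.rev ↔ j.rev = k := Fin.rev_eq_iff.symm
  grind

variable (m A) in
/-- The filtration of the lower triangular matrices by the distance from the diagonal: the entries
`(i, j)` with `i < j + k` vanish. -/
def lowerFiltration (k : ℕ) : Submodule A (Matrix (Fin m) (Fin m) A) where
  carrier := {x | ∀ i j : Fin m, (i : ℕ) < j + k → x i j = 0}
  add_mem' {x y} hx hy i j h := by rw [add_apply, hx i j h, hy i j h, add_zero]
  zero_mem' _ _ _ := rfl
  smul_mem' a x hx i j h := by rw [smul_apply, hx i j h, smul_zero]

theorem lowerFiltration_anti {k l : ℕ} (h : k ≤ l) :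
    lowerFiltration m A l ≤ lowerFiltration m A k :=
  fun _ hx i j hij => hx i j (by omega)

theorem mul_mem_lowerFiltration {k l : ℕ} {x y : Matrix (Fin m) (Fin m) A}
    (hx : x ∈ lowerFiltration m A k) (hy : y ∈ lowerFiltration m A l) :
    x * y ∈ lowerFiltration m A (k + l) := by
  intro i j hij
  rw [mul_apply]
  refine Finset.sum_eq_zero fun a _ => ?_
  rcases lt_or_ge (i : ℕ) (a + k) with h | h
  · rw [hx i a h, zero_mul]
  · rw [hy a j (by omega), mul_zero]

theorem one_mem_lowerFiltration : (1 : Matrix (Fin m) (Fin m) A) ∈ lowerFiltration m A 0 := by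
  intro i j hij
  rw [one_apply_ne]
  rintro rfl
  omega

theorem pow_mem_lowerFiltration {x : Matrix (Fin m) (Fin m) A} {l : ℕ}
    (hx : x ∈ lowerFiltration m A l) (k : ℕ) : x ^ k ∈ lowerFiltration m A (k * l) := by
  induction k with
  | zero => simpa using one_mem_lowerFiltration
  | succ k ih =>
    rw [pow_succ, Nat.succ_mul]
    exact mul_mem_lowerFiltration ih hx

theorem eq_zero_of_mem_lowerFiltration {x : Matrix (Fin m) (Fin m) A} {k : ℕ} (hk : m ≤ k)
    (hx : x ∈ lowerFiltration m A k) : x = 0 := by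
  ext i j
  exact hx i j (by omega)

theorem antitranspose_mem_lowerFiltration {x : Matrix (Fin m) (Fin m) A} {k : ℕ}
    (hx : x ∈ lowerFiltration m A k) : x.antitranspose ∈ lowerFiltration m A k := by
  intro i j h
  refine hx _ _ ?_
  rw [Fin.val_rev, Fin.val_rev]
  omega

/-- The geometric series `1 + x + x² + ⋯`, which for a strictly lower triangular matrix `x` is the
inverse of `1 - x`. It is truncated after the power `m + 1`, so that there are always at least two
terms. -/
def geomSeries (x : Matrix (Fin m) (Fin m) A) : Matrix (Fin m) (Fin m) A :=
  ∑ k ∈ Finset.range (m + 2), x ^ k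

theorem pow_eq_zero_of_mem_lowerFiltration {x : Matrix (Fin m) (Fin m) A}
    (hx : x ∈ lowerFiltration m A 1) : x ^ (m + 2) = 0 :=
  eq_zero_of_mem_lowerFiltration (by omega) (pow_mem_lowerFiltration hx (m + 2))

theorem one_sub_mul_geomSeries {x : Matrix (Fin m) (Fin m) A} (hx : x ∈ lowerFiltration m A 1) :
    (1 - x) * geomSeries x = 1 := by
  rw [geomSeries, mul_neg_geom_sum, pow_eq_zero_of_mem_lowerFiltration hx, sub_zero]

theorem geomSeries_mul_one_sub {x : Matrix (Fin m) (Fin m) A} (hx : x ∈ lowerFiltration m A 1) :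
    geomSeries x * (1 - x) = 1 := by
  rw [geomSeries, geom_sum_mul_neg, pow_eq_zero_of_mem_lowerFiltration hx, sub_zero]

theorem geomSeries_mem {x : Matrix (Fin m) (Fin m) A} (hx : x ∈ lowerFiltration m A 1) :
    geomSeries x ∈ lowerFiltration m A 0 :=
  Submodule.sum_mem _ fun k _ =>
    lowerFiltration_anti (Nat.zero_le _) (pow_mem_lowerFiltration hx k)

theorem geomSeries_sub_one_mem {x : Matrix (Fin m) (Fin m) A} {k : ℕ}
    (hx : x ∈ lowerFiltration m A k) : geomSeries x - 1 ∈ lowerFiltration m A k := by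
  rw [geomSeries, Finset.sum_range_succ', pow_zero, add_sub_cancel_right]
  refine Submodule.sum_mem _ fun j _ => ?_
  exact lowerFiltration_anti (Nat.le_mul_of_pos_left k j.succ_pos) (pow_mem_lowerFiltration hx _)

/-- The Cayley transform `(1 + x)(1 - x)⁻¹` of a strictly lower triangular matrix. -/
def cayley (x : Matrix (Fin m) (Fin m) A) : Matrix (Fin m) (Fin m) A :=
  (1 + x) * geomSeries x

theorem commute_geomSeries (x : Matrix (Fin m) (Fin m) A) : Commute x (geomSeries x) :=
  Commute.sum_right _ _ _ fun k _ => Commute.self_pow x k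

theorem antitranspose_geomSeries (x : Matrix (Fin m) (Fin m) A) :
    (geomSeries x).antitranspose = geomSeries x.antitranspose := by
  simp only [geomSeries, antitranspose_sum, antitranspose_pow]

theorem antitranspose_cayley (x : Matrix (Fin m) (Fin m) A) :
    (cayley x).antitranspose = cayley x.antitranspose := by
  rw [cayley, antitranspose_mul, antitranspose_geomSeries, antitranspose_add, antitranspose_one,
    cayley]
  exact ((Commute.one_left _).add_left (commute_geomSeries _)).symm.eq

theorem cayley_neg_mul_cayley {x : Matrix (Fin m) (Fin m) A} (hx : x ∈ lowerFiltration m A 1) :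
    cayley (-x) * cayley x = 1 := by
  have h1 := geomSeries_mul_one_sub (Submodule.neg_mem _ hx)
  have h2 := one_sub_mul_geomSeries hx
  rw [sub_neg_eq_add] at h1
  have h3 : Commute (1 + -x) (geomSeries (-x)) :=
    (Commute.one_left _).add_left (commute_geomSeries _)
  rw [cayley, cayley, h3.eq, ← sub_eq_add_neg]
  have h4 : (1 - x) * (1 + x) = (1 + x) * (1 - x) := by noncomm_ring
  calc geomSeries (-x) * (1 - x) * ((1 + x) * geomSeries x)
      = geomSeries (-x) * ((1 - x) * (1 + x)) * geomSeries x := by simp only [mul_assoc]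
    _ = geomSeries (-x) * (1 + x) * ((1 - x) * geomSeries x) := by rw [h4]; simp only [mul_assoc]
    _ = 1 := by rw [h1, h2, one_mul]

theorem cayley_map {B : Type*} [CommRing B] (f : A →+* B) (x : Matrix (Fin m) (Fin m) A) :
    (cayley x).map f = cayley (x.map f) := by
  have h : ∀ y : Matrix (Fin m) (Fin m) A, y.map f = f.mapMatrix y := fun _ => rfl
  simp only [cayley, geomSeries, h, map_mul, map_add, map_one, map_sum, map_pow]

theorem cayley_sub_one_mem {x : Matrix (Fin m) (Fin m) A} {k : ℕ}
    (hx : x ∈ lowerFiltration m A k) : cayley x - 1 ∈ lowerFiltration m A k := by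
  have h1 := geomSeries_sub_one_mem hx
  have h2 : cayley x - 1 = (geomSeries x - 1) + x + x * (geomSeries x - 1) := by
    rw [cayley]; noncomm_ring
  rw [h2]
  refine Submodule.add_mem _ (Submodule.add_mem _ h1 hx) ?_
  exact lowerFiltration_anti (Nat.le_add_right _ _) (mul_mem_lowerFiltration hx h1)

/-- The Cayley transform agrees with `1 + 2x` up to terms of higher order. -/
theorem cayley_sub_mem {x : Matrix (Fin m) (Fin m) A} {k : ℕ} (hx : x ∈ lowerFiltration m A k) :
    cayley x - 1 - (2 : A) • x ∈ lowerFiltration m A (k + k) := by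
  have h1 := geomSeries_sub_one_mem hx
  have h2 : cayley x - 1 - (2 : A) • x = (geomSeries x - 1 - x) + x * (geomSeries x - 1) := by
    rw [cayley, two_smul]; noncomm_ring
  rw [h2]
  refine Submodule.add_mem _ ?_ (mul_mem_lowerFiltration hx h1)
  have h3 : geomSeries x - 1 - x = ∑ j ∈ Finset.range m, x ^ (j + 2) := by
    rw [geomSeries, Finset.sum_range_succ', Finset.sum_range_succ']
    simp
  rw [h3]
  refine Submodule.sum_mem _ fun j _ => ?_
  exact lowerFiltration_anti (by nlinarith [Nat.zero_le (j * k)]) (pow_mem_lowerFiltration hx _)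

end Matrix

open Matrix

variable {X : OrthType} {n : ℕ} {K : Type*} [Field K]

theorem mem_nilpotentAlgebra {x : Matrix (Fin (X.size n)) (Fin (X.size n)) K} :
    x ∈ nilpotentAlgebra X n K ↔
      x ∈ lowerFiltration (X.size n) K 1 ∧ x.antitranspose = -x := by
  rw [mem_nilpotentAlgebra_iff]
  refine and_congr ?_ ?_
  · refine forall_congr' fun i => forall_congr' fun j => ?_
    rw [Nat.lt_succ_iff, ← Fin.le_def]
  · rw [← Matrix.ext_iff]
    rfl

theorem mem_unipotentGroup {g : Matrix.GeneralLinearGroup (Fin (X.size n)) K} :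
    g ∈ unipotentGroup X n K ↔
      g.val - 1 ∈ lowerFiltration (X.size n) K 1 ∧ g.val.antitranspose * g.val = 1 := by
  have hJ : ∀ x : Matrix (Fin (X.size n)) (Fin (X.size n)) K,
      antidiagonalForm X n K * (x.transpose * antidiagonalForm X n K) = x.antitranspose := by
    intro x
    ext i j
    rw [antidiagonalForm_mul_apply, mul_antidiagonalForm_apply]
    rfl
  have hJJ : antidiagonalForm X n K * antidiagonalForm X n K = 1 := by
    have := hJ 1
    rwa [Matrix.transpose_one, one_mul, antitranspose_one] at this
  have key : g.val.transpose * antidiagonalForm X n K * g.val = antidiagonalForm X n K ↔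
      g.val.antitranspose * g.val = 1 := by
    rw [← hJ]
    constructor
    · intro h
      rw [mul_assoc, h, hJJ]
    · intro h
      calc g.val.transpose * antidiagonalForm X n K * g.val
          = (antidiagonalForm X n K * antidiagonalForm X n K) *
            (g.val.transpose * antidiagonalForm X n K * g.val) := by rw [hJJ, one_mul]
        _ = antidiagonalForm X n K *
            (antidiagonalForm X n K * (g.val.transpose * antidiagonalForm X n K) * g.val) := by
          simp only [mul_assoc]
        _ = _ := by rw [h, mul_one]
  change ((∀ i j, i < j → g.val i j = 0) ∧ (∀ i, g.val i i = 1) ∧ _) ↔ _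
  rw [key, ← and_assoc]
  refine and_congr ?_ Iff.rfl
  constructor
  · rintro ⟨h1, h2⟩ i j hij
    rw [Matrix.sub_apply, one_apply]
    rcases lt_or_eq_of_le (show i ≤ j by rw [Fin.le_def]; omega) with h | rfl
    · rw [h1 i j h, if_neg h.ne, sub_zero]
    · rw [h2, if_pos rfl, sub_self]
  · intro h
    constructor
    · intro i j hij
      have := h i j (by rw [Fin.lt_def] at hij; omega)
      rwa [Matrix.sub_apply, one_apply, if_neg hij.ne, sub_zero] at this
    · intro i
      have := h i i (by omega)
      rwa [Matrix.sub_apply, one_apply, if_pos rfl, sub_eq_zero] at this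

end

/-! ### The linear form on `𝔲` and its commutators -/

section

open PosRoot Matrix

variable {X : OrthType} {n : ℕ} {K : Type*} [Field K] {D : Finset (PosRoot X n)}

/-- The linear form `x ↦ ∑ ξ_β (x_{r,c} - x_{-c,-r})`, with `c = col β` and `r = row β`, on all
matrices. It changes sign under the antitranspose, and on `𝔲` it is twice the form `f_{D,ξ}`. -/
def skewForm (D : Finset (PosRoot X n)) (ξ : D → K) :
    Matrix (Fin (X.size n)) (Fin (X.size n)) K →ₗ[K] K where
  toFun x := ∑ β : D, ξ β *
    (x β.1.rowIndex β.1.colIndex - x β.1.colIndex.rev β.1.rowIndex.rev)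
  map_add' x y := by
    rw [← Finset.sum_add_distrib]
    refine Finset.sum_congr rfl fun β _ => ?_
    rw [Matrix.add_apply, Matrix.add_apply]
    ring
  map_smul' a x := by
    rw [RingHom.id_apply, smul_eq_mul, Finset.mul_sum]
    refine Finset.sum_congr rfl fun β _ => ?_
    rw [Matrix.smul_apply, Matrix.smul_apply, smul_eq_mul, smul_eq_mul]
    ring

theorem skewForm_apply (ξ : D → K) (x : Matrix (Fin (X.size n)) (Fin (X.size n)) K) :
    skewForm D ξ x = ∑ β : D, ξ β *
      (x β.1.rowIndex β.1.colIndex - x β.1.colIndex.rev β.1.rowIndex.rev) := rfl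

theorem skewForm_antitranspose (ξ : D → K) (x : Matrix (Fin (X.size n)) (Fin (X.size n)) K) :
    skewForm D ξ x.antitranspose = -skewForm D ξ x := by
  rw [skewForm_apply, skewForm_apply, ← Finset.sum_neg_distrib]
  refine Finset.sum_congr rfl fun β _ => ?_
  rw [antitranspose_apply, antitranspose_apply, Fin.rev_rev, Fin.rev_rev]
  ring

theorem canonicalForm_apply (ξ : D → K) (u : nilpotentAlgebra X n K) :
    canonicalForm D ξ u = 2⁻¹ * skewForm D ξ u.1 := by
  rw [canonicalForm, LinearMap.sum_apply, skewForm_apply, Finset.mul_sum]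
  refine Finset.sum_congr rfl fun β _ => ?_
  have h : (((β.1.rootMatrix K).transpose * u.1).trace : K) =
      u.1 β.1.rowIndex β.1.colIndex - u.1 β.1.colIndex.rev β.1.rowIndex.rev := by
    rw [rootMatrix, transpose_sub, transpose_single, transpose_single, sub_mul, trace_sub,
      trace_single_mul, trace_single_mul, one_smul, one_smul]
    rfl
  have h2 : β.1.dualVector K u = 2⁻¹ * ((β.1.rootMatrix K).transpose * u.1).trace := rfl
  rw [LinearMap.smul_apply, h2, h, smul_eq_mul]
  ring

/-- The condition `F(yg) = F(gy)` for all strictly lower triangular `y`. For `g ∈ U` it describes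
the stabilizer of `f_{D,ξ}`, and for `g ∈ 𝔲` the radical of `(u, v) ↦ f_{D,ξ}([u, v])`; being linear
in `g`, it is preserved by the Cayley transform. -/
def Centralizes {m : ℕ} (F : Matrix (Fin m) (Fin m) K →ₗ[K] K) (g : Matrix (Fin m) (Fin m) K) :
    Prop :=
  ∀ y ∈ lowerFiltration m K 1, F (y * g) = F (g * y)

theorem centralizes_iff_single {m : ℕ} {F : Matrix (Fin m) (Fin m) K →ₗ[K] K}
    {g : Matrix (Fin m) (Fin m) K} :
    Centralizes F g ↔ ∀ x y : Fin m, x < y → F (g * single y x 1) - F (single y x 1 * g) = 0 := by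
  constructor
  · intro h x y hxy
    rw [h _, sub_self]
    intro i j hij
    rw [single_apply, if_neg]
    rintro ⟨rfl, rfl⟩
    rw [Fin.lt_def] at hxy
    omega
  · intro h z hz
    have h1 : ∀ i j, F (z i j • (single i j 1 * g)) = F (z i j • (g * single i j 1)) := by
      intro i j
      by_cases hij : j < i
      · rw [map_smul, map_smul, sub_eq_zero.mp (h j i hij)]
      · rw [hz i j (by rw [Fin.lt_def] at hij; omega), zero_smul, zero_smul]
    have h2 : z = ∑ i, ∑ j, z i j • single i j (1 : K) := by
      conv_lhs => rw [matrix_eq_sum_single z]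
      refine Finset.sum_congr rfl fun i _ => Finset.sum_congr rfl fun j _ => ?_
      rw [smul_single, smul_eq_mul, mul_one]
    rw [h2]
    simp only [Finset.sum_mul, Finset.mul_sum, smul_mul_assoc, mul_smul_comm, map_sum]
    exact Finset.sum_congr rfl fun i _ => Finset.sum_congr rfl fun j _ => h1 i j

/-- The linear form `u ↦ F([u, e_{y,x}])` on `𝔲`, where `F` is `skewForm D ξ`. At the column and the
row of a root `α` its value is `f_{D,ξ}([u, e_α])`. -/
def pairingForm (D : Finset (PosRoot X n)) (ξ : D → K) (x y : Fin (X.size n)) :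
    nilpotentAlgebra X n K →ₗ[K] K :=
  skewForm D ξ ∘ₗ
    (LinearMap.mulRight K (single y x (1 : K)) - LinearMap.mulLeft K (single y x 1)) ∘ₗ
    (nilpotentAlgebra X n K).subtype

theorem pairingForm_apply (ξ : D → K) (x y : Fin (X.size n)) (u : nilpotentAlgebra X n K) :
    pairingForm D ξ x y u = skewForm D ξ (u.1 * single y x 1 - single y x 1 * u.1) := rfl

theorem mul_single_apply' {m : ℕ} (u : Matrix (Fin m) (Fin m) K) (x y a b : Fin m) :
    (u * single y x (1 : K)) a b = if b = x then u a y else 0 := by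
  split_ifs with h
  · subst h; simp
  · exact mul_single_apply_of_ne _ _ _ _ _ h _

theorem single_mul_apply' {m : ℕ} (u : Matrix (Fin m) (Fin m) K) (x y a b : Fin m) :
    (single y x (1 : K) * u) a b = if a = y then u x b else 0 := by
  split_ifs with h
  · subst h; simp
  · exact single_mul_apply_of_ne _ _ _ _ _ h _

theorem nilpotentAlgebra_rev (u : nilpotentAlgebra X n K) (a b : Fin (X.size n)) :
    u.1 b.rev a.rev = -u.1 a b := by
  have := congrFun (congrFun (mem_nilpotentAlgebra.mp u.2).2 a) b
  exact this

theorem nilpotentAlgebra_of_le (u : nilpotentAlgebra X n K) {a b : Fin (X.size n)} (h : a ≤ b) :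
    u.1 a b = 0 :=
  (mem_nilpotentAlgebra.mp u.2).1 a b (by rw [Fin.le_def] at h; omega)

theorem pairingForm_eq (ξ : D → K) (x y : Fin (X.size n)) (u : nilpotentAlgebra X n K) :
    pairingForm D ξ x y u = ∑ β : D, ξ β *
      ((if β.1.colIndex = x then u.1 β.1.rowIndex y else 0)
        + (if β.1.rowIndex.rev = x then u.1 y.rev β.1.colIndex else 0)
        - (if β.1.rowIndex = y then u.1 x β.1.colIndex else 0)
        - (if β.1.colIndex.rev = y then u.1 β.1.rowIndex x.rev else 0)) := by
  rw [pairingForm_apply, skewForm_apply]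
  refine Finset.sum_congr rfl fun β _ => ?_
  have h1 := nilpotentAlgebra_rev u y.rev β.1.colIndex
  have h2 := nilpotentAlgebra_rev u β.1.rowIndex x.rev
  rw [Fin.rev_rev] at h1 h2
  simp only [Matrix.sub_apply, mul_single_apply', single_mul_apply', h1, h2]
  split_ifs <;> ring

/-- The element `e_{y,x} - e_{-x,-y}` of `𝔲`, for positions `x < y`. -/
def skewUnit (K : Type*) [Field K] {x y : Fin (X.size n)} (h : x < y) : nilpotentAlgebra X n K :=
  ⟨single y x 1 - single x.rev y.rev 1, by
    rw [mem_nilpotentAlgebra]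
    constructor
    · intro i j hij
      rw [Fin.lt_def] at h
      rw [Matrix.sub_apply, single_apply, single_apply, if_neg, if_neg, sub_zero]
      · rintro ⟨rfl, rfl⟩
        rw [Fin.val_rev, Fin.val_rev] at hij
        omega
      · rintro ⟨rfl, rfl⟩
        omega
    · rw [antitranspose_sub, antitranspose_single, antitranspose_single, Fin.rev_rev, Fin.rev_rev,
        neg_sub]⟩

theorem skewUnit_apply {x y : Fin (X.size n)} (h : x < y) (a b : Fin (X.size n)) :
    (skewUnit K h).1 a b =
      (if y = a ∧ x = b then 1 else 0) - (if x.rev = a ∧ y.rev = b then 1 else 0) := by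
  change (single y x (1 : K) - single x.rev y.rev 1 : Matrix _ _ K) a b = _
  rw [Matrix.sub_apply, single_apply, single_apply]

theorem skewForm_commutator_antitranspose (ξ : D → K) (u : nilpotentAlgebra X n K)
    (y : Matrix (Fin (X.size n)) (Fin (X.size n)) K) :
    skewForm D ξ (u.1 * y.antitranspose - y.antitranspose * u.1) =
      -skewForm D ξ (u.1 * y - y * u.1) := by
  rw [← skewForm_antitranspose, antitranspose_sub, antitranspose_mul, antitranspose_mul,
    (mem_nilpotentAlgebra.mp u.2).2]
  congr 1
  noncomm_ring

theorem skewForm_commutator_skewUnit (ξ : D → K) (u : nilpotentAlgebra X n K)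
    {x y : Fin (X.size n)} (h : x < y) :
    skewForm D ξ (u.1 * (skewUnit K h).1 - (skewUnit K h).1 * u.1) =
      2 * pairingForm D ξ x y u := by
  have h1 : (skewUnit K h).1 = single y x 1 - (single y x (1 : K)).antitranspose := by
    rw [antitranspose_single]; rfl
  have h2 := skewForm_commutator_antitranspose ξ u (single y x 1)
  rw [h1, mul_sub, sub_mul, pairingForm_apply, sub_sub_sub_comm, map_sub, h2]
  ring

theorem pairingForm_rev (ξ : D → K) (x y : Fin (X.size n)) (u : nilpotentAlgebra X n K) :
    pairingForm D ξ y.rev x.rev u = -pairingForm D ξ x y u := by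
  have := skewForm_commutator_antitranspose ξ u (single y x 1)
  rw [antitranspose_single] at this
  exact this

theorem pairingForm_skewUnit_comm (h2 : (2 : K) ≠ 0) (ξ : D → K) {x y x' y' : Fin (X.size n)}
    (h : x < y) (h' : x' < y') :
    pairingForm D ξ x y (skewUnit K h') = -pairingForm D ξ x' y' (skewUnit K h) := by
  have e1 := skewForm_commutator_skewUnit ξ (skewUnit K h') h
  have e2 := skewForm_commutator_skewUnit ξ (skewUnit K h) h'
  rw [← neg_sub, map_neg, e1] at e2
  exact mul_left_cancel₀ h2 (by linear_combination -e2)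

/-- The pairs of positions `(x, y)` and `(x', y')` are equal or related by `(x, y) ↦ (-y, -x)`. -/
def SamePair {m : ℕ} (x y x' y' : Fin m) : Prop :=
  (x = x' ∧ y = y') ∨ (x = y'.rev ∧ y = x'.rev)

theorem SamePair.rev {m : ℕ} {x y x' y' : Fin m} (h : SamePair x y x' y') :
    SamePair y.rev x.rev x' y' := by
  rcases h with ⟨rfl, rfl⟩ | ⟨rfl, rfl⟩
  · exact Or.inr ⟨rfl, rfl⟩
  · exact Or.inl ⟨Fin.rev_rev _, Fin.rev_rev _⟩

/-- Every decomposition of a root of `D` into positive roots involves one of the distinguished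
roots at `(z, row β)`, for `(β, z) ∈ decompositions D`: these form a vertex cover of the graph of
the pairs of positive roots with sum in `D`. -/
theorem exists_samePair (hD : IsOrthogonalRookPlacement D) {β : PosRoot X n} (hβ : β ∈ D)
    {z : Fin (X.size n)} (h1 : β.colIndex < z) (h2 : z < β.rowIndex) (h3 : z ≠ β.rowIndex.rev) :
    (β, z) ∈ decompositions D ∨ ∃ s ∈ decompositions D,
      SamePair β.colIndex z s.2 s.1.rowIndex ∨ SamePair z β.rowIndex s.2 s.1.rowIndex := by
  by_cases hmem : (β, z) ∈ decompositions D
  · exact Or.inl hmem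
  right
  have hex : ∃ γ ∈ D, γ.Meets z ∧ γ.colIndex < β.colIndex := by
    by_contra hno
    push Not at hno
    exact hmem (mem_decompositions.mpr ⟨hβ, h1, h2, h3, hno⟩)
  obtain ⟨γ, hγ, hm, hlt⟩ := hex
  have hne : ∀ x, β.Meets x → ¬ γ.Meets x := fun x h h' =>
    hlt.ne (congrArg _ (hD.eq_of_meets hγ hβ h' h))
  have hb := β.rowIndex_lt_rev_colIndex
  have hK : ∀ x, β.Meets x → ∀ δ ∈ D, δ.Meets x → γ.colIndex ≤ δ.colIndex := by
    intro x hx δ hδ h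
    rw [hD.eq_of_meets hδ hβ h hx]
    exact hlt.le
  rcases hm with rfl | rfl | rfl | rfl
  · exact absurd h1 hlt.asymm
  · refine ⟨(γ, β.colIndex), mem_decompositions.mpr ⟨hγ, hlt, h1, fun e : β.colIndex = _ => ?_, ?_⟩,
      Or.inl (Or.inl ⟨rfl, rfl⟩)⟩
    · exact hne _ β.meets_colIndex (e ▸ γ.meets_rowIndex.rev)
    · exact hK _ β.meets_colIndex
  · have := Fin.rev_lt_rev.mpr hlt
    exact absurd (h2.trans hb) this.asymm
  · refine ⟨(γ, β.rowIndex.rev), mem_decompositions.mpr ⟨hγ, ?_, ?_, ?_, ?_⟩,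
      Or.inr (Or.inr ⟨rfl, (Fin.rev_rev _).symm⟩)⟩
    · rw [← Fin.rev_lt_rev, Fin.rev_rev]
      exact hb.trans (Fin.rev_lt_rev.mpr hlt)
    · rw [← Fin.rev_lt_rev, Fin.rev_rev]
      exact h2
    · exact fun e => h3 e.symm
    · exact hK _ β.meets_rowIndex.rev

section Radical

variable (ξ : D → K)

theorem pairingForm_of_mem (hD : IsOrthogonalRookPlacement D) {s : PosRoot X n × Fin (X.size n)}
    (hs : s ∈ decompositions D) (u : nilpotentAlgebra X n K) :
    pairingForm D ξ s.1.colIndex s.2 u =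
      ξ ⟨s.1, (mem_decompositions.mp hs).1⟩ * u.1 s.1.rowIndex s.2 := by
  obtain ⟨β, z⟩ := s
  obtain ⟨hβ, h1, h2, h3, h4⟩ := mem_decompositions.mp hs
  simp only at hβ h1 h2 h3 h4 ⊢
  have hb := β.rowIndex_lt_rev_colIndex
  have hc := β.colIndex_lt_rowIndex
  have hb' := Fin.rev_lt_rev.mpr hb
  rw [Fin.rev_rev] at hb'
  rw [pairingForm_eq, Finset.sum_eq_single ⟨β, hβ⟩]
  · rw [if_pos rfl, if_neg hb'.ne', if_neg h2.ne', if_neg (h2.trans hb).ne']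
    ring
  · rintro ⟨γ, hγ⟩ - hne
    have hne' : γ ≠ β := fun e => hne (Subtype.ext e)
    have hno : ∀ x, β.Meets x → ¬ γ.Meets x := fun x h h' => hne' (hD.eq_of_meets hγ hβ h' h)
    have n1 : γ.colIndex ≠ β.colIndex := fun e => hno _ β.meets_colIndex (e ▸ γ.meets_colIndex)
    have n2 : γ.rowIndex.rev ≠ β.colIndex := fun e =>
      hno _ β.meets_colIndex (e ▸ γ.meets_rowIndex.rev)
    simp only
    rw [if_neg n1, if_neg n2]
    have e1 : (if γ.rowIndex = z then u.1 β.colIndex γ.colIndex else 0) = 0 := by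
      split_ifs with e
      · exact nilpotentAlgebra_of_le u (h4 γ hγ (e ▸ γ.meets_rowIndex))
      · rfl
    have e2 : (if γ.colIndex.rev = z then u.1 γ.rowIndex β.colIndex.rev else 0) = 0 := by
      split_ifs with e
      · exact nilpotentAlgebra_of_le u (γ.rowIndex_lt_rev_colIndex.le.trans (e ▸ (h2.trans hb).le))
      · rfl
    rw [e1, e2]
    ring
  · simp

end Radical

end

/-! ### The radical -/

section

open PosRoot Matrix

variable {X : OrthType} {n : ℕ} {K : Type*} [Field K] {D : Finset (PosRoot X n)}

/-- The radical of the form `(u, v) ↦ f_{D,ξ}([u, v])` on `𝔲`. -/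
def radical (D : Finset (PosRoot X n)) (ξ : D → K) : Submodule K (nilpotentAlgebra X n K) where
  carrier := {u | Centralizes (skewForm D ξ) u.1}
  add_mem' {u v} hu hv y hy := by
    rw [Submodule.coe_add, mul_add, add_mul, map_add, map_add, hu y hy, hv y hy]
  zero_mem' y _ := by simp
  smul_mem' a u hu y hy := by
    rw [Submodule.coe_smul, mul_smul_comm, smul_mul_assoc, map_smul, map_smul, hu y hy]

theorem mem_radical {ξ : D → K} {u : nilpotentAlgebra X n K} :
    u ∈ radical D ξ ↔ Centralizes (skewForm D ξ) u.1 := Iff.rfl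

theorem mem_radical_iff {ξ : D → K} {u : nilpotentAlgebra X n K} :
    u ∈ radical D ξ ↔ ∀ x y, x < y → pairingForm D ξ x y u = 0 := by
  rw [mem_radical, centralizes_iff_single]
  simp only [pairingForm_apply, map_sub]

theorem SamePair.apply_eq_zero {u : nilpotentAlgebra X n K} {x y x' y' : Fin (X.size n)}
    (h : SamePair x y x' y') (h0 : u.1 y' x' = 0) : u.1 y x = 0 := by
  rcases h with ⟨rfl, rfl⟩ | ⟨rfl, rfl⟩
  · exact h0
  · rw [nilpotentAlgebra_rev, h0, neg_zero]

theorem SamePair.pairingForm_eq_zero {ξ : D → K} {u : nilpotentAlgebra X n K}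
    {x y x' y' : Fin (X.size n)} (h : SamePair x y x' y') (h0 : pairingForm D ξ x' y' u = 0) :
    pairingForm D ξ x y u = 0 := by
  rcases h with ⟨rfl, rfl⟩ | ⟨rfl, rfl⟩
  · exact h0
  · rw [pairingForm_rev, h0, neg_zero]

/-- If the coordinates of `u ∈ 𝔲` at the distinguished roots vanish, and the distinguished root
vectors are orthogonal to `u`, then `u` lies in the radical. -/
theorem mem_radical_of_decompositions (h2 : (2 : K) ≠ 0) (hD : IsOrthogonalRookPlacement D)
    (ξ : D → K) {u : nilpotentAlgebra X n K}
    (hu : ∀ s ∈ decompositions D, u.1 s.1.rowIndex s.2 = 0)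
    (hu' : ∀ s ∈ decompositions D, pairingForm D ξ s.2 s.1.rowIndex u = 0) :
    u ∈ radical D ξ := by
  have self_zero : ∀ a, u.1 a a.rev = 0 := by
    intro a
    have := nilpotentAlgebra_rev u a a.rev
    rw [Fin.rev_rev] at this
    have h3 : 2 * u.1 a a.rev = 0 := by linear_combination this
    exact (mul_eq_zero.mp h3).resolve_left h2
  rw [mem_radical_iff]
  intro x y hxy
  by_cases hxy' : y = x.rev
  · have h3 := pairingForm_rev ξ x y u
    rw [hxy', Fin.rev_rev] at h3
    have h4 : 2 * pairingForm D ξ x x.rev u = 0 := by linear_combination h3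
    rw [hxy']
    exact (mul_eq_zero.mp h4).resolve_left h2
  by_cases hsame : ∃ s ∈ decompositions D, SamePair x y s.2 s.1.rowIndex
  · obtain ⟨s, hs, h⟩ := hsame
    exact h.pairingForm_eq_zero (hu' s hs)
  push Not at hsame
  -- the terms of `pairingForm D ξ x y u` are entries of `u` at the other member of a decomposition
  -- of a root of `D` involving the pair `(x, y)`; by the vertex cover property they vanish
  have first : ∀ x y, (∀ s ∈ decompositions D, ¬ SamePair x y s.2 s.1.rowIndex) → x < y →
      ∀ β ∈ D, β.colIndex = x → u.1 β.rowIndex y = 0 := by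
    rintro x y hsame hxy β hβ rfl
    rcases le_or_gt β.rowIndex y with h | h
    · exact nilpotentAlgebra_of_le u h
    by_cases h' : y = β.rowIndex.rev
    · rw [h']; exact self_zero _
    rcases exists_samePair hD hβ hxy h h' with h3 | ⟨s, hs, h3 | h3⟩
    · exact hu _ h3
    · exact absurd h3 (hsame s hs)
    · exact h3.apply_eq_zero (hu s hs)
  have second : ∀ x y, (∀ s ∈ decompositions D, ¬ SamePair x y s.2 s.1.rowIndex) → x < y →
      y ≠ x.rev → ∀ β ∈ D, β.rowIndex = y → u.1 x β.colIndex = 0 := by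
    rintro x y hsame hxy hne β hβ rfl
    rcases le_or_gt x β.colIndex with h | h
    · exact nilpotentAlgebra_of_le u h
    rcases exists_samePair hD hβ h hxy (fun e => hne (by rw [e, Fin.rev_rev])) with
      h3 | ⟨s, hs, h3 | h3⟩
    · exact absurd (Or.inl ⟨rfl, rfl⟩) (hsame _ h3)
    · exact h3.apply_eq_zero (hu s hs)
    · exact absurd h3 (hsame s hs)
  have hsame' : ∀ s ∈ decompositions D, ¬ SamePair y.rev x.rev s.2 s.1.rowIndex := by
    intro s hs h
    have := h.rev
    rw [Fin.rev_rev, Fin.rev_rev] at this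
    exact hsame s hs this
  have hlt' : y.rev < x.rev := Fin.rev_lt_rev.mpr hxy
  have hne' : x.rev ≠ y.rev.rev := by rw [Fin.rev_rev]; exact Ne.symm hxy'
  rw [pairingForm_eq]
  refine Finset.sum_eq_zero fun β _ => ?_
  have t1 : (if β.1.colIndex = x then u.1 β.1.rowIndex y else 0) = 0 := by
    split_ifs with h
    · exact first x y hsame hxy β β.2 h
    · rfl
  have t2 : (if β.1.rowIndex.rev = x then u.1 y.rev β.1.colIndex else 0) = 0 := by
    split_ifs with h
    · exact second _ _ hsame' hlt' hne' β β.2 (by rw [← h, Fin.rev_rev])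
    · rfl
  have t3 : (if β.1.rowIndex = y then u.1 x β.1.colIndex else 0) = 0 := by
    split_ifs with h
    · exact second x y hsame hxy hxy' β β.2 h
    · rfl
  have t4 : (if β.1.colIndex.rev = y then u.1 β.1.rowIndex x.rev else 0) = 0 := by
    split_ifs with h
    · exact first _ _ hsame' hlt' β β.2 (by rw [← h, Fin.rev_rev])
    · rfl
  rw [t1, t2, t3, t4]
  ring

/-- The values `f_{D,ξ}([u, e])` at the root vectors `e` of the two members of every decomposition,
up to sign. -/
noncomputable def decompositionMap (D : Finset (PosRoot X n)) (ξ : D → K) :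
    nilpotentAlgebra X n K →ₗ[K] (decompositions D → K) × (decompositions D → K) :=
  (LinearMap.pi fun s => pairingForm D ξ s.1.1.colIndex s.1.2).prod
    (LinearMap.pi fun s => pairingForm D ξ s.1.2 s.1.1.rowIndex)

theorem decompositionMap_fst (ξ : D → K) (u : nilpotentAlgebra X n K) (s : decompositions D) :
    (decompositionMap D ξ u).1 s = pairingForm D ξ s.1.1.colIndex s.1.2 u := rfl

theorem decompositionMap_snd (ξ : D → K) (u : nilpotentAlgebra X n K) (s : decompositions D) :
    (decompositionMap D ξ u).2 s = pairingForm D ξ s.1.2 s.1.1.rowIndex u := rfl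

theorem ker_decompositionMap (h2 : (2 : K) ≠ 0) (hD : IsOrthogonalRookPlacement D) {ξ : D → K}
    (hξ : ∀ β, ξ β ≠ 0) : LinearMap.ker (decompositionMap D ξ) = radical D ξ := by
  ext u
  rw [LinearMap.mem_ker]
  constructor
  · intro h
    refine mem_radical_of_decompositions h2 hD ξ (fun s hs => ?_) fun s hs => ?_
    · have h1 : (decompositionMap D ξ u).1 ⟨s, hs⟩ = 0 := by rw [h]; rfl
      rw [decompositionMap_fst, pairingForm_of_mem ξ hD hs] at h1
      exact (mul_eq_zero.mp h1).resolve_left (hξ _)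
    · have h1 : (decompositionMap D ξ u).2 ⟨s, hs⟩ = 0 := by rw [h]; rfl
      exact h1
  · intro h
    rw [mem_radical_iff] at h
    ext s
    · exact h _ _ (mem_decompositions.mp s.2).2.1
    · exact h _ _ (mem_decompositions.mp s.2).2.2.1

theorem decompositions_not_samePair (hD : IsOrthogonalRookPlacement D)
    {s t : PosRoot X n × Fin (X.size n)} (hs : s ∈ decompositions D) (ht : t ∈ decompositions D) :
    ¬ SamePair s.2 s.1.rowIndex t.1.colIndex t.2 := by
  obtain ⟨β, z⟩ := s
  obtain ⟨γ, w⟩ := t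
  obtain ⟨hβ, h1, h2, h3, h4⟩ := mem_decompositions.mp hs
  obtain ⟨hγ, k1, k2, k3, k4⟩ := mem_decompositions.mp ht
  simp only at *
  rintro (⟨rfl, rfl⟩ | ⟨rfl, e⟩)
  · exact absurd h1 (not_lt.mpr (k4 β hβ β.meets_rowIndex))
  · have := hD.eq_of_meets hβ hγ β.meets_rowIndex (e ▸ γ.meets_colIndex.rev)
    subst this
    exact absurd e β.rowIndex_lt_rev_colIndex.ne

theorem decompositions_samePair (hD : IsOrthogonalRookPlacement D)
    {s t : PosRoot X n × Fin (X.size n)} (hs : s ∈ decompositions D) (ht : t ∈ decompositions D)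
    (h : SamePair s.2 s.1.rowIndex t.2 t.1.rowIndex) : s = t ∧ s.2 ≠ t.1.rowIndex.rev := by
  obtain ⟨β, z⟩ := s
  obtain ⟨γ, w⟩ := t
  obtain ⟨hβ, h1, h2, h3, h4⟩ := mem_decompositions.mp hs
  obtain ⟨hγ, k1, k2, k3, k4⟩ := mem_decompositions.mp ht
  simp only at *
  rcases h with ⟨rfl, e⟩ | ⟨rfl, e⟩
  · have := hD.eq_of_meets hβ hγ β.meets_rowIndex (e ▸ γ.meets_rowIndex)
    subst this
    exact ⟨rfl, h3⟩
  · have h5 := h4 γ hγ γ.meets_rowIndex.rev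
    have h6 := k4 β hβ (meets_rev_iff.mp (e ▸ β.meets_rowIndex))
    have := hD.eq_of_meets hβ hγ β.meets_colIndex (le_antisymm h5 h6 ▸ γ.meets_colIndex)
    subst this
    exact absurd rfl h3

/-- The matrix of the form at the distinguished root vectors is block triangular: the vectors at
`(col β, z)` are isotropic, and they are dual, up to the scalars `ξ_β`, to those at `(z, row β)`. -/
theorem decompositionMap_surjective (h2 : (2 : K) ≠ 0) (hD : IsOrthogonalRookPlacement D)
    {ξ : D → K} (hξ : ∀ β, ξ β ≠ 0) : Function.Surjective (decompositionMap D ξ) := by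
  classical
  have hc : ∀ s : decompositions D, s.1.1.colIndex < s.1.2 := fun s =>
    (mem_decompositions.mp s.2).2.1
  have hr : ∀ s : decompositions D, s.1.2 < s.1.1.rowIndex := fun s =>
    (mem_decompositions.mp s.2).2.2.1
  let b : decompositions D → D := fun s => ⟨s.1.1, (mem_decompositions.mp s.2).1⟩
  have row_row : ∀ s t : decompositions D,
      pairingForm D ξ s.1.1.colIndex s.1.2 (skewUnit K (hr t)) = if s = t then ξ (b s) else 0 := by
    intro s t
    rw [pairingForm_of_mem ξ hD s.2, skewUnit_apply]
    by_cases h : s = t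
    · subst h
      have := (decompositions_samePair hD s.2 s.2 (Or.inl ⟨rfl, rfl⟩)).2
      rw [if_pos ⟨rfl, rfl⟩, if_neg, if_pos rfl, sub_zero, mul_one]
      rintro ⟨-, e⟩
      exact this e.symm
    · rw [if_neg, if_neg, if_neg h, sub_zero, mul_zero]
      · rintro ⟨e1, e2⟩
        exact h (Subtype.ext (decompositions_samePair hD s.2 t.2 (Or.inr ⟨e2.symm, e1.symm⟩)).1)
      · rintro ⟨e1, e2⟩
        exact h (Subtype.ext (decompositions_samePair hD s.2 t.2 (Or.inl ⟨e2.symm, e1.symm⟩)).1)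
  have col_col : ∀ s t : decompositions D,
      pairingForm D ξ s.1.1.colIndex s.1.2 (skewUnit K (hc t)) = 0 := by
    intro s t
    have h := decompositions_not_samePair hD s.2 t.2
    rw [pairingForm_of_mem ξ hD s.2, skewUnit_apply, if_neg, if_neg, sub_zero, mul_zero]
    · rintro ⟨e1, e2⟩
      exact h (Or.inr ⟨e2.symm, e1.symm⟩)
    · rintro ⟨e1, e2⟩
      exact h (Or.inl ⟨e2.symm, e1.symm⟩)
  have row_col : ∀ s t : decompositions D,
      pairingForm D ξ s.1.2 s.1.1.rowIndex (skewUnit K (hc t)) = if s = t then -ξ (b s) else 0 := by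
    intro s t
    rw [pairingForm_skewUnit_comm h2 ξ (hr s) (hc t), row_row]
    by_cases h : s = t
    · subst h; simp
    · rw [if_neg h, if_neg (Ne.symm h), neg_zero]
  rintro ⟨p, q⟩
  set v : nilpotentAlgebra X n K := ∑ t, ((ξ (b t))⁻¹ * p t) • skewUnit K (hr t) with hv
  set w : nilpotentAlgebra X n K :=
    ∑ t, ((ξ (b t))⁻¹ * ((decompositionMap D ξ v).2 t - q t)) • skewUnit K (hc t) with hw
  refine ⟨v + w, ?_⟩
  have hv1 : ∀ s, (decompositionMap D ξ v).1 s = p s := by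
    intro s
    rw [decompositionMap_fst, hv, map_sum, Finset.sum_eq_single s]
    · rw [map_smul, row_row, if_pos rfl, smul_eq_mul]
      field_simp [hξ (b s)]
    · intro t _ hts
      rw [map_smul, row_row, if_neg (Ne.symm hts), smul_zero]
    · simp
  have hw1 : ∀ s, (decompositionMap D ξ w).1 s = 0 := by
    intro s
    rw [decompositionMap_fst, hw, map_sum]
    refine Finset.sum_eq_zero fun t _ => ?_
    rw [map_smul, col_col, smul_zero]
  have hw2 : ∀ s, (decompositionMap D ξ w).2 s = q s - (decompositionMap D ξ v).2 s := by
    intro s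
    rw [decompositionMap_snd, hw, map_sum, Finset.sum_eq_single s]
    · rw [map_smul, row_col, if_pos rfl, smul_eq_mul]
      have := hξ (b s)
      field_simp
      ring
    · intro t _ hts
      rw [map_smul, row_col, if_neg (Ne.symm hts), smul_zero]
    · simp
  rw [map_add]
  ext s
  · rw [Prod.fst_add, Pi.add_apply, hv1, hw1, add_zero]
  · rw [Prod.snd_add, Pi.add_apply, hw2]
    ring

/-- The radical has codimension `2 |decompositions D|` in `𝔲`. -/
theorem finrank_radical (h2 : (2 : K) ≠ 0) (hD : IsOrthogonalRookPlacement D) {ξ : D → K}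
    (hξ : ∀ β, ξ β ≠ 0) :
    2 * (decompositions D).card + Module.finrank K (radical D ξ) =
      Module.finrank K (nilpotentAlgebra X n K) := by
  have h := LinearMap.finrank_range_add_finrank_ker (decompositionMap D ξ)
  rw [LinearMap.range_eq_top.mpr (decompositionMap_surjective h2 hD hξ), finrank_top,
    ker_decompositionMap h2 hD hξ, Module.finrank_prod, Module.finrank_fintype_fun_eq_card,
    Fintype.card_coe] at h
  omega

end

/-! ### The number of points of the orbit -/

section

open PosRoot Matrix

section Centralizes

variable {m : ℕ} {K : Type*} [Field K] {F : Matrix (Fin m) (Fin m) K →ₗ[K] K}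
  {g h : Matrix (Fin m) (Fin m) K}

theorem Centralizes.add (hg : Centralizes F g) (hh : Centralizes F h) : Centralizes F (g + h) := by
  intro y hy
  rw [mul_add, add_mul, map_add, map_add, hg y hy, hh y hy]

theorem Centralizes.smul (a : K) (hg : Centralizes F g) : Centralizes F (a • g) := by
  intro y hy
  rw [mul_smul_comm, smul_mul_assoc, map_smul, map_smul, hg y hy]

theorem Centralizes.one : Centralizes F 1 := by
  intro y _
  rw [mul_one, one_mul]

theorem Centralizes.sub (hg : Centralizes F g) (hh : Centralizes F h) : Centralizes F (g - h) := by
  rw [sub_eq_add_neg, ← neg_one_smul K h]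
  exact hg.add (hh.smul _)

theorem Centralizes.mul (hg : Centralizes F g) (hh : Centralizes F h)
    (hgl : g ∈ lowerFiltration m K 0) (hhl : h ∈ lowerFiltration m K 0) :
    Centralizes F (g * h) := by
  intro y hy
  rw [← mul_assoc, hh _ (mul_mem_lowerFiltration hy hgl), ← mul_assoc,
    hg _ (by simpa using mul_mem_lowerFiltration hhl hy), mul_assoc]

theorem Centralizes.of_mul_eq_one (hg : Centralizes F g) (hgh : g * h = 1)
    (hhl : h ∈ lowerFiltration m K 0) : Centralizes F h := by
  intro y hy
  have hhg : h * g = 1 := mul_eq_one_comm.mp hgh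
  have := hg (h * y * h)
    (mul_mem_lowerFiltration (by simpa using mul_mem_lowerFiltration hhl hy) hhl)
  rw [mul_assoc, hhg, mul_one, ← mul_assoc, ← mul_assoc, hgh, one_mul] at this
  exact this.symm

end Centralizes

namespace Matrix

variable {m : ℕ} {K : Type*} [Field K]

theorem cayley_mul_one_sub {x : Matrix (Fin m) (Fin m) K} (hx : x ∈ lowerFiltration m K 1) :
    cayley x * (1 - x) = 1 + x := by
  rw [cayley, mul_assoc, geomSeries_mul_one_sub hx, mul_one]

/-- The inverse of `g + 1`, for a lower unitriangular matrix `g`. -/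
noncomputable def addOneInv (g : Matrix (Fin m) (Fin m) K) : Matrix (Fin m) (Fin m) K :=
  (2 : K)⁻¹ • geomSeries (-((2 : K)⁻¹ • (g - 1)))

variable {g : Matrix (Fin m) (Fin m) K}

theorem addOneInv_mem (hg : g - 1 ∈ lowerFiltration m K 1) :
    addOneInv g ∈ lowerFiltration m K 0 :=
  Submodule.smul_mem _ _ (geomSeries_mem (Submodule.neg_mem _ (Submodule.smul_mem _ _ hg)))

theorem add_one_mul_addOneInv (h2 : (2 : K) ≠ 0) (hg : g - 1 ∈ lowerFiltration m K 1) :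
    (g + 1) * addOneInv g = 1 := by
  have h := one_sub_mul_geomSeries (Submodule.neg_mem _ (Submodule.smul_mem _ (2 : K)⁻¹ hg))
  have e : g + 1 = (2 : K) • (1 - -((2 : K)⁻¹ • (g - 1))) := by
    rw [sub_neg_eq_add, smul_add, smul_smul, mul_inv_cancel₀ h2, two_smul, one_smul]
    abel
  conv_lhs => rw [e]
  rw [addOneInv, smul_mul_smul_comm, mul_inv_cancel₀ h2, one_smul, h]

theorem addOneInv_mul_add_one (h2 : (2 : K) ≠ 0) (hg : g - 1 ∈ lowerFiltration m K 1) :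
    addOneInv g * (g + 1) = 1 :=
  mul_eq_one_comm.mp (add_one_mul_addOneInv h2 hg)

theorem cayley_injOn (h2 : (2 : K) ≠ 0) {x y : Matrix (Fin m) (Fin m) K}
    (hx : x ∈ lowerFiltration m K 1) (hy : y ∈ lowerFiltration m K 1) (h : cayley x = cayley y) :
    x = y := by
  have key : ∀ z ∈ lowerFiltration m K 1, (cayley z + 1) * z = cayley z - 1 := by
    intro z hz
    have := cayley_mul_one_sub hz
    rw [mul_sub, mul_one] at this
    rw [add_mul, one_mul]
    rw [sub_eq_iff_eq_add] at this
    rw [eq_sub_iff_add_eq]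
    exact Eq.trans (by abel) this.symm
  have hg := cayley_sub_one_mem hx
  have e := key x hx
  rw [h, ← key y hy] at e
  rw [h] at hg
  calc x = addOneInv (cayley y) * ((cayley y + 1) * x) := by
        rw [← mul_assoc, addOneInv_mul_add_one h2 hg, one_mul]
    _ = y := by rw [e, ← mul_assoc, addOneInv_mul_add_one h2 hg, one_mul]

end Matrix

variable {X : OrthType} {n : ℕ} {K : Type*} [Field K]

theorem unipotentGroup_inv_val {g : Matrix.GeneralLinearGroup (Fin (X.size n)) K}
    (hg : g ∈ unipotentGroup X n K) : (g⁻¹).val = g.val.antitranspose := by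
  have h := (mem_unipotentGroup.mp hg).2
  calc (g⁻¹).val = g.val.antitranspose * g.val * (g⁻¹).val := by rw [h, one_mul]
    _ = _ := by rw [mul_assoc, Units.mul_inv, mul_one]

theorem unipotentGroup_val_mem {g : Matrix.GeneralLinearGroup (Fin (X.size n)) K}
    (hg : g ∈ unipotentGroup X n K) : g.val ∈ lowerFiltration (X.size n) K 0 := by
  have := Submodule.add_mem _ (lowerFiltration_anti (Nat.zero_le 1) (mem_unipotentGroup.mp hg).1)
    one_mem_lowerFiltration
  rwa [sub_add_cancel] at this

theorem unipotentGroup_mul_antitranspose {g : Matrix.GeneralLinearGroup (Fin (X.size n)) K}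
    (hg : g ∈ unipotentGroup X n K) : g.val * g.val.antitranspose = 1 := by
  rw [← unipotentGroup_inv_val hg, Units.mul_inv]

/-- The Cayley transform of an element `u ∈ 𝔲`, as an element of `U`; its inverse is the Cayley
transform of `-u`. -/
def cayleyUnit (u : nilpotentAlgebra X n K) : unipotentGroup X n K :=
  ⟨⟨cayley u.1, cayley (-u.1), by
      have := cayley_neg_mul_cayley (Submodule.neg_mem _ (mem_nilpotentAlgebra.mp u.2).1)
      rwa [neg_neg] at this,
    cayley_neg_mul_cayley (mem_nilpotentAlgebra.mp u.2).1⟩, by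
    rw [mem_unipotentGroup]
    refine ⟨cayley_sub_one_mem (mem_nilpotentAlgebra.mp u.2).1, ?_⟩
    change (cayley u.1).antitranspose * cayley u.1 = 1
    rw [antitranspose_cayley, (mem_nilpotentAlgebra.mp u.2).2,
      cayley_neg_mul_cayley (mem_nilpotentAlgebra.mp u.2).1]⟩

theorem centralizes_cayley {F : Matrix (Fin (X.size n)) (Fin (X.size n)) K →ₗ[K] K}
    {u : nilpotentAlgebra X n K} (hu : Centralizes F u.1) : Centralizes F (cayley u.1) := by
  have hl := (mem_nilpotentAlgebra.mp u.2).1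
  have hs : Centralizes F (geomSeries u.1) :=
    (Centralizes.one.sub hu).of_mul_eq_one (one_sub_mul_geomSeries hl) (geomSeries_mem hl)
  exact (Centralizes.one.add hu).mul hs
    (Submodule.add_mem _ one_mem_lowerFiltration (lowerFiltration_anti (Nat.zero_le 1) hl))
    (geomSeries_mem hl)

/-- The Cayley transform is surjective, and elements with a centralizing property come from
elements with the same property: the inverse transform `(g - 1)(g + 1)⁻¹` preserves it. -/
theorem exists_cayleyUnit_eq (h2 : (2 : K) ≠ 0)
    (F : Matrix (Fin (X.size n)) (Fin (X.size n)) K →ₗ[K] K) (g : unipotentGroup X n K)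
    (hg : Centralizes F g.1.val) :
    ∃ u : nilpotentAlgebra X n K, Centralizes F u.1 ∧ cayleyUnit u = g := by
  have hl := (mem_unipotentGroup.mp g.2).1
  have hT := unipotentGroup_mul_antitranspose g.2
  have hT' := (mem_unipotentGroup.mp g.2).2
  set G := g.1.val with hG
  have i1 := add_one_mul_addOneInv h2 hl
  have i2 := addOneInv_mul_add_one h2 hl
  have il := addOneInv_mem hl
  set h := addOneInv G
  have hcomm : (G + 1) * (G - 1) = (G - 1) * (G + 1) := by noncomm_ring
  have e1 : (G + 1) * (h * (G - 1)) = G - 1 := by rw [← mul_assoc, i1, one_mul]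
  have e2 : h * (G - 1) * (G + 1) = G - 1 := by
    rw [mul_assoc, ← hcomm, ← mul_assoc, i2, one_mul]
  have hxl : h * (G - 1) ∈ lowerFiltration (X.size n) K 1 := by
    simpa using mul_mem_lowerFiltration il hl
  set x := h * (G - 1) with hx
  have e3 : x.antitranspose * (G.antitranspose + 1) = G.antitranspose - 1 := by
    have := congrArg antitranspose e1
    rwa [antitranspose_mul, antitranspose_add, antitranspose_sub, antitranspose_one] at this
  have e4 : x.antitranspose * (G + 1) = 1 - G := by
    have := congrArg (· * G) e3
    simp only [mul_assoc, add_mul, sub_mul, one_mul, hT'] at this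
    rw [add_comm G 1, this]
  have e5 : x.antitranspose = -x := by
    rw [← add_eq_zero_iff_eq_neg]
    have h0 : (x.antitranspose + x) * (G + 1) = 0 := by rw [add_mul, e4, e2]; abel
    calc x.antitranspose + x = (x.antitranspose + x) * (G + 1) * h := by
          rw [mul_assoc, i1, mul_one]
      _ = 0 := by rw [h0, zero_mul]
  refine ⟨⟨x, mem_nilpotentAlgebra.mpr ⟨hxl, e5⟩⟩, ?_, ?_⟩
  · have hh : Centralizes F h := (hg.add Centralizes.one).of_mul_eq_one i1 il
    exact hh.mul (hg.sub Centralizes.one) il (lowerFiltration_anti (Nat.zero_le 1) hl)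
  · refine Subtype.ext (Units.ext ?_)
    change cayley x = G
    have e6 : 1 + x = G * (1 - x) := by
      rw [add_mul, one_mul] at e1
      rw [mul_sub, mul_one]
      rw [eq_sub_iff_add_eq] at e1 ⊢
      exact Eq.trans (by abel) e1
    rw [cayley, e6, mul_assoc, one_sub_mul_geomSeries hxl, mul_one]

/-- The Cayley transform is a bijection between the elements of `𝔲` and of `U` with the property.
For the zero form this compares `𝔲` and `U` themselves. -/
theorem card_centralizes (h2 : (2 : K) ≠ 0)
    (F : Matrix (Fin (X.size n)) (Fin (X.size n)) K →ₗ[K] K) :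
    Nat.card {u : nilpotentAlgebra X n K // Centralizes F u.1} =
      Nat.card {g : unipotentGroup X n K // Centralizes F g.1.val} := by
  refine Nat.card_congr (Equiv.ofBijective (fun u => ⟨cayleyUnit u.1, centralizes_cayley u.2⟩)
    ⟨fun u v huv => ?_, fun g => ?_⟩)
  · have h : cayley u.1.1 = cayley v.1.1 :=
      congrArg (fun g : {g : unipotentGroup X n K // Centralizes F g.1.val} => g.1.1.val) huv
    exact Subtype.ext (Subtype.ext (cayley_injOn h2 (mem_nilpotentAlgebra.mp u.1.2).1
      (mem_nilpotentAlgebra.mp v.1.2).1 h))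
  · obtain ⟨u, hu, h⟩ := exists_cayleyUnit_eq h2 F g.1 g.2
    exact ⟨⟨u, hu⟩, Subtype.ext h⟩

variable {D : Finset (PosRoot X n)}

theorem coadjointRep_canonicalForm_apply (ξ : D → K) (g : unipotentGroup X n K)
    (u : nilpotentAlgebra X n K) :
    coadjointRep X n K g (canonicalForm D ξ) u =
      2⁻¹ * skewForm D ξ (g.1.val.antitranspose * u.1 * g.1.val) := by
  have h : coadjointRep X n K g (canonicalForm D ξ) u =
    canonicalForm D ξ (adjointRep X n K g⁻¹ u) := rfl
  rw [h, canonicalForm_apply]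
  congr 2
  change (g⁻¹).1.val * u.1 * ((g⁻¹).1⁻¹).val = _
  rw [show ((g⁻¹).1⁻¹) = g.1 by simp, ← unipotentGroup_inv_val g.2]
  rfl

theorem skewForm_of_symmetric (h2 : (2 : K) ≠ 0) (ξ : D → K)
    {x : Matrix (Fin (X.size n)) (Fin (X.size n)) K} (hx : x.antitranspose = x) :
    skewForm D ξ x = 0 := by
  have h := skewForm_antitranspose ξ x
  rw [hx] at h
  have h3 : 2 * skewForm D ξ x = 0 := by linear_combination h
  exact (mul_eq_zero.mp h3).resolve_left h2

/-- The stabilizer of `f_{D,ξ}` is described by a condition which is linear in the matrix. -/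
theorem coadjointRep_canonicalForm_eq_iff (h2 : (2 : K) ≠ 0) (ξ : D → K)
    (g : unipotentGroup X n K) :
    coadjointRep X n K g (canonicalForm D ξ) = canonicalForm D ξ ↔
      Centralizes (skewForm D ξ) g.1.val := by
  have hl := unipotentGroup_val_mem g.2
  have hT := unipotentGroup_mul_antitranspose g.2
  have hT' := (mem_unipotentGroup.mp g.2).2
  have h2' : (2 : K)⁻¹ ≠ 0 := inv_ne_zero h2
  constructor
  · intro h y hy
    have hskew : ∀ z ∈ lowerFiltration (X.size n) K 1, z.antitranspose = -z →
        skewForm D ξ (g.1.val.antitranspose * z * g.1.val) = skewForm D ξ z := by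
      intro z hz hz'
      have := congrArg (fun f => f ⟨z, mem_nilpotentAlgebra.mpr ⟨hz, hz'⟩⟩) h
      simp only [coadjointRep_canonicalForm_apply, canonicalForm_apply] at this
      exact mul_left_cancel₀ h2' this
    -- both sides vanish at matrices that are symmetric with respect to the antidiagonal
    have hsymm : ∀ z : Matrix (Fin (X.size n)) (Fin (X.size n)) K, z.antitranspose = z →
        skewForm D ξ (g.1.val.antitranspose * z * g.1.val) = skewForm D ξ z := by
      intro z hz
      rw [skewForm_of_symmetric h2 ξ hz, skewForm_of_symmetric h2 ξ]
      rw [antitranspose_mul, antitranspose_mul, antitranspose_antitranspose, hz, mul_assoc]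
    have hz : g.1.val * y ∈ lowerFiltration (X.size n) K 1 := by
      simpa using mul_mem_lowerFiltration hl hy
    set z := g.1.val * y with hzdef
    have hy' : g.1.val.antitranspose * z = y := by rw [hzdef, ← mul_assoc, hT', one_mul]
    have h3 := hskew (z - z.antitranspose)
      (Submodule.sub_mem _ hz (antitranspose_mem_lowerFiltration hz))
      (by rw [antitranspose_sub, antitranspose_antitranspose, neg_sub])
    have h4 := hsymm (z + z.antitranspose)
      (by rw [antitranspose_add, antitranspose_antitranspose, add_comm])
    rw [mul_sub, sub_mul, map_sub, map_sub] at h3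
    rw [mul_add, add_mul, map_add, map_add] at h4
    rw [hy'] at h3 h4
    exact mul_left_cancel₀ h2 (by linear_combination h3 + h4)
  · intro h
    ext u
    rw [coadjointRep_canonicalForm_apply, canonicalForm_apply]
    rw [h (g.1.val.antitranspose * u.1) (by
      simpa using mul_mem_lowerFiltration (antitranspose_mem_lowerFiltration hl)
        (mem_nilpotentAlgebra.mp u.2).1), ← mul_assoc, hT, one_mul]

/-- Over a finite field, `|U| = |𝔲|` and the stabilizer has as many elements as the radical, so that
the number of points of the orbit is a power of `q` with the codimension of the radical as
exponent. -/
theorem ncard_associatedOrbit [Fintype K] (h2 : (2 : K) ≠ 0) (hD : IsOrthogonalRookPlacement D)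
    {ξ : D → K} (hξ : ∀ β, ξ β ≠ 0) :
    (associatedOrbit D ξ).ncard = Fintype.card K ^ (2 * (decompositions D).card) := by
  let _ : MulAction (unipotentGroup X n K) (Module.Dual K (nilpotentAlgebra X n K)) :=
    MulAction.compHom _ (coadjointRep X n K)
  have horb : associatedOrbit D ξ =
    MulAction.orbit (unipotentGroup X n K) (canonicalForm D ξ) := rfl
  have hstab : Nat.card (MulAction.stabilizer (unipotentGroup X n K) (canonicalForm D ξ)) =
      Nat.card (radical D ξ) :=
    (Nat.card_congr (Equiv.subtypeEquivRight fun g =>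
      coadjointRep_canonicalForm_eq_iff h2 ξ g)).trans
        (card_centralizes h2 (skewForm D ξ)).symm
  have htriv : ∀ z : Matrix (Fin (X.size n)) (Fin (X.size n)) K, Centralizes 0 z :=
    fun _ _ _ => rfl
  have hU : Nat.card (unipotentGroup X n K) = Nat.card (nilpotentAlgebra X n K) :=
    (Nat.card_congr (Equiv.subtypeUnivEquiv fun _ => htriv _)).symm.trans
      ((card_centralizes h2 0).symm.trans
        (Nat.card_congr (Equiv.subtypeUnivEquiv fun _ => htriv _)))
  have h := Subgroup.card_eq_card_quotient_mul_card_subgroup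
    (MulAction.stabilizer (unipotentGroup X n K) (canonicalForm D ξ))
  rw [← Nat.card_congr (MulAction.orbitEquivQuotientStabilizer _ _), hstab, hU,
    Module.natCard_eq_pow_finrank (K := K),
    Module.natCard_eq_pow_finrank (K := K) (V := radical D ξ),
    ← finrank_radical h2 hD hξ, pow_add, Nat.card_eq_fintype_card] at h
  rw [horb, ← Nat.card_coe_set_eq]
  exact (Nat.eq_of_mul_eq_mul_right (pow_pos Fintype.card_pos _) h).symm

end

/-! ### Dimensions of images of polynomial maps -/

section

open MvPolynomial in
theorem MvPolynomial.IsHomogeneous.aeval_mul {σ R A : Type*} [CommRing R] [CommRing A] [Algebra R A]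
    {p : MvPolynomial σ R} {d : ℕ} (hp : p.IsHomogeneous d) (s : A) (y : σ → A) :
    MvPolynomial.aeval (fun i => s * y i) p = s ^ d * MvPolynomial.aeval y p := by
  rw [aeval_def, aeval_def, eval₂_eq, eval₂_eq, Finset.mul_sum]
  refine Finset.sum_congr rfl fun e he => ?_
  simp only [mul_pow]
  rw [Finset.prod_mul_distrib, Finset.prod_pow_eq_pow_sum, hp.degree_eq_sum_deg_support he,
    mul_left_comm]

section VarietyDim

open MvPolynomial

theorem MvPolynomial.map_aeval_eq_eval {σ R A : Type*} [CommRing R] [CommRing A] [Algebra R A]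
    (f : A →+* R) (hf : ∀ a, f (algebraMap R A a) = a) (y : σ → A) (p : MvPolynomial σ R) :
    f (aeval y p) = eval (fun i => f (y i)) p := by
  rw [map_aeval, show f.comp (algebraMap R A) = RingHom.id R from RingHom.ext hf]
  rfl

variable {K : Type*} [Field K] [Infinite K] {ι κ σ : Type}

/-- The image of an affine space under a polynomial map has at most the dimension of that space. -/
theorem varietyDim_range_le [Fintype ι] (φ : κ → MvPolynomial ι K) :
    varietyDim (Set.range fun (t : ι → K) (a : κ) => eval t (φ a)) ≤
      (Fintype.card ι : Cardinal) := by
  have hker : vanishingIdeal K (Set.range fun (t : ι → K) (a : κ) => eval t (φ a)) =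
      RingHom.ker (aeval φ : MvPolynomial κ K →ₐ[K] MvPolynomial ι K) := by
    ext p
    have h : ∀ t : ι → K, aeval (fun a => eval t (φ a)) p = eval t (aeval φ p) := fun t =>
      (map_aeval_eq_eval (eval t) (fun a => eval_C a) φ p).symm
    rw [mem_vanishingIdeal_iff, RingHom.mem_ker]
    constructor
    · intro hp
      refine MvPolynomial.funext fun t => ?_
      rw [map_zero, ← hp _ ⟨t, rfl⟩]
      exact (h t).symm
    · rintro hp _ ⟨t, rfl⟩
      rw [h, hp, map_zero]
  rw [varietyDim, hker]
  refine (trdeg_le_of_injective _ (Ideal.kerLiftAlg_injective _ : Function.Injective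
    (Ideal.kerLiftAlg (aeval φ : MvPolynomial κ K →ₐ[K] MvPolynomial ι K)))).trans ?_
  rw [MvPolynomial.trdeg_of_isDomain, Cardinal.mk_fintype, Cardinal.lift_natCast]

/-- A polynomial vanishing on germs of curves through the origin in all directions is zero:
its lowest homogeneous component vanishes at the tangent vectors. -/
theorem MvPolynomial.eq_zero_of_forall_curve (q : MvPolynomial σ K)
    (h : ∀ b : σ → K, ∃ y : σ → Polynomial K, (∀ j, (y j).coeff 0 = b j) ∧
      aeval (fun j => Polynomial.X * y j) q = 0) : q = 0 := by
  by_contra hq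
  have hex : ∃ d, homogeneousComponent d q ≠ 0 := by
    by_contra hno
    push Not at hno
    rw [← sum_homogeneousComponent q] at hq
    exact hq (Finset.sum_eq_zero fun d _ => hno d)
  classical
  set d := Nat.find hex
  have hd : homogeneousComponent d q ≠ 0 := Nat.find_spec hex
  have hmin : ∀ e < d, homogeneousComponent e q = 0 := fun e he => not_not.mp (Nat.find_min hex he)
  refine hd (MvPolynomial.funext fun b => ?_)
  obtain ⟨y, hy, h0⟩ := h b
  have hsum : ∑ e ∈ Finset.range (q.totalDegree + 1),
      (Polynomial.X : Polynomial K) ^ e * aeval y (homogeneousComponent e q) = 0 := by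
    rw [← h0]
    conv_rhs => rw [← sum_homogeneousComponent q]
    rw [map_sum]
    exact Finset.sum_congr rfl fun e _ =>
      ((homogeneousComponent_isHomogeneous e q).aeval_mul _ _).symm
  have hdm : d ∈ Finset.range (q.totalDegree + 1) := by
    rw [Finset.mem_range]
    by_contra hlt
    exact hd (homogeneousComponent_eq_zero _ _ (by omega))
  rw [← Finset.add_sum_erase _ _ hdm] at hsum
  have hdvd : (Polynomial.X : Polynomial K) ^ d * Polynomial.X ∣
      Polynomial.X ^ d * aeval y (homogeneousComponent d q) := by
    rw [eq_neg_of_add_eq_zero_left hsum, dvd_neg]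
    refine Finset.dvd_sum fun e he => ?_
    rcases lt_or_gt_of_ne (Finset.ne_of_mem_erase he) with hlt | hlt
    · rw [hmin e hlt, map_zero, mul_zero]
      exact dvd_zero _
    · rw [← pow_succ]
      exact (pow_dvd_pow _ hlt).mul_right _
  rw [mul_dvd_mul_iff_left (pow_ne_zero _ Polynomial.X_ne_zero), Polynomial.X_dvd_iff] at hdvd
  have hc := map_aeval_eq_eval Polynomial.constantCoeff (fun a => Polynomial.coeff_C_zero) y
    (homogeneousComponent d q)
  rw [Polynomial.constantCoeff_apply, hdvd] at hc
  have hb : (fun j => Polynomial.constantCoeff (y j)) = b := _root_.funext hy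
  rw [map_zero, hc, hb]

/-- If the tangent vectors at one point of the polynomial curves in `V` project onto a coordinate
subspace, then these coordinates are algebraically independent on `V`. -/
theorem card_le_varietyDim [Fintype σ] (V : Set (κ → K)) (S : σ → κ) (c : σ → K)
    (h : ∀ b : σ → K, ∃ γ : κ → Polynomial K, (∀ s : K, (fun a => (γ a).eval s) ∈ V) ∧
      ∀ j, (γ (S j)).coeff 0 = c j ∧ (γ (S j)).coeff 1 = b j) :
    (Fintype.card σ : Cardinal) ≤ varietyDim V := by
  have key : AlgebraicIndependent K
      fun j => Ideal.Quotient.mkₐ K (vanishingIdeal K V) (X (S j)) := by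
    rw [algebraicIndependent_iff]
    intro p hp
    have hmem : rename S p ∈ vanishingIdeal K V := by
      rw [← Ideal.Quotient.eq_zero_iff_mem, ← hp, ← Ideal.Quotient.mkₐ_eq_mk K]
      conv_lhs => rw [← aeval_X_left_apply (rename S p), aeval_rename]
      rw [comp_aeval_apply]
      rfl
    have hq : aeval (fun j => X j + C (c j)) p = (0 : MvPolynomial σ K) := by
      refine eq_zero_of_forall_curve _ fun b => ?_
      obtain ⟨γ, hγ, hj⟩ := h b
      refine ⟨fun j => (γ (S j)).divX, fun j => ?_, ?_⟩
      · rw [Polynomial.coeff_divX, zero_add, (hj j).2]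
      · have e : ∀ j, aeval (fun j => Polynomial.X * (γ (S j)).divX) (X j + C (c j)) = γ (S j) := by
          intro j
          rw [map_add, aeval_X, aeval_C, Polynomial.algebraMap_eq, ← (hj j).1,
            Polynomial.X_mul_divX_add]
        rw [← AlgHom.comp_apply, comp_aeval]
        simp only [e]
        refine Polynomial.funext fun s => ?_
        have h1 := hmem _ (hγ s)
        rw [aeval_rename] at h1
        rw [Polynomial.eval_zero, ← h1, ← Polynomial.coe_evalRingHom,
          map_aeval_eq_eval _ fun a => Polynomial.eval_C]
        rfl
    have hinv : aeval (fun j => X j - C (c j)) (aeval (fun j => X j + C (c j)) p) = p := by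
      rw [← AlgHom.comp_apply, comp_aeval]
      simp
    rw [← hinv, hq, map_zero]
  have := key.lift_cardinalMk_le_trdeg
  rw [Cardinal.mk_fintype, Cardinal.lift_natCast] at this
  simpa [varietyDim] using this

end VarietyDim

end

/-! ### Factorization of the elements of `U` -/

section

open PosRoot Matrix

namespace Matrix

variable {m : ℕ} {K : Type*} [Field K]

theorem mul_sub_one_mem {k : ℕ} {a b : Matrix (Fin m) (Fin m) K}
    (ha : a - 1 ∈ lowerFiltration m K k) (hb : b - 1 ∈ lowerFiltration m K k) :
    a * b - 1 - ((a - 1) + (b - 1)) ∈ lowerFiltration m K (k + k) := by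
  have : a * b - 1 - ((a - 1) + (b - 1)) = (a - 1) * (b - 1) := by noncomm_ring
  rw [this]
  exact mul_mem_lowerFiltration ha hb

end Matrix

variable {X : OrthType} {n : ℕ} {K : Type*} [Field K] {D : Finset (PosRoot X n)}

/-- The elements of `𝔲` whose entries vanish up to distance `k - 1` from the diagonal. -/
def nilpotentFiltration (X : OrthType) (n : ℕ) (K : Type*) [Field K] (k : ℕ) :
    Submodule K (nilpotentAlgebra X n K) :=
  (lowerFiltration (X.size n) K k).comap (nilpotentAlgebra X n K).subtype

theorem mem_nilpotentFiltration {k : ℕ} {u : nilpotentAlgebra X n K} :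
    u ∈ nilpotentFiltration X n K k ↔ u.1 ∈ lowerFiltration (X.size n) K k := Iff.rfl

theorem nilpotentFiltration_one : nilpotentFiltration X n K 1 = ⊤ :=
  eq_top_iff.mpr fun u _ => (mem_nilpotentAlgebra.mp u.2).1

theorem nilpotentFiltration_anti {k l : ℕ} (h : k ≤ l) :
    nilpotentFiltration X n K l ≤ nilpotentFiltration X n K k :=
  fun _ hu => lowerFiltration_anti h hu

theorem nilpotentFiltration_eq_bot {k : ℕ} (h : X.size n ≤ k) :
    nilpotentFiltration X n K k = ⊥ :=
  eq_bot_iff.mpr fun _ hu => Subtype.ext (eq_zero_of_mem_lowerFiltration h hu)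

/-- The leading term of an element of `U` belongs to `𝔲`. -/
theorem exists_leading_term (h2 : (2 : K) ≠ 0) {k : ℕ} (hk : 1 ≤ k) {g : unipotentGroup X n K}
    (hg : g.1.val - 1 ∈ lowerFiltration (X.size n) K k) :
    ∃ u ∈ nilpotentFiltration X n K k,
      g.1.val - 1 - u.1 ∈ lowerFiltration (X.size n) K (k + 1) := by
  set G := g.1.val
  have hg' : G.antitranspose - 1 ∈ lowerFiltration (X.size n) K k := by
    have := antitranspose_mem_lowerFiltration hg
    rwa [antitranspose_sub, antitranspose_one] at this
  have hu : (2 : K)⁻¹ • (G - G.antitranspose) ∈ lowerFiltration (X.size n) K k := by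
    refine Submodule.smul_mem _ _ ?_
    rw [← sub_sub_sub_cancel_right _ _ 1]
    exact Submodule.sub_mem _ hg hg'
  refine ⟨⟨(2 : K)⁻¹ • (G - G.antitranspose), mem_nilpotentAlgebra.mpr
    ⟨lowerFiltration_anti hk hu, ?_⟩⟩, hu, ?_⟩
  · rw [antitranspose_smul, antitranspose_sub, antitranspose_antitranspose, ← smul_neg, neg_sub]
  · have h := mul_sub_one_mem hg hg'
    rw [unipotentGroup_mul_antitranspose g.2, sub_self, zero_sub] at h
    have e : G - 1 - (2 : K)⁻¹ • (G - G.antitranspose) =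
        (-(2 : K)⁻¹) • -((G - 1) + (G.antitranspose - 1)) := by
      have : G - 1 = (2 : K)⁻¹ • ((2 : K) • (G - 1)) := by
        rw [smul_smul, inv_mul_cancel₀ h2, one_smul]
      rw [neg_smul_neg]
      nth_rewrite 1 [this]
      rw [← smul_sub, two_smul]
      congr 1
      abel
    change G - 1 - (2 : K)⁻¹ • (G - G.antitranspose) ∈ _
    rw [e]
    exact Submodule.smul_mem _ _ (lowerFiltration_anti (by omega) h)

/-- Adjusting `g` by Cayley transforms on both sides changes its leading term accordingly. -/
theorem adjust_leading_term {k : ℕ} (hk : 1 ≤ k) {g : unipotentGroup X n K}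
    {v w ρ : nilpotentAlgebra X n K}
    (hg : g.1.val - 1 ∈ lowerFiltration (X.size n) K k)
    (hw : w ∈ nilpotentFiltration X n K k) (hρ : ρ ∈ nilpotentFiltration X n K k)
    (hv : v ∈ nilpotentFiltration X n K (k + 1))
    (hu : g.1.val - 1 - ((2 : K) • w + v + (2 : K) • ρ).1 ∈ lowerFiltration (X.size n) K (k + 1)) :
    ((cayleyUnit w)⁻¹ * g * (cayleyUnit ρ)⁻¹).1.val - 1 ∈
      lowerFiltration (X.size n) K (k + 1) := by
  have hle : lowerFiltration (X.size n) K (k + k) ≤ lowerFiltration (X.size n) K (k + 1) :=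
    lowerFiltration_anti (by omega)
  have hcay : ∀ x : nilpotentAlgebra X n K, x ∈ nilpotentFiltration X n K k →
      cayley (-x.1) - 1 ∈ lowerFiltration (X.size n) K k ∧
      cayley (-x.1) - 1 - (2 : K) • -x.1 ∈ lowerFiltration (X.size n) K (k + 1) := fun x hx =>
    ⟨cayley_sub_one_mem (Submodule.neg_mem _ hx), hle (cayley_sub_mem (Submodule.neg_mem _ hx))⟩
  obtain ⟨w1, w2⟩ := hcay w hw
  obtain ⟨r1, r2⟩ := hcay ρ hρ
  change cayley (-w.1) * g.1.val * cayley (-ρ.1) - 1 ∈ _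
  have a1 := mul_sub_one_mem w1 hg
  have a2 : cayley (-w.1) * g.1.val - 1 ∈ lowerFiltration (X.size n) K k := by
    have := Submodule.add_mem _ (lowerFiltration_anti (Nat.le_add_right k k) a1)
      (Submodule.add_mem _ w1 hg)
    rwa [sub_add_cancel] at this
  have a3 := mul_sub_one_mem a2 r1
  have := Submodule.add_mem _ (Submodule.add_mem _ (Submodule.add_mem _ (hle a3) (hle a1))
    (Submodule.add_mem _ w2 r2)) (Submodule.add_mem _ hu (mem_nilpotentFiltration.mp hv))
  convert this using 1
  rw [Submodule.coe_add, Submodule.coe_add, Submodule.coe_smul, Submodule.coe_smul, smul_neg,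
    smul_neg]
  abel

/-- A complement of the radical in `𝔲` can be built one step of the filtration at a time. -/
theorem exists_complement (R : Submodule K (nilpotentAlgebra X n K)) (k : ℕ) :
    ∃ W ≤ nilpotentFiltration X n K k,
      nilpotentFiltration X n K k ≤ W ⊔ (nilpotentFiltration X n K (k + 1) ⊔
        (R ⊓ nilpotentFiltration X n K k)) ∧
      Module.finrank K W + (Module.finrank K (nilpotentFiltration X n K (k + 1)) +
        Module.finrank K ↥(R ⊓ nilpotentFiltration X n K k)) =
      Module.finrank K (nilpotentFiltration X n K k) +
        Module.finrank K ↥(R ⊓ nilpotentFiltration X n K (k + 1)) := by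
  set V := nilpotentFiltration X n K k
  set V' := nilpotentFiltration X n K (k + 1)
  have hV : V' ≤ V := nilpotentFiltration_anti (Nat.le_succ k)
  set S := V' ⊔ (R ⊓ V)
  have hS : S ≤ V := sup_le hV inf_le_right
  obtain ⟨C, hC⟩ := S.exists_isCompl
  have hsup : S ⊔ (C ⊓ V) = V := by
    rw [← sup_inf_assoc_of_le C hS, hC.sup_eq_top, top_inf_eq]
  have hinf : S ⊓ (C ⊓ V) = ⊥ := by
    rw [← inf_assoc, hC.inf_eq_bot, bot_inf_eq]
  refine ⟨C ⊓ V, inf_le_right, by rw [sup_comm, hsup], ?_⟩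
  have e1 := Submodule.finrank_sup_add_finrank_inf_eq S (C ⊓ V)
  have e2 := Submodule.finrank_sup_add_finrank_inf_eq V' (R ⊓ V)
  rw [hsup, hinf, finrank_bot] at e1
  have e3 : V' ⊓ (R ⊓ V) = R ⊓ V' := by
    rw [inf_left_comm, inf_eq_left.mpr hV]
  rw [e3] at e2
  change Module.finrank K S + _ = _ at e2
  change _ = Module.finrank K V + _
  omega

open MvPolynomial in
/-- The elements of `U` that are congruent to `1` modulo the `k`-th step of the filtration are
products of an element of a family depending polynomially on parameters and an element centralizing
the form; the number of parameters is the codimension of the radical. -/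
theorem exists_parametrization (h2 : (2 : K) ≠ 0) (ξ : D → K) (j : ℕ) :
    ∀ k, 1 ≤ k → X.size n ≤ k + j → ∃ (ι : Type) (_ : Fintype ι)
      (G : Matrix (Fin (X.size n)) (Fin (X.size n)) (MvPolynomial ι K)),
      Fintype.card ι + Module.finrank K ↥(radical D ξ ⊓ nilpotentFiltration X n K k) =
        Module.finrank K (nilpotentFiltration X n K k) ∧
      (∀ t : ι → K, ∃ g : unipotentGroup X n K, g.1.val = G.map (eval t)) ∧
      ∀ g : unipotentGroup X n K, g.1.val - 1 ∈ lowerFiltration (X.size n) K k →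
        ∃ (t : ι → K) (s : unipotentGroup X n K), Centralizes (skewForm D ξ) s.1.val ∧
          g.1.val = G.map (eval t) * s.1.val := by
  induction j with
  | zero =>
    intro k hk hm
    refine ⟨Empty, inferInstance, 1, ?_, fun t => ⟨1, ?_⟩, fun g hg => ⟨fun i => i.elim, 1, ?_, ?_⟩⟩
    · rw [nilpotentFiltration_eq_bot (by omega), inf_bot_eq]
      simp
    · exact (map_one (eval t).mapMatrix).symm
    · exact Centralizes.one
    · rw [sub_eq_zero.mp (eq_zero_of_mem_lowerFiltration (by omega) hg)]
      refine Eq.trans ?_ (congrArg (· * (1 : Matrix (Fin (X.size n)) (Fin (X.size n)) K))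
        (map_one (eval fun i : Empty => i.elim).mapMatrix).symm)
      exact (mul_one 1).symm
  | succ j ih =>
    intro k hk hm
    obtain ⟨ι, _, G, hcard, hU, hfac⟩ := ih (k + 1) (by omega) (by omega)
    obtain ⟨W, hW, hsup, hdim⟩ := exists_complement (radical D ξ) k
    have : Module.Free K W := Module.Free.of_divisionRing K W
    let b := Module.finBasis K W
    let B : Matrix (Fin (X.size n)) (Fin (X.size n))
      (MvPolynomial (Fin (Module.finrank K W) ⊕ ι) K) :=
        ∑ i, (MvPolynomial.X (Sum.inl i) : MvPolynomial (Fin (Module.finrank K W) ⊕ ι) K) •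
          (b i).1.1.map C
    have hB : ∀ t : Fin (Module.finrank K W) ⊕ ι → K,
        B.map (eval t) = (∑ i, t (Sum.inl i) • b i).1.1 := by
      intro t
      ext x y
      simp only [B, Matrix.map_apply, Matrix.sum_apply, Matrix.smul_apply, map_sum, smul_eq_mul,
        map_mul, eval_X, eval_C, Submodule.coe_sum, Submodule.coe_smul]
    have hG : ∀ t : Fin (Module.finrank K W) ⊕ ι → K,
        (cayley B * G.map (rename Sum.inr)).map (eval t) =
          cayley (∑ i, t (Sum.inl i) • b i).1.1 * G.map (eval (t ∘ Sum.inr)) := by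
      intro t
      rw [Matrix.map_mul, cayley_map, hB]
      congr 1
      ext x y
      simp only [Matrix.map_apply, eval_rename]
    refine ⟨Fin (Module.finrank K W) ⊕ ι, inferInstance, cayley B * G.map (rename Sum.inr),
      ?_, fun t => ?_, fun g hg => ?_⟩
    · rw [Fintype.card_sum, Fintype.card_fin]
      omega
    · obtain ⟨g, h⟩ := hU (t ∘ Sum.inr)
      refine ⟨cayleyUnit (∑ i, t (Sum.inl i) • b i).1 * g, ?_⟩
      rw [hG, ← h]
      rfl
    · obtain ⟨u, hu, hgu⟩ := exists_leading_term h2 hk hg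
      obtain ⟨w, hw, x, hx, rfl⟩ := Submodule.mem_sup.mp (hsup hu)
      obtain ⟨v, hv, ρ, hρ, rfl⟩ := Submodule.mem_sup.mp hx
      -- `cayley x` has the leading term `2x`
      have half : ∀ x : nilpotentAlgebra X n K, (2 : K) • ((2 : K)⁻¹ • x) = x := fun x => by
        rw [smul_smul, mul_inv_cancel₀ h2, one_smul]
      have hw2 : (2 : K)⁻¹ • w ∈ W := Submodule.smul_mem _ _ hw
      have hρ2 := Submodule.smul_mem _ (2 : K)⁻¹ hρ
      rw [← add_assoc, ← half w, ← half ρ] at hgu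
      obtain ⟨t, s, hs, hts⟩ := hfac _ (adjust_leading_term hk hg (hW hw2) hρ2.2 hv hgu)
      refine ⟨Sum.elim (b.repr ⟨_, hw2⟩) t, s * cayleyUnit ((2 : K)⁻¹ • ρ), ?_, ?_⟩
      · exact hs.mul (centralizes_cayley hρ2.1) (unipotentGroup_val_mem s.2)
          (unipotentGroup_val_mem (cayleyUnit _).2)
      · rw [hG]
        simp only [Sum.elim_inl, b.sum_repr]
        have e : g = cayleyUnit ((2 : K)⁻¹ • w) *
          ((cayleyUnit ((2 : K)⁻¹ • w))⁻¹ * g * (cayleyUnit ((2 : K)⁻¹ • ρ))⁻¹) *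
            cayleyUnit ((2 : K)⁻¹ • ρ) := by group
        have e' := congrArg (fun g : unipotentGroup X n K => g.1.val) e
        refine e'.trans ?_
        simp only [Subgroup.coe_mul, Units.val_mul] at hts ⊢
        rw [hts, Sum.elim_comp_inr]
        simp only [mul_assoc]
        rfl

end

/-! ### The dimension of the orbit -/

section

open PosRoot Matrix

namespace Matrix

variable {m : ℕ} {K : Type*} [Field K]

/-- The extension of a linear form on matrices to matrices over a `K`-algebra. -/
def extendForm (L : Matrix (Fin m) (Fin m) K →ₗ[K] K) {A : Type*} [CommRing A] [Algebra K A]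
    (x : Matrix (Fin m) (Fin m) A) : A :=
  ∑ i, ∑ j, L (single i j 1) • x i j

theorem map_extendForm (L : Matrix (Fin m) (Fin m) K →ₗ[K] K) {A : Type*} [CommRing A]
    [Algebra K A] (φ : A →ₗ[K] K) (x : Matrix (Fin m) (Fin m) A) :
    φ (extendForm L x) = L (x.map φ) := by
  conv_rhs => rw [matrix_eq_sum_single (x.map φ)]
  simp only [extendForm, map_sum, map_smul]
  refine Finset.sum_congr rfl fun i _ => Finset.sum_congr rfl fun j _ => ?_
  rw [← mul_one ((x.map φ) i j), ← smul_eq_mul ((x.map φ) i j) 1, ← smul_single, map_smul,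
    smul_eq_mul, smul_eq_mul, mul_comm]
  rfl

open Polynomial in
theorem map_coeff_zero_mul (x y : Matrix (Fin m) (Fin m) K[X]) :
    (x * y).map (lcoeff K 0) = x.map (lcoeff K 0) * y.map (lcoeff K 0) := by
  ext i j
  simp only [map_apply, mul_apply, map_sum, lcoeff_apply, mul_coeff_zero]

open Polynomial in
theorem map_coeff_one_mul (x y : Matrix (Fin m) (Fin m) K[X]) :
    (x * y).map (lcoeff K 1) =
      x.map (lcoeff K 0) * y.map (lcoeff K 1) + x.map (lcoeff K 1) * y.map (lcoeff K 0) := by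
  ext i j
  simp only [map_apply, mul_apply, map_sum, lcoeff_apply, mul_coeff_one, Finset.sum_add_distrib,
    Matrix.add_apply]

/-- The Cayley transform agrees with `1 + 2x` up to a multiple of `x²`. -/
theorem exists_cayley_eq {A : Type*} [CommRing A] (x : Matrix (Fin m) (Fin m) A) :
    ∃ y, cayley x = 1 + (2 : A) • x + x * x * y := by
  have h : geomSeries x = 1 + x + x * x * ∑ k ∈ Finset.range m, x ^ k := by
    rw [geomSeries, Finset.sum_range_succ', Finset.sum_range_succ', Finset.mul_sum]
    simp only [pow_zero, zero_add, pow_one, ← pow_two, ← pow_add]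
    rw [add_assoc, add_comm, add_comm x]
    congr 1
    exact Finset.sum_congr rfl fun k _ => by rw [add_assoc, add_comm]
  set s := ∑ k ∈ Finset.range m, x ^ k
  refine ⟨1 + s + x * s, ?_⟩
  rw [cayley, h, two_smul]
  noncomm_ring

open Polynomial in
theorem cayley_X_smul_coeff (a : Matrix (Fin m) (Fin m) K) :
    (cayley ((X : K[X]) • a.map C)).map (lcoeff K 0) = 1 ∧
      (cayley ((X : K[X]) • a.map C)).map (lcoeff K 1) = (2 : K) • a := by
  obtain ⟨y, hy⟩ := exists_cayley_eq ((X : K[X]) • a.map C)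
  have hadd : ∀ (k : ℕ) (x y : Matrix (Fin m) (Fin m) K[X]),
      (x + y).map (lcoeff K k) = x.map (lcoeff K k) + y.map (lcoeff K k) := fun k x y => by
    ext i j
    simp
  have h0 : ((X : K[X]) • a.map C).map (lcoeff K 0) = 0 := by
    ext i j
    simp
  have h1 : ((2 : K[X]) • (X : K[X]) • a.map C).map (lcoeff K 0) = 0 := by
    ext i j
    simp [← C_ofNat]
  have h2 : ((2 : K[X]) • (X : K[X]) • a.map C).map (lcoeff K 1) = (2 : K) • a := by
    ext i j
    simp [← C_ofNat]
  have o0 : (1 : Matrix (Fin m) (Fin m) K[X]).map (lcoeff K 0) = 1 := by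
    ext i j
    by_cases h : i = j
    · subst h; simp
    · simp [one_apply_ne h]
  have o1 : (1 : Matrix (Fin m) (Fin m) K[X]).map (lcoeff K 1) = 0 := by
    ext i j
    by_cases h : i = j
    · subst h; simp [coeff_one]
    · simp [one_apply_ne h]
  constructor
  · rw [hy, hadd, hadd,
      map_coeff_zero_mul, map_coeff_zero_mul, h0, h1, o0]
    simp
  · rw [hy, hadd, hadd,
      map_coeff_one_mul, map_coeff_zero_mul, map_coeff_one_mul, h0, h2, o1]
    simp

end Matrix

variable {X : OrthType} {n : ℕ} {K : Type*} [Field K] {D : Finset (PosRoot X n)}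

/-- The orbit `Ω_{D,ξ}` in the coordinates `h ↦ h(e_α)`. -/
def orbitCoordinates (D : Finset (PosRoot X n)) (ξ : D → K) : Set (PosRoot X n → K) :=
  (fun (h : Module.Dual K (nilpotentAlgebra X n K)) (α : PosRoot X n) => h (α.rootVector K)) ''
    associatedOrbit D ξ

theorem rootVector_eq_skewUnit (α : PosRoot X n) :
    α.rootVector K = skewUnit K α.colIndex_lt_rowIndex := rfl

/-- The Cayley transforms of the multiples of `w ∈ 𝔲` move `f_{D,ξ}` along a polynomial curve whose
derivative at `0` is the linear form `e ↦ -2 f_{D,ξ}([w, e])`. -/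
theorem exists_curve (h2 : (2 : K) ≠ 0) (ξ : D → K) (w : nilpotentAlgebra X n K) :
    ∃ γ : PosRoot X n → Polynomial K,
      (∀ s : K, (fun α => (γ α).eval s) ∈ orbitCoordinates D ξ) ∧
      ∀ α, (γ α).coeff 0 = canonicalForm D ξ (α.rootVector K) ∧
        (γ α).coeff 1 = -2 * pairingForm D ξ α.colIndex α.rowIndex w := by
  let E : PosRoot X n → Matrix (Fin (X.size n)) (Fin (X.size n)) (Polynomial K) := fun α =>
    cayley ((Polynomial.X : Polynomial K) • (-w.1).map Polynomial.C) *
      (α.rootVector K).1.map Polynomial.C *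
      cayley ((Polynomial.X : Polynomial K) • w.1.map Polynomial.C)
  refine ⟨fun α => extendForm ((2 : K)⁻¹ • skewForm D ξ) (E α), fun s => ?_, fun α => ?_⟩
  · refine ⟨_, ⟨cayleyUnit (s • w), rfl⟩, ?_⟩
    funext α
    have hw : ∀ u : Matrix (Fin (X.size n)) (Fin (X.size n)) K,
        (cayley ((Polynomial.X : Polynomial K) • u.map Polynomial.C)).map (Polynomial.evalRingHom s)
          = cayley (s • u) := by
      intro u
      rw [cayley_map]
      congr 1
      ext i j
      simp
      exact mul_comm _ _
    have hE : (E α).map (Polynomial.leval s) =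
        (cayley (s • w.1)).antitranspose * (α.rootVector K).1 * cayley (s • w.1) := by
      change (E α).map (Polynomial.evalRingHom s) = _
      rw [Matrix.map_mul, Matrix.map_mul, hw, hw, antitranspose_cayley, antitranspose_smul,
        (mem_nilpotentAlgebra.mp w.2).2]
      congr 2
      ext i j
      simp
    have h := map_extendForm ((2 : K)⁻¹ • skewForm D ξ) (Polynomial.leval s) (E α)
    rw [hE] at h
    exact (coadjointRep_canonicalForm_apply ξ _ _).trans h.symm
  · obtain ⟨p0, p1⟩ := cayley_X_smul_coeff w.1
    obtain ⟨q0, q1⟩ := cayley_X_smul_coeff (-w.1)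
    have e0 : ((α.rootVector K).1.map Polynomial.C).map (Polynomial.lcoeff K 0) =
        (α.rootVector K).1 := by
      ext i j; simp
    have e1 : ((α.rootVector K).1.map Polynomial.C).map (Polynomial.lcoeff K 1) = 0 := by
      ext i j; simp
    constructor
    · have h := map_extendForm ((2 : K)⁻¹ • skewForm D ξ) (Polynomial.lcoeff K 0) (E α)
      rw [map_coeff_zero_mul, map_coeff_zero_mul, p0, q0, e0, one_mul, mul_one] at h
      exact h.trans (canonicalForm_apply ξ _).symm
    · have h := map_extendForm ((2 : K)⁻¹ • skewForm D ξ) (Polynomial.lcoeff K 1) (E α)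
      rw [map_coeff_one_mul, map_coeff_one_mul, map_coeff_zero_mul, p0, q0, e0, p1, q1, e1,
        one_mul, mul_one, mul_zero, zero_add] at h
      refine h.trans ?_
      have h3 := skewForm_commutator_skewUnit ξ w α.colIndex_lt_rowIndex
      rw [← rootVector_eq_skewUnit] at h3
      have h4 : (α.rootVector K).1 * (2 : K) • w.1 + (2 : K) • -w.1 * (α.rootVector K).1 =
          (-2 : K) • (w.1 * (α.rootVector K).1 - (α.rootVector K).1 * w.1) := by
        rw [mul_smul_comm, smul_mul_assoc, neg_mul, neg_smul, smul_sub, smul_neg]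
        abel
      rw [h4, map_smul, LinearMap.smul_apply, h3, smul_eq_mul, smul_eq_mul]
      field_simp

theorem PosRoot.IsAt.pairingForm_eq {α : PosRoot X n} {x y : Fin (X.size n)} (h : α.IsAt x y)
    (ξ : D → K) : ∃ ε : K, ε * ε = 1 ∧ ∀ u,
      pairingForm D ξ α.colIndex α.rowIndex u = ε * pairingForm D ξ x y u := by
  rcases h with ⟨h1, h2⟩ | ⟨h1, h2⟩
  · exact ⟨1, one_mul 1, fun u => by rw [h1, h2, one_mul]⟩
  · exact ⟨-1, by ring, fun u => by rw [h1, h2, pairingForm_rev, neg_one_mul]⟩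

variable [Infinite K]

/-- The coordinates of the orbit at the members of the distinguished decompositions are
algebraically independent. -/
theorem le_varietyDim_orbitCoordinates (h2 : (2 : K) ≠ 0) (hD : IsOrthogonalRookPlacement D)
    {ξ : D → K} (hξ : ∀ β, ξ β ≠ 0) :
    ((2 * (decompositions D).card : ℕ) : Cardinal) ≤ varietyDim (orbitCoordinates D ξ) := by
  have hl : ∀ s : decompositions D, ∃ α : PosRoot X n, α.IsAt s.1.1.colIndex s.1.2 := fun s => by
    obtain ⟨-, h1, h2, -, -⟩ := mem_decompositions.mp s.2
    exact exists_isAt h1 (h2.trans s.1.1.rowIndex_lt_rev_colIndex).ne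
  have hr : ∀ s : decompositions D, ∃ α : PosRoot X n, α.IsAt s.1.2 s.1.1.rowIndex := fun s => by
    obtain ⟨-, h1, h2, h3, -⟩ := mem_decompositions.mp s.2
    exact exists_isAt h2 fun e => h3 (by rw [e, Fin.rev_rev])
  choose αl hαl using hl
  choose αr hαr using hr
  choose εl hεl hl using fun s => (hαl s).pairingForm_eq ξ
  choose εr hεr hr using fun s => (hαr s).pairingForm_eq ξ
  have h := card_le_varietyDim (orbitCoordinates D ξ) (Sum.elim αl αr)
    (fun j => canonicalForm D ξ ((Sum.elim αl αr j).rootVector K)) fun b => by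
      obtain ⟨w, hw⟩ := decompositionMap_surjective h2 hD hξ
        (fun s => -(εl s * b (Sum.inl s)) * 2⁻¹, fun s => -(εr s * b (Sum.inr s)) * 2⁻¹)
      have hw1 := fun s => congrFun (congrArg Prod.fst hw) s
      have hw2 := fun s => congrFun (congrArg Prod.snd hw) s
      simp only [decompositionMap_fst, decompositionMap_snd] at hw1 hw2
      obtain ⟨γ, hγ, hj⟩ := exists_curve h2 ξ w
      refine ⟨γ, hγ, ?_⟩
      rintro (s | s)
      · refine ⟨(hj _).1, (hj _).2.trans ?_⟩
        rw [Sum.elim_inl, hl, hw1]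
        have e := hεl s
        field_simp
        linear_combination b (Sum.inl s) * e
      · refine ⟨(hj _).1, (hj _).2.trans ?_⟩
        rw [Sum.elim_inr, hr, hw2]
        have e := hεr s
        field_simp
        linear_combination b (Sum.inr s) * e
  rwa [Fintype.card_sum, Fintype.card_coe, ← two_mul] at h

/-- The orbit is the image of an affine space under a polynomial map, because factors that
centralize the form do not move it. -/
theorem varietyDim_orbitCoordinates_le (h2 : (2 : K) ≠ 0) (hD : IsOrthogonalRookPlacement D)
    {ξ : D → K} (hξ : ∀ β, ξ β ≠ 0) :
    varietyDim (orbitCoordinates D ξ) ≤ ((2 * (decompositions D).card : ℕ) : Cardinal) := by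
  obtain ⟨ι, _, G, hcard, hU, hfac⟩ :=
    exists_parametrization h2 ξ (X.size n) 1 le_rfl (Nat.le_add_left _ _)
  rw [nilpotentFiltration_one, inf_top_eq, finrank_top, ← finrank_radical h2 hD hξ] at hcard
  have hι : Fintype.card ι = 2 * (decompositions D).card := by omega
  rw [← hι]
  let φ : PosRoot X n → MvPolynomial ι K := fun α =>
    extendForm ((2 : K)⁻¹ • skewForm D ξ)
      (G.antitranspose * (α.rootVector K).1.map MvPolynomial.C * G)
  have hφ : ∀ (t : ι → K) (g : unipotentGroup X n K), g.1.val = G.map (MvPolynomial.eval t) →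
      ∀ α, MvPolynomial.eval t (φ α) =
        coadjointRep X n K g (canonicalForm D ξ) (α.rootVector K) := by
    intro t g hg α
    have h := map_extendForm ((2 : K)⁻¹ • skewForm D ξ) (MvPolynomial.aeval t).toLinearMap
      (G.antitranspose * (α.rootVector K).1.map MvPolynomial.C * G)
    have e : (G.antitranspose * (α.rootVector K).1.map MvPolynomial.C * G).map
        (MvPolynomial.aeval t).toLinearMap =
        g.1.val.antitranspose * (α.rootVector K).1 * g.1.val := by
      change (G.antitranspose * (α.rootVector K).1.map MvPolynomial.C * G).map
        (MvPolynomial.eval t) = _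
      rw [Matrix.map_mul, Matrix.map_mul, antitranspose_map, ← hg]
      congr 2
      ext i j
      simp
    rw [e] at h
    exact h.trans (coadjointRep_canonicalForm_apply ξ g _).symm
  have horb : orbitCoordinates D ξ =
      Set.range fun (t : ι → K) (α : PosRoot X n) => MvPolynomial.eval t (φ α) := by
    apply Set.Subset.antisymm
    · rintro _ ⟨_, ⟨g, rfl⟩, rfl⟩
      obtain ⟨t, s, hs, hg⟩ := hfac g (mem_unipotentGroup.mp g.2).1
      obtain ⟨g', hg'⟩ := hU t
      refine ⟨t, funext fun α => ?_⟩
      have e : g = g' * s := Subtype.ext (Units.ext (by rw [hg, ← hg']; rfl))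
      have hs' := (coadjointRep_canonicalForm_eq_iff h2 ξ s).mpr hs
      refine (hφ t g' hg' α).trans ?_
      simp only [e, map_mul, Module.End.mul_apply, hs']
    · rintro _ ⟨t, rfl⟩
      obtain ⟨g, hg⟩ := hU t
      exact ⟨_, ⟨g, rfl⟩, funext fun α => (hφ t g hg α).symm⟩
  rw [horb]
  exact varietyDim_range_le φ

theorem orbitDim_eq {F : Type*} [Field F] (h2 : (2 : F) ≠ 0) (hD : IsOrthogonalRookPlacement D)
    {ξ : D → F} (hξ : ∀ β, ξ β ≠ 0) :
    orbitDim D ξ = ((2 * (decompositions D).card : ℕ) : Cardinal) := by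
  have h2' : (2 : AlgebraicClosure F) ≠ 0 := by
    rw [← map_ofNat (algebraMap F (AlgebraicClosure F))]
    exact (map_ne_zero _).mpr h2
  have hξ' : ∀ β, algebraMap F (AlgebraicClosure F) (ξ β) ≠ 0 := fun β =>
    (map_ne_zero _).mpr (hξ β)
  have : Infinite (AlgebraicClosure F) := IsAlgClosed.instInfinite
  exact le_antisymm (varietyDim_orbitCoordinates_le h2' hD hξ')
    (le_varietyDim_orbitCoordinates h2' hD hξ')

end

/-- Let `Φ` be `B_n` or `D_n`, let `D ⊆ Φ⁺` be an orthogonal rook placement and `σ` the involution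
with support `D`. Then `l(σ) - s(σ) - 2d(σ)` is the dimension of every orbit `Ω_{D,ξ}` over a finite
field with `q` elements of characteristic `p ≥ n`, `p ≠ 2`, whatever the nonzero scalars `ξ`; and
each such orbit has `q ^ dim Ω_{D,ξ}` points over this field. -/
theorem theorem5p5 (X : OrthType) (n : ℕ) (F : Type*) [Field F] [Fintype F]
    (p : ℕ) [Fact p.Prime] [CharP F p] (hp2 : p ≠ 2) (hpn : n ≤ p)
    (D : Finset (PosRoot X n)) (hD : IsOrthogonalRookPlacement D) :
    ∃ k : ℕ,
      (k : ℤ) = (coxeterLength X n (supportInvolution D) : ℤ)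
        - (reflectionLength X n (supportInvolution D) : ℤ) - 2 * (dNumber D : ℤ) ∧
      ∀ ξ : D → F, (∀ β, ξ β ≠ 0) →
        orbitDim D ξ = (k : Cardinal) ∧
        (associatedOrbit D ξ).ncard = Fintype.card F ^ k := by
  have h2 : (2 : F) ≠ 0 := Ring.two_ne_zero (by rwa [ringChar.eq F p])
  refine ⟨2 * (decompositions D).card, ?_, fun ξ hξ =>
    ⟨orbitDim_eq h2 hD hξ, ncard_associatedOrbit h2 hD hξ⟩⟩
  rw [coxeterLength_supportInvolution, inversions_supportPerm hD,
    reflectionLength_supportInvolution hD]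
  push_cast
  ring
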